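/- **Setting.** Let $d\ge 1$, let $\mathcal X,\mathcal Z\subset\mathbb R^d$ be finite with $\mathrm{span}(\mathcal X)=\mathbb R^d$, let $\Sigma^*\in\mathbb R^{d\times d}$ be an unknown positive semidefinite matrix, $\sigma_x^2=x^\top\Sigma^*x$, and suppose $0<\sigma_{\min}^2\le\sigma_x^2\le\sigma_{\max}^2$ for all $x\in\mathcal X$ with known $\sigma_{\min}^2,\sigma_{\max}^2$; put $\kappa=\sigma_{\max}^2/\sigma_{\min}^2$. A pull of $x\in\mathcal X$ returns $x^\top\theta^*+\eta$ with unknown $\theta^*\in\mathbb R^d$ and with independent, centered noise $\eta$ that is strictly sub-Gaussian (variance $\sigma_x^2$ and $\mathbb E e^{s\eta}\le e^{s^2\sigma_x^2/2}$ for all real $s$; e.g. $\mathcal N(0,\sigma_x^2)$). Let $\delta\in(0,1)$; if $|\mathcal X|=1$, assume also that $\delta\le 1/2$ or $\sigma_{\min}^2=\sigma_{\max}^2$. **Objectives.** For best-arm identification (BAI) the target is $\mathcal H=\{z^*\}$, $z^*=\arg\max_{z\in\mathcal Z}z^\top\theta^*$ (assumed unique); put $\mathcal V=\{z^*-z: z\in\mathcal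 Z, z\ne z^*\}$, $b=0$. For level-set identification (LS) with threshold $\alpha\in\mathbb R$ the target is $\mathcal H=\{z\in\mathcal Z: z^\top\theta^*>\alpha\}$ (assuming $z^\top\theta^*\ne\alpha$ for all $z\in\mathcal Z$); put $\mathcal V=\mathcal Z$, $b=\alpha$. Let $P_{\mathcal X}$ be the probability vectors on $\mathcal X$, $$\psi^*=\min_{\lambda\in P_{\mathcal X}}\max_{v\in\mathcal V}\frac{\|v\|^2_{(\sum_x\lambda_x\sigma_x^{-2}xx^\top)^{-1}}}{(v^\top\theta^*-b)^2},\qquad \Delta=\min_{v\in\mathcal V}|v^\top\theta^*-b|,\qquad L=\max\{\log(\Delta^{-1}),2\}.$$ (For positive semidefinite $A$, $\|v\|^2_{A^{-1}}$ is $v^\top w$ for any $w$ with $Aw=v$, and $\infty$ if there is none.) **Algorithm H-RAGE** with burn-in constant $c$. *Burn-in* with budget $\Gamma=2N$, $N=\lceil c\,\kappa^2d^2\log(|\mathcal X|/\delta)\rceil$: (1) pull each $x$ exactly $\lceil N\lambda^*_x\rceil$ times, where $\lambda^*\in P_{\mathcal X}$ minimizes $\max_{x\in\mathcal X}\|x\|^2_{(\sum_{x'}\lambda_{x'}x'x'^\top)^{-1}}$,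 and let $\widehat\theta$ be the least squares estimate of $\theta^*$; (2) let $\phi_x\in\mathbb R^{d(d+1)/2}$ be such that $\phi_x^\top\mathrm{vech}(S)=x^\top Sx$ for symmetric $S$; pull each $x$ exactly $n_x$ times, where $(n_x)$ is a nonnegative integer allocation with $\sum_xn_x\le N$ which, among all such allocations, minimizes $\max_{x}\|\phi_x\|^2_{(\sum_{x'} n_{x'}\phi_{x'}\phi_{x'}^\top)^{-1}}$ up to a factor $3$; let $\widehat s$ be the least squares fit of the squared residuals $(y-x^\top\widehat\theta)^2$ by $\phi_x^\top s$, and $\widehat\sigma_x^2=\min\{\max\{\phi_x^\top\widehat s,\sigma_{\min}^2\},\sigma_{\max}^2\}$. *Elimination:* start with $\mathcal Z_1=\mathcal Z$, $\mathcal G_1=\mathcal B_1=\emptyset$. In round $\ell=1,2,\dots$, while $|\mathcal Z_\ell|>1$ (BAI) or $|\mathcal Z_\ell|>0$ (LS), let $\mathcal V_\ell=\{z'-z: z,z'\in\mathcal Z_\ell, z\neq z'\}$ (BAI) or $\mathcal V_\ell=\mathcal Z_\ell$ (LS), let $\widehat\lambda_\ell$ be a minimizer over $P_{\mathcal X}$,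 and $q_\ell$ the minimum, of $\max_{v\in\mathcal V_\ell}\|v\|^2_{(\sum_x\lambda_x\widehat\sigma_x^{-2}xx^\top)^{-1}}$, put $\epsilon_\ell=2^{-\ell}$ and $\tau_\ell=3\epsilon_\ell^{-2}q_\ell\log(8\ell^2|\mathcal Z|/\delta)$, pull each $x$ exactly $\lceil\tau_\ell\widehat\lambda_{\ell,x}\rceil$ times, and let $\widehat\theta_\ell$ be the least squares estimate from these pulls with weights $\widehat\sigma_x^{-2}$. For BAI, $\mathcal Z_{\ell+1}$ is $\mathcal Z_\ell$ without the $z$ for which $\max_{z'\in\mathcal Z_\ell}(z'-z)^\top\widehat\theta_\ell>\epsilon_\ell$. For LS, the $z\in\mathcal Z_\ell$ with $z^\top\widehat\theta_\ell-\epsilon_\ell>\alpha$ are added to $\mathcal G_\ell$, those with $z^\top\widehat\theta_\ell+\epsilon_\ell<\alpha$ to $\mathcal B_\ell$, and both are removed from $\mathcal Z_\ell$. On exit return $\mathcal Z_\ell$ (BAI) or $\mathcal G_\ell$ (LS). The minimizing designs ($\lambda^*$ and $\widehat\lambda_\ell$) are chosen by a rule that is measurable in the variances, and with at most $d(d+1)/2+1$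 support points whenever some minimizer has that few. Let $\tau$ be the total number of pulls. **Theorem.** There is a universal constant $c_0>0$ such that for every $c\ge c_0$ there is a constant $C>0$, depending only on $c$, such that in every such setting, for BAI and for LS: 1. ($\delta$-PAC) for every $\theta^*$ with a unique best item (BAI), respectively with no item on the threshold (LS), H-RAGE stops and returns $\mathcal H$ with probability at least $1-\delta$; 2. if moreover $|v^\top\theta^*-b|\le 2$ for all $v\in\mathcal V$, then with probability at least $1-\delta$ H-RAGE stops, returns $\mathcal H$, and $$\tau\le C\Big(\psi^*\,L\,\big[\log(|\mathcal Z|/\delta)+\log L\big]+L\,d^2+\log(|\mathcal X|/\delta)\,\kappa^2d^2\Big).$$ In particular $\tau=O\big(\psi^*\log(\Delta^{-1})[\log(|\mathcal Z|/\delta)+\log\log(\Delta^{-1})]+\log(\Delta^{-1})d^2+\log(|\mathcal X|/\delta)\kappa^2d^2\big)$ for, say, $\Delta\le e^{-2}$. -/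

import Mathlib

open MeasureTheory ProbabilityTheory
open scoped ENNReal Matrix

namespace HRage

/-! ### Designs -/

/-- Vectors of `ℝ^d`; only the dot product is used on them. -/
abbrev Vec (d : ℕ) := Fin d → ℝ

/-- The weighted design matrix `∑ i, w i • (f i) (f i)ᵀ`. -/
noncomputable def infoMatrix {ι m : Type*} [Fintype ι] (f : ι → m → ℝ) (w : ι → ℝ) :
    Matrix m m ℝ :=
  ∑ i, w i • Matrix.vecMulVec (f i) (f i)

/-- `‖v‖²_{A⁻¹}` for a positive semidefinite matrix `A`, with values in `[0, ∞]`: it is `vᵀ w` for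
any `w` with `A w = v` (so `vᵀ A⁻¹ v` if `A` is invertible), and `∞` if `v` is not in the range
of `A`. -/
noncomputable def invQuad {m : Type*} [Fintype m] (A : Matrix m m ℝ) (v : m → ℝ) : ℝ≥0∞ :=
  ⨅ (w : m → ℝ) (_ : A *ᵥ w = v), ENNReal.ofReal (v ⬝ᵥ w)

/-- A solution `s` of the normal equations `A s = b` (so `A⁻¹ b` if `A` is invertible). -/
noncomputable def solve {m : Type*} [Fintype m] (A : Matrix m m ℝ) (b : m → ℝ) : m → ℝ :=
  Classical.epsilon fun s => A *ᵥ s = b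

/-- `q(lam; V) = max_{v ∈ V} ‖v‖²` in the norm of `(∑ₓ lamₓ sₓ⁻¹ x xᵀ)⁻¹`, for the variances
`s`. -/
noncomputable def designValue {d : ℕ} {X : Finset (Vec d)} (s : X → ℝ) (V : Finset (Vec d))
    (lam : X → ℝ) : ℝ≥0∞ :=
  ⨆ v ∈ V, invQuad (infoMatrix (fun x : X => (x : Vec d)) fun x => lam x / s x) v

/-- `q(V) = inf_{lam ∈ P_X} q(lam; V)`. -/
noncomputable def optValue {d : ℕ} {X : Finset (Vec d)} (s : X → ℝ) (V : Finset (Vec d)) : ℝ≥0∞ :=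
  ⨅ lam ∈ stdSimplex ℝ X, designValue s V lam

/-- `lam` is a design minimizing `q(·; V)`. -/
def IsOptDesign {d : ℕ} {X : Finset (Vec d)} (s : X → ℝ) (V : Finset (Vec d))
    (lam : X → ℝ) : Prop :=
  lam ∈ stdSimplex ℝ X ∧ ∀ mu ∈ stdSimplex ℝ X, designValue s V lam ≤ designValue s V mu

/-- The number of support points of a design. -/
noncomputable def supportSize {d : ℕ} {X : Finset (Vec d)} (lam : X → ℝ) : ℕ :=
  {x : X | lam x ≠ 0}.ncard

/-- Index set of the half-vectorization; it has `d (d + 1) / 2` elements. -/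
abbrev HalfIdx (d : ℕ) := {p : Fin d × Fin d // p.1 ≤ p.2}

/-- `φ_x = Gᵀ vec(x xᵀ)` with `G` the duplication matrix, so that `φ_xᵀ vech(S) = xᵀ S x` for
symmetric `S`. -/
noncomputable def phi {d : ℕ} (x : Vec d) : HalfIdx d → ℝ :=
  fun p => if p.1.1 = p.1.2 then x p.1.1 * x p.1.2 else 2 * (x p.1.1 * x p.1.2)

/-- The G-criterion `max_{x ∈ X} φ_xᵀ (∑ₓ nₓ φ_x φ_xᵀ)⁻¹ φ_x` of an integer allocation. -/
noncomputable def phiValue {d : ℕ} {X : Finset (Vec d)} (n : X → ℕ) : ℝ≥0∞ :=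
  ⨆ x : X, invQuad (infoMatrix (fun x : X => phi (x : Vec d)) fun x => (n x : ℝ)) (phi (x : Vec d))

/-! ### The identification problem -/

/-- The objective: best-arm identification, or level-set identification with a threshold. -/
inductive Objective where
  | bai : Objective
  | ls (α : ℝ) : Objective

/-- The set to be identified: the maximizers of `zᵀ θ`, or `{z ∈ Z : zᵀ θ > α}`. -/
noncomputable def target {d : ℕ} (obj : Objective) (Z : Finset (Vec d)) (θ : Vec d) :
    Finset (Vec d) :=
  open Classical in
  match obj with
  | .bai => Z.filter fun z => ∀ z' ∈ Z, z' ⬝ᵥ θ ≤ z ⬝ᵥ θ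
  | .ls α => Z.filter fun z => α < z ⬝ᵥ θ

/-- The objective is well posed at `θ`: the best item is unique, or no item is on the threshold. -/
def WellPosed {d : ℕ} (obj : Objective) (Z : Finset (Vec d)) (θ : Vec d) : Prop :=
  match obj with
  | .bai => ∃ z, target .bai Z θ = {z}
  | .ls α => ∀ z ∈ Z, z ⬝ᵥ θ ≠ α

/-- The directions to be decided: all `z* - z` with `z ≠ z*`, or all items. -/
noncomputable def directions {d : ℕ} (obj : Objective) (Z : Finset (Vec d)) (θ : Vec d) :
    Finset (Vec d) :=
  open Classical in
  match obj with
  | .bai => ((target .bai Z θ ×ˢ Z).filter fun p => p.2 ≠ p.1).image fun p => p.1 - p.2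
  | .ls _ => Z

/-- The constant `b`: `0`, or the threshold. -/
def Objective.offset : Objective → ℝ
  | .bai => 0
  | .ls α => α

/-- The minimum gap `Δ = min_v |vᵀ θ - b|` over the directions to be decided. -/
noncomputable def gap {d : ℕ} (obj : Objective) (Z : Finset (Vec d)) (θ : Vec d) : ℝ :=
  ⨅ v : directions obj Z θ, |(v : Vec d) ⬝ᵥ θ - obj.offset|

/-- The variance `σₓ² = xᵀ S x`. -/
def armVar {d : ℕ} (S : Matrix (Fin d) (Fin d) ℝ) (x : Vec d) : ℝ := x ⬝ᵥ S *ᵥ x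

/-- `ψ* = min_{lam ∈ P_X} max_v ‖v‖²_{(∑ₓ lamₓ σₓ⁻² x xᵀ)⁻¹} / (vᵀ θ - b)²`. -/
noncomputable def psiStar {d : ℕ} (obj : Objective) (X Z : Finset (Vec d))
    (S : Matrix (Fin d) (Fin d) ℝ) (θ : Vec d) : ℝ≥0∞ :=
  ⨅ lam ∈ stdSimplex ℝ X, ⨆ v ∈ directions obj Z θ,
    invQuad (infoMatrix (fun x : X => (x : Vec d)) fun x => lam x / armVar S x) v /
      ENNReal.ofReal ((v ⬝ᵥ θ - obj.offset) ^ 2)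

/-! ### The algorithm -/

/-- What the learner is given: arms, items, objective, variance bounds, confidence, and the
constant `c` of the burn-in budget. -/
structure Input (d : ℕ) where
  X : Finset (Vec d)
  Z : Finset (Vec d)
  obj : Objective
  vmin : ℝ
  vmax : ℝ
  δ : ℝ
  c : ℝ

/-- The subroutines left open by the pseudocode: the choice of a minimizing design for given
variances and a given set of directions, and the rounded integer allocation of a given size for
the second stage of the variance estimation. -/
structure Choices {d : ℕ} (X : Finset (Vec d)) where
  design : (X → ℝ) → Finset (Vec d) → X → ℝ
  alloc : ℕ → X → ℕ

/-- What is asked of the subroutines. The chosen design is a minimizer, measurable in the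
variances, with at most `d (d + 1) / 2 + 1` support points if some minimizer has that few. The
allocation uses at most `N` pulls and is optimal for the G-criterion among these up to the factor
`3 = 1 + 6 ε`, `ε = 1 / 3`; a rounding that is `(1 + 6 ε)`-optimal with respect to the relaxed
problem of real-valued allocations, `ε ≤ 1 / 3`, has this property. -/
structure Choices.Valid {d : ℕ} {X : Finset (Vec d)} (R : Choices X) : Prop where
  opt : ∀ s : X → ℝ, (∀ x, 0 < s x) → ∀ V, IsOptDesign s V (R.design s V)
  sparse : ∀ s : X → ℝ, (∀ x, 0 < s x) → ∀ V mu, IsOptDesign s V mu →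
    supportSize mu ≤ d * (d + 1) / 2 + 1 → supportSize (R.design s V) ≤ d * (d + 1) / 2 + 1
  measurable : ∀ V, Measurable fun s => R.design s V
  alloc_le : ∀ N, ∑ x, R.alloc N x ≤ N
  alloc_opt : ∀ N (n : X → ℕ), ∑ x, n x ≤ N → phiValue (R.alloc N) ≤ 3 * phiValue n

/-- Rewards: `y k x i` is the `i`-th reward of arm `x` in phase `k`. Phases `0` and `1` are the two
stages of the variance estimation, phase `ℓ + 1` is round `ℓ ≥ 1` of the elimination. -/
abbrev Rewards {d : ℕ} (X : Finset (Vec d)) := ℕ → X → ℕ → ℝ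

/-- `κ`, from the variance bounds. -/
noncomputable def Input.kappa {d : ℕ} (I : Input d) : ℝ := I.vmax / I.vmin

/-- Half of the burn-in budget, `Γ / 2 = ⌈c κ² d² log(|X| / δ)⌉`. -/
noncomputable def Input.half {d : ℕ} (I : Input d) : ℕ :=
  ⌈I.c * I.kappa ^ 2 * (d : ℝ) ^ 2 * Real.log (I.X.card / I.δ)⌉₊

/-- Stage 1 of the variance estimation: pulls according to the G-optimal design on `X`. -/
noncomputable def stageOnePulls {d : ℕ} (I : Input d) (R : Choices I.X) (x : I.X) : ℕ :=
  ⌈R.design (fun _ => 1) I.X x * I.half⌉₊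

/-- Stage 1: the least squares estimate of `θ`. -/
noncomputable def stageOneTheta {d : ℕ} (I : Input d) (R : Choices I.X) (y : Rewards I.X) : Vec d :=
  solve (infoMatrix (fun x : I.X => (x : Vec d)) fun x => (stageOnePulls I R x : ℝ))
    (∑ x : I.X, ∑ i ∈ Finset.range (stageOnePulls I R x), y 0 x i • (x : Vec d))

/-- Stage 2: the least squares estimate of `vech(Σ)` from the squared residuals. -/
noncomputable def stageTwoFit {d : ℕ} (I : Input d) (R : Choices I.X) (y : Rewards I.X) :
    HalfIdx d → ℝ :=
  solve (infoMatrix (fun x : I.X => phi (x : Vec d)) fun x => (R.alloc I.half x : ℝ))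
    (∑ x : I.X, ∑ i ∈ Finset.range (R.alloc I.half x),
      (y 1 x i - (x : Vec d) ⬝ᵥ stageOneTheta I R y) ^ 2 • phi (x : Vec d))

/-- The variance estimates, truncated to the known range. -/
noncomputable def varEst {d : ℕ} (I : Input d) (R : Choices I.X) (y : Rewards I.X) (x : I.X) : ℝ :=
  min (max (phi (x : Vec d) ⬝ᵥ stageTwoFit I R y) I.vmin) I.vmax

/-- The undecided items, and the items declared above and below the threshold. -/
structure State (d : ℕ) where
  active : Finset (Vec d)
  good : Finset (Vec d)
  bad : Finset (Vec d)

/-- The set the round is designed for: `{v' - v : v, v' ∈ Z_ℓ, v ≠ v'}`, or `Z_ℓ`. -/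
noncomputable def roundSet {d : ℕ} (obj : Objective) (A : Finset (Vec d)) : Finset (Vec d) :=
  open Classical in
  match obj with
  | .bai => A.offDiag.image fun p => p.2 - p.1
  | .ls _ => A

/-- The accuracy `ε_ℓ = 2^{-ℓ}`. -/
noncomputable def eps (ℓ : ℕ) : ℝ := (2 ^ ℓ)⁻¹

/-- `τ_ℓ = 3 ε_ℓ⁻² q(·) log(8 ℓ² |Z| / δ)`. -/
noncomputable def roundTau {d : ℕ} (I : Input d) (R : Choices I.X) (y : Rewards I.X)
    (ℓ : ℕ) (st : State d) : ℝ :=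
  3 * (eps ℓ ^ 2)⁻¹ * (optValue (varEst I R y) (roundSet I.obj st.active)).toReal *
    Real.log (8 * (ℓ : ℝ) ^ 2 * I.Z.card / I.δ)

/-- The number of pulls of arm `x` in round `ℓ`. -/
noncomputable def roundPulls {d : ℕ} (I : Input d) (R : Choices I.X) (y : Rewards I.X)
    (ℓ : ℕ) (st : State d) (x : I.X) : ℕ :=
  ⌈roundTau I R y ℓ st * R.design (varEst I R y) (roundSet I.obj st.active) x⌉₊

/-- The weighted least squares estimate of round `ℓ`. -/
noncomputable def roundTheta {d : ℕ} (I : Input d) (R : Choices I.X) (y : Rewards I.X)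
    (ℓ : ℕ) (st : State d) : Vec d :=
  solve (infoMatrix (fun x : I.X => (x : Vec d))
      fun x => (roundPulls I R y ℓ st x : ℝ) / varEst I R y x)
    (∑ x : I.X, ∑ i ∈ Finset.range (roundPulls I R y ℓ st x),
      ((varEst I R y x)⁻¹ * y (ℓ + 1) x i) • (x : Vec d))

/-- The update of the item sets at the end of a round with estimate `θ` and accuracy `ε`. -/
noncomputable def update {d : ℕ} (obj : Objective) (θ : Vec d) (ε : ℝ) (st : State d) : State d :=
  open Classical in
  match obj with
  | .bai =>
    { st with active := st.active.filter fun z => ¬ ∃ z' ∈ st.active, ε < (z' - z) ⬝ᵥ θ }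
  | .ls α =>
    let good := st.good ∪ st.active.filter fun z => α < z ⬝ᵥ θ - ε
    let bad := st.bad ∪ st.active.filter fun z => z ⬝ᵥ θ + ε < α
    ⟨st.active \ ((good \ st.good) ∪ (bad \ st.bad)), good, bad⟩

/-- The state after `j` rounds, that is, at the start of round `j + 1`. -/
noncomputable def state {d : ℕ} (I : Input d) (R : Choices I.X) (y : Rewards I.X) : ℕ → State d
  | 0 => ⟨I.Z, ∅, ∅⟩
  | j + 1 => update I.obj (roundTheta I R y (j + 1) (state I R y j)) (eps (j + 1)) (state I R y j)

/-- The exit condition of the loop. -/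
def Done {d : ℕ} (obj : Objective) (st : State d) : Prop :=
  match obj with
  | .bai => st.active.card ≤ 1
  | .ls _ => st.active.card = 0

/-- The loop is left after exactly `j` rounds. -/
def StopsAfter {d : ℕ} (I : Input d) (R : Choices I.X) (y : Rewards I.X) (j : ℕ) : Prop :=
  Done I.obj (state I R y j) ∧ ∀ i < j, ¬ Done I.obj (state I R y i)

/-- The returned set. -/
def output {d : ℕ} (obj : Objective) (st : State d) : Finset (Vec d) :=
  match obj with
  | .bai => st.active
  | .ls _ => st.good

/-- The total number of pulls if the loop is left after `j` rounds. -/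
noncomputable def totalPulls {d : ℕ} (I : Input d) (R : Choices I.X) (y : Rewards I.X)
    (j : ℕ) : ℕ :=
  ∑ x, stageOnePulls I R x + ∑ x, R.alloc I.half x +
    ∑ i ∈ Finset.range j, ∑ x, roundPulls I R y (i + 1) (state I R y i) x

/-! ### The observations -/

/-- Independent noise; the noise of arm `x` is centered and strictly sub-Gaussian: its variance
`σₓ² = xᵀ S x` is also its variance proxy. Gaussian noise `N(0, σₓ²)` is an example. -/
structure IsNoise {d : ℕ} {X : Finset (Vec d)} {Ω : Type*} [MeasurableSpace Ω] (P : Measure Ω)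
    (S : Matrix (Fin d) (Fin d) ℝ) (η : ℕ → X → ℕ → Ω → ℝ) : Prop where
  measurable : ∀ k x i, Measurable (η k x i)
  indep : iIndepFun (fun p : ℕ × X × ℕ => η p.1 p.2.1 p.2.2) P
  mean : ∀ k x i, ∫ ω, η k x i ω ∂P = 0
  var : ∀ k x i, ∫ ω, η k x i ω ^ 2 ∂P = armVar S x
  subGaussian : ∀ k x i, HasSubgaussianMGF (η k x i) (armVar S x).toNNReal P

/-- The rewards `xᵀ θ + η`. -/
def rewards {d : ℕ} {X : Finset (Vec d)} {Ω : Type*} (θ : Vec d) (η : ℕ → X → ℕ → Ω → ℝ) (ω : Ω) :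
    Rewards X :=
  fun k x i => (x : Vec d) ⬝ᵥ θ + η k x i ω

/-- The sample complexity `ψ* L [log(|Z| / δ) + log L] + L d² + log(|X| / δ) κ² d²`, where `L` is
`log(Δ⁻¹)`, or `2` if that is larger. -/
noncomputable def complexity {d : ℕ} (I : Input d) (S : Matrix (Fin d) (Fin d) ℝ) (θ : Vec d) : ℝ :=
  let L := max (Real.log (gap I.obj I.Z θ)⁻¹) 2
  (psiStar I.obj I.X I.Z S θ).toReal * L * (Real.log (I.Z.card / I.δ) + Real.log L) +
    L * (d : ℝ) ^ 2 + Real.log (I.X.card / I.δ) * I.kappa ^ 2 * (d : ℝ) ^ 2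

end HRage

/-! The failure probability is split in two: δ/2 for the variance estimates
(`Input.Regular.measure_varEst_le`) and δ/2 for all elimination rounds together
(`Input.Regular.measure_iUnion_roundFailure_le`). Outside these two events the rest of the argument
is deterministic.

Variances. Let N be half of the burn-in budget and e_x the error of the first stage at the arm x. A
squared residual is (η - e_x)², so the error of the second fit in direction φ_x is a weighted sum of
three kinds of terms: centered squares η² - σ², cross terms -2eη, and biases e². The weights are
controlled by the G-criterion, at most 6d²/N, because maximizing a determinant over exact designs
makes all leverages comparable (`exists_exact_design`). The squares are sub-exponential, since
variance and variance proxy agree; the cross terms are sub-Gaussian once the first stage is fixed;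
the biases are handled by Cauchy-Schwarz. Each contribution stays below σ_min²/9, hence σ̂² is
within σ_min²/3 of σ², which gives σ² ≤ (3/2) σ̂² and σ̂² ≤ (4/3) σ².

Rounds. Given the earlier phases, the pulls and weights of round ℓ are constants, and weighted least
squares errs by more than ε_ℓ in a given designed direction with probability at most δ/(4ℓ²|Z|). The
union bound runs over the directions z* - z only, at most |Z| of them, although the design covers
all pairs. Conditioning needs measurability: the state is a simple function of the rewards, and the
estimates enter only through pairings expressed by the dual norm.

Complexity. In a run without misjudgements every direction still active in round ℓ has gap at most
4ε_ℓ, so an almost optimal design for ψ* gives it squared dual norm at most about 16 ε_ℓ² ψ*. Every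
designed direction is a difference of two such directions or zero, so τ_ℓ is at most a constant
times ψ* log(8ℓ²|Z|/δ). Rounding up costs one pull per support point, O(d²) by Carathéodory, and
there are at most 3L rounds (`SoundRun.totalPulls_le`). -/

namespace HRage

/-! ### Information matrices and the dual norm -/

section Design

variable {ι m : Type*} [Fintype ι] [Fintype m]

/-- `(vᵀ w)² ≤ K wᵀ A w` for all `w`, where `A` is the information matrix; for `K ≥ 0` and
nonnegative weights this says that `‖v‖²_{A⁻¹} ≤ K`. -/
def QuadBound (f : ι → m → ℝ) (a : ι → ℝ) (v : m → ℝ) (K : ℝ) : Prop :=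
  ∀ w : m → ℝ, (v ⬝ᵥ w) ^ 2 ≤ K * ∑ i, a i * (f i ⬝ᵥ w) ^ 2

theorem infoMatrix_mulVec (f : ι → m → ℝ) (a : ι → ℝ) (w : m → ℝ) :
    infoMatrix f a *ᵥ w = ∑ i, (a i * (f i ⬝ᵥ w)) • f i := by
  unfold infoMatrix
  rw [Matrix.sum_mulVec]
  refine Finset.sum_congr rfl fun i _ => ?_
  rw [Matrix.smul_mulVec, Matrix.vecMulVec_mulVec, mul_smul]
  simp

theorem dotProduct_infoMatrix_mulVec (f : ι → m → ℝ) (a : ι → ℝ) (u w : m → ℝ) :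
    u ⬝ᵥ infoMatrix f a *ᵥ w = ∑ i, a i * (f i ⬝ᵥ u) * (f i ⬝ᵥ w) := by
  rw [infoMatrix_mulVec, dotProduct_sum]
  refine Finset.sum_congr rfl fun i _ => ?_
  rw [dotProduct_smul, dotProduct_comm u, smul_eq_mul]
  ring

theorem dotProduct_infoMatrix_mulVec_comm (f : ι → m → ℝ) (a : ι → ℝ) (u w : m → ℝ) :
    u ⬝ᵥ infoMatrix f a *ᵥ w = w ⬝ᵥ infoMatrix f a *ᵥ u := by
  simp only [dotProduct_infoMatrix_mulVec, mul_right_comm]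

theorem dotProduct_infoMatrix_mulVec_self (f : ι → m → ℝ) (a : ι → ℝ) (w : m → ℝ) :
    w ⬝ᵥ infoMatrix f a *ᵥ w = ∑ i, a i * (f i ⬝ᵥ w) ^ 2 := by
  simp only [dotProduct_infoMatrix_mulVec, mul_assoc, sq]

/-- The range of a symmetric matrix is the orthogonal complement of its kernel. A functional
vanishing on the range but not at v is represented by a vector w; symmetry puts w in the kernel. -/
theorem exists_mulVec_eq_of_ker {f : ι → m → ℝ} {a : ι → ℝ} {v : m → ℝ}
    (h : ∀ w, infoMatrix f a *ᵥ w = 0 → v ⬝ᵥ w = 0) : ∃ w, infoMatrix f a *ᵥ w = v := by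
  classical
  by_contra hne
  have hv : v ∉ LinearMap.range (infoMatrix f a).mulVecLin := by
    rintro ⟨w, hw⟩
    exact hne ⟨w, by simpa using hw⟩
  obtain ⟨g, hgv, hg⟩ := Submodule.exists_le_ker_of_notMem hv
  let w : m → ℝ := fun i => g (Pi.single i 1)
  have hgw : ∀ u, g u = u ⬝ᵥ w := by
    intro u
    conv_lhs => rw [pi_eq_sum_univ u]
    simp only [map_sum, map_smul, smul_eq_mul, dotProduct, w]
    refine Finset.sum_congr rfl fun i _ => ?_
    congr 2
    ext j
    simp [Pi.single_apply, eq_comm]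
  refine hgv ?_
  rw [hgw]
  refine h w ?_
  refine dotProduct_eq_zero _ fun u => ?_
  rw [dotProduct_comm, dotProduct_infoMatrix_mulVec_comm, dotProduct_comm, ← hgw]
  exact hg ⟨u, by simp⟩

theorem QuadBound.exists_mulVec_eq {f : ι → m → ℝ} {a : ι → ℝ} {v : m → ℝ} {K : ℝ}
    (h : QuadBound f a v K) : ∃ w, infoMatrix f a *ᵥ w = v := by
  refine exists_mulVec_eq_of_ker fun w hw => ?_
  have := h w
  rw [← dotProduct_infoMatrix_mulVec_self, hw, dotProduct_zero, mul_zero] at this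
  exact pow_eq_zero_iff (two_ne_zero) |>.1 (le_antisymm this (sq_nonneg _))

/-- By symmetry all solutions w of A w = v give the same value vᵀw, so the infimum is over a
constant. -/
theorem invQuad_of_mulVec_eq {f : ι → m → ℝ} {a : ι → ℝ} {v w : m → ℝ}
    (h : infoMatrix f a *ᵥ w = v) : invQuad (infoMatrix f a) v = ENNReal.ofReal (v ⬝ᵥ w) := by
  refine le_antisymm (iInf₂_le w h) (le_iInf₂ fun u hu => ?_)
  rw [← hu, dotProduct_comm, dotProduct_infoMatrix_mulVec_comm, h, hu, dotProduct_comm u]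

theorem exists_of_invQuad_ne_top {A : Matrix m m ℝ} {v : m → ℝ}
    (h : invQuad A v ≠ ⊤) : ∃ w, A *ᵥ w = v := by
  by_contra! hne
  exact h (by simp [invQuad, hne])

theorem sum_mul_dotProduct_sq_nonneg {f : ι → m → ℝ} {a : ι → ℝ} (ha : ∀ i, 0 ≤ a i) (w : m → ℝ) :
    0 ≤ ∑ i, a i * (f i ⬝ᵥ w) ^ 2 :=
  Finset.sum_nonneg fun i _ => mul_nonneg (ha i) (sq_nonneg _)

theorem sum_mul_mul_sq_le {a : ι → ℝ} (ha : ∀ i, 0 ≤ a i) (p q : ι → ℝ) :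
    (∑ i, a i * p i * q i) ^ 2 ≤ (∑ i, a i * p i ^ 2) * ∑ i, a i * q i ^ 2 := by
  have := Finset.sum_mul_sq_le_sq_mul_sq Finset.univ (fun i => √(a i) * p i)
    (fun i => √(a i) * q i)
  have e : ∀ i, √(a i) * p i * (√(a i) * q i) = a i * p i * q i := fun i => by
    have := Real.mul_self_sqrt (ha i)
    linear_combination p i * q i * this
  simpa only [e, mul_pow, Real.sq_sqrt (ha _)] using this

theorem quadBound_of_mulVec_eq {f : ι → m → ℝ} {a : ι → ℝ} (ha : ∀ i, 0 ≤ a i) {v w : m → ℝ}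
    (h : infoMatrix f a *ᵥ w = v) : QuadBound f a v (v ⬝ᵥ w) := by
  intro u
  rw [← h, dotProduct_comm, dotProduct_infoMatrix_mulVec, dotProduct_comm _ w,
    dotProduct_infoMatrix_mulVec_self, mul_comm]
  exact sum_mul_mul_sq_le ha _ _

theorem QuadBound.mono {f : ι → m → ℝ} {a : ι → ℝ} (ha : ∀ i, 0 ≤ a i) {v : m → ℝ} {K K' : ℝ}
    (h : QuadBound f a v K) (hK : K ≤ K') : QuadBound f a v K' := fun w =>
  (h w).trans (mul_le_mul_of_nonneg_right hK (sum_mul_dotProduct_sq_nonneg ha w))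

theorem QuadBound.dotProduct_le {f : ι → m → ℝ} {a : ι → ℝ} {v w : m → ℝ} {K : ℝ} (hK : 0 ≤ K)
    (h : QuadBound f a v K) (hw : infoMatrix f a *ᵥ w = v) : v ⬝ᵥ w ≤ K := by
  have h1 := h w
  rw [← dotProduct_infoMatrix_mulVec_self, hw, dotProduct_comm w] at h1
  by_contra! hlt
  nlinarith

/-- Cauchy-Schwarz for the form A gives one direction; testing the bound at a solution of A w = v
gives the other. Finiteness of the dual norm is thus encoded in an inequality that is easy to
compare between designs. -/
theorem invQuad_le_iff {f : ι → m → ℝ} {a : ι → ℝ} (ha : ∀ i, 0 ≤ a i) {v : m → ℝ} {K : ℝ}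
    (hK : 0 ≤ K) : invQuad (infoMatrix f a) v ≤ ENNReal.ofReal K ↔ QuadBound f a v K := by
  constructor
  · intro h
    obtain ⟨w, hw⟩ := exists_of_invQuad_ne_top (ne_top_of_le_ne_top ENNReal.ofReal_ne_top h)
    rw [invQuad_of_mulVec_eq hw, ENNReal.ofReal_le_ofReal_iff hK] at h
    exact (quadBound_of_mulVec_eq ha hw).mono ha h
  · intro h
    obtain ⟨w, hw⟩ := h.exists_mulVec_eq
    rw [invQuad_of_mulVec_eq hw]
    exact ENNReal.ofReal_le_ofReal (h.dotProduct_le hK hw)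

theorem dotProduct_nonneg_of_mulVec_eq {f : ι → m → ℝ} {a : ι → ℝ} (ha : ∀ i, 0 ≤ a i)
    {v w : m → ℝ} (h : infoMatrix f a *ᵥ w = v) : 0 ≤ v ⬝ᵥ w := by
  rw [← h, dotProduct_comm, dotProduct_infoMatrix_mulVec_self]
  exact sum_mul_dotProduct_sq_nonneg ha w

/-- The dual norm as a supremum of continuous functions of the matrix and the vector. -/
theorem invQuad_eq_iSup {f : ι → m → ℝ} {a : ι → ℝ} (ha : ∀ i, 0 ≤ a i) (v : m → ℝ) :
    invQuad (infoMatrix f a) v =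
      ⨆ w : m → ℝ, ENNReal.ofReal (2 * (v ⬝ᵥ w) - ∑ i, a i * (f i ⬝ᵥ w) ^ 2) := by
  apply le_antisymm
  · by_cases hex : ∃ w, infoMatrix f a *ᵥ w = v
    · obtain ⟨w, hw⟩ := hex
      rw [invQuad_of_mulVec_eq hw]
      refine le_iSup_of_le w (ENNReal.ofReal_le_ofReal ?_)
      rw [← dotProduct_infoMatrix_mulVec_self, hw, dotProduct_comm w]
      linarith
    · have : ∃ w, infoMatrix f a *ᵥ w = 0 ∧ v ⬝ᵥ w ≠ 0 := by
        by_contra! h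
        exact hex (exists_mulVec_eq_of_ker h)
      obtain ⟨w, hw, hvw⟩ := this
      -- Along a kernel vector not orthogonal to v the quadratic term vanishes and the linear term
      -- is unbounded.
      have : (⨆ w : m → ℝ, ENNReal.ofReal (2 * (v ⬝ᵥ w) - ∑ i, a i * (f i ⬝ᵥ w) ^ 2)) = ⊤ := by
        refine ENNReal.eq_top_of_forall_nnreal_le fun r => ?_
        refine le_iSup_of_le ((r / (v ⬝ᵥ w)) • w) ?_
        rw [← dotProduct_infoMatrix_mulVec_self, Matrix.mulVec_smul, hw, smul_zero,
          dotProduct_zero, dotProduct_smul, smul_eq_mul, div_mul_cancel₀ _ hvw]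
        rw [← ENNReal.ofReal_coe_nnreal]
        exact ENNReal.ofReal_le_ofReal (by linarith [r.2])
      rw [this]; exact le_top
  · refine iSup_le fun w => ?_
    refine le_iInf₂ fun u hu => ENNReal.ofReal_le_ofReal ?_
    -- Completing the square at the solution u.
    have h0 := sum_mul_dotProduct_sq_nonneg (f := f) ha (u - w)
    rw [← dotProduct_infoMatrix_mulVec_self] at h0 ⊢
    rw [Matrix.mulVec_sub, dotProduct_sub, sub_dotProduct, sub_dotProduct,
      dotProduct_infoMatrix_mulVec_comm f a u w, hu, dotProduct_comm u, dotProduct_comm w] at h0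
    linarith

theorem mulVec_solve {A : Matrix m m ℝ} {b : m → ℝ} (h : ∃ s, A *ᵥ s = b) :
    A *ᵥ solve A b = b :=
  Classical.epsilon_spec h

/-- `solve` is an arbitrary solution, possibly one of many; paired with a vector in the range it has
a determined value. -/
theorem dotProduct_solve {f : ι → m → ℝ} {a : ι → ℝ} {v w b : m → ℝ}
    (hw : infoMatrix f a *ᵥ w = v) (hb : ∃ s, infoMatrix f a *ᵥ s = b) :
    v ⬝ᵥ solve (infoMatrix f a) b = w ⬝ᵥ b := by
  rw [← hw, dotProduct_comm, dotProduct_infoMatrix_mulVec_comm, mulVec_solve hb]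

theorem exists_mulVec_eq_sum {f : ι → m → ℝ} {a : ι → ℝ} (ha : ∀ i, 0 ≤ a i) {c : ι → ℝ}
    (hc : ∀ i, a i = 0 → c i = 0) : ∃ w, infoMatrix f a *ᵥ w = ∑ i, c i • f i := by
  refine exists_mulVec_eq_of_ker fun w hw => ?_
  have h0 : ∑ i, a i * (f i ⬝ᵥ w) ^ 2 = 0 := by
    rw [← dotProduct_infoMatrix_mulVec_self, hw, dotProduct_zero]
  rw [Finset.sum_eq_zero_iff_of_nonneg fun i _ => mul_nonneg (ha i) (sq_nonneg _)] at h0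
  rw [sum_dotProduct]
  refine Finset.sum_eq_zero fun i hi => ?_
  rw [smul_dotProduct]
  rcases mul_eq_zero.1 (h0 i hi) with h | h
  · simp [hc i h]
  · simp [pow_eq_zero_iff two_ne_zero |>.1 h]

end Design

/-! ### Exact designs by exchange -/

section Exchange

variable {ι m : Type*} [Fintype m]

/-- If exchanging one rank-one term does not increase the determinant, then the leverages
of the two terms are comparable. -/
theorem leverage_le_of_det_le [DecidableEq m] {A : Matrix m m ℝ} (hA : 0 < A.det)
    (hs : ∀ u v : m → ℝ, u ⬝ᵥ A⁻¹ *ᵥ v = v ⬝ᵥ A⁻¹ *ᵥ u) {u v : m → ℝ}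
    (h : (A + (Matrix.vecMulVec v v - Matrix.vecMulVec u u)).det ≤ A.det) :
    v ⬝ᵥ A⁻¹ *ᵥ v ≤ (u ⬝ᵥ A⁻¹ *ᵥ u) * (1 + v ⬝ᵥ A⁻¹ *ᵥ v) := by
  let U : Matrix m (Fin 2) ℝ := Matrix.of fun i j => ![v i, u i] j
  let V : Matrix (Fin 2) m ℝ := Matrix.of fun j i => ![v i, -u i] j
  have hUV : Matrix.vecMulVec v v - Matrix.vecMulVec u u = U * V := by
    ext i j
    simp [U, V, Matrix.mul_apply, Fin.sum_univ_two, Matrix.vecMulVec_apply]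
    ring
  have hVU : ∀ i j, (V * A⁻¹ * U) i j = V i ⬝ᵥ A⁻¹ *ᵥ (Uᵀ j) := by
    intro i j
    rw [Matrix.mul_assoc, Matrix.mul_apply]
    rfl
  have hV0 : V 0 = v := rfl
  have hV1 : V 1 = -u := rfl
  have hU0 : Uᵀ 0 = v := rfl
  have hU1 : Uᵀ 1 = u := rfl
  rw [hUV, Matrix.det_add_mul U V (isUnit_iff_ne_zero.2 hA.ne'), Matrix.det_fin_two] at h
  simp only [Matrix.add_apply, hVU, hV0, hV1, hU0, hU1, Matrix.one_apply_eq, neg_dotProduct,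
    Matrix.one_apply_ne (zero_ne_one' (Fin 2)), Matrix.one_apply_ne (one_ne_zero' (Fin 2)),
    hs u v] at h
  -- With p, q the leverages of v, u and r = vᵀA⁻¹u, the 2×2 determinant gives (1 + p)(1 - q) + r² ≤
  -- 1; dropping r² is the claim.
  have h1 := (mul_le_iff_le_one_right hA).1 h
  nlinarith [sq_nonneg (v ⬝ᵥ A⁻¹ *ᵥ u)]

/-- Take a sequence of N points maximizing the determinant; the ridge term ε keeps all determinants
positive even if `f` does not span. Exchanging any chosen point for x does not increase the
determinant, so lev(x) ≤ lev(g k)(1 + lev(x)). The chosen leverages sum to at most D = card m, by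
the trace of B⁻¹B, and summing over k yields N lev(x) ≤ D (1 + lev(x)). -/
theorem exists_regularized_exact_design [Nonempty ι] [Finite ι] (f : ι → m → ℝ) {N : ℕ}
    (hN : Fintype.card m < N) {ε : ℝ} (hε : 0 < ε) :
    ∃ g : Fin N → ι, ∀ i w, (f i ⬝ᵥ w) ^ 2 ≤
      Fintype.card m / (N - Fintype.card m : ℝ) *
        (ε * (w ⬝ᵥ w) + ∑ k, (f (g k) ⬝ᵥ w) ^ 2) := by
  classical
  let F : (Fin N → ι) → m ⊕ Fin N → m → ℝ := fun g => Sum.elim (fun i => Pi.single i 1) (f ∘ g)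
  let a : m ⊕ Fin N → ℝ := Sum.elim (fun _ => ε) fun _ => 1
  have ha : ∀ j, 0 ≤ a j := by rintro (j | j) <;> simp [a, hε.le]
  let B : (Fin N → ι) → Matrix m m ℝ := fun g => infoMatrix (F g) a
  have hform : ∀ g w, ∑ j, a j * (F g j ⬝ᵥ w) ^ 2 = ε * (w ⬝ᵥ w) + ∑ k, (f (g k) ⬝ᵥ w) ^ 2 := by
    intro g w
    have hw : ∀ i : m, Pi.single i 1 ⬝ᵥ w = w i := fun i => single_one_dotProduct i w
    simp only [Fintype.sum_sum_type, F, a, Sum.elim_inl, Sum.elim_inr, hw, ← Finset.mul_sum,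
      one_mul, Function.comp_apply, sq]
    rfl
  have hpos : ∀ g, (B g).PosDef := by
    intro g
    refine Matrix.PosDef.of_dotProduct_mulVec_pos ?_ fun w hw => ?_
    · ext i j
      simp [B, infoMatrix, Matrix.sum_apply, Matrix.vecMulVec_apply, mul_comm]
    · rw [star_trivial, dotProduct_infoMatrix_mulVec_self, hform]
      have : 0 < w ⬝ᵥ w := by
        refine lt_of_le_of_ne (Finset.sum_nonneg fun i _ => mul_self_nonneg _) fun h => hw ?_
        exact dotProduct_self_eq_zero.1 h.symm
      have := mul_pos hε this
      have : 0 ≤ ∑ k, (f (g k) ⬝ᵥ w) ^ 2 := Finset.sum_nonneg fun k _ => sq_nonneg _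
      linarith
  obtain ⟨g, hg⟩ := Finite.exists_max fun g => (B g).det
  refine ⟨g, fun x w => ?_⟩
  have hdet := (hpos g).det_pos
  have hinv : ∀ v, B g *ᵥ ((B g)⁻¹ *ᵥ v) = v := fun v => by
    rw [Matrix.mulVec_mulVec, Matrix.mul_nonsing_inv _ (isUnit_iff_ne_zero.2 hdet.ne'),
      Matrix.one_mulVec]
  have hs : ∀ u v : m → ℝ, u ⬝ᵥ (B g)⁻¹ *ᵥ v = v ⬝ᵥ (B g)⁻¹ *ᵥ u := by
    intro u v
    conv_lhs => rw [← hinv u, dotProduct_comm, dotProduct_infoMatrix_mulVec_comm, hinv v,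
      dotProduct_comm]
  have hnn : ∀ v, 0 ≤ v ⬝ᵥ (B g)⁻¹ *ᵥ v := fun v => dotProduct_nonneg_of_mulVec_eq ha (hinv v)
  have htr : ∑ j, a j * (F g j ⬝ᵥ (B g)⁻¹ *ᵥ F g j) = Fintype.card m := by
    have : ((B g)⁻¹ * B g).trace = Fintype.card m := by
      rw [Matrix.nonsing_inv_mul _ (isUnit_iff_ne_zero.2 hdet.ne'), Matrix.trace_one]
    rw [← this]
    conv_rhs => rw [show B g = infoMatrix (F g) a from rfl, infoMatrix, Finset.mul_sum,
      Matrix.trace_sum]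
    refine Finset.sum_congr rfl fun j _ => ?_
    rw [Matrix.mul_smul, Matrix.trace_smul, Matrix.mul_vecMulVec, Matrix.trace_vecMulVec,
      smul_eq_mul, dotProduct_comm]
    rfl
  have hlev : ∑ k, f (g k) ⬝ᵥ (B g)⁻¹ *ᵥ f (g k) ≤ Fintype.card m := by
    rw [← htr, Fintype.sum_sum_type]
    have : 0 ≤ ∑ i : m, a (.inl i) * (F g (.inl i) ⬝ᵥ (B g)⁻¹ *ᵥ F g (.inl i)) :=
      Finset.sum_nonneg fun i _ => mul_nonneg (ha _) (hnn _)
    simpa [a, F] using this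
  have hex : ∀ k, f x ⬝ᵥ (B g)⁻¹ *ᵥ f x ≤
      (f (g k) ⬝ᵥ (B g)⁻¹ *ᵥ f (g k)) * (1 + f x ⬝ᵥ (B g)⁻¹ *ᵥ f x) := by
    intro k
    refine leverage_le_of_det_le hdet hs ?_
    have hup : B (Function.update g k x) =
        B g + (Matrix.vecMulVec (f x) (f x) - Matrix.vecMulVec (f (g k)) (f (g k))) := by
      simp only [B, infoMatrix, Fintype.sum_sum_type, F, a, Sum.elim_inl, Sum.elim_inr, one_smul,
        Function.comp_apply]
      rw [← Finset.add_sum_erase _ _ (Finset.mem_univ k),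
        ← Finset.add_sum_erase _ (fun k => Matrix.vecMulVec (f (g k)) (f (g k)))
          (Finset.mem_univ k)]
      have : ∑ j ∈ Finset.univ.erase k, Matrix.vecMulVec (f (Function.update g k x j))
          (f (Function.update g k x j)) =
          ∑ j ∈ Finset.univ.erase k, Matrix.vecMulVec (f (g j)) (f (g j)) :=
        Finset.sum_congr rfl fun j hj => by
          rw [Function.update_of_ne (Finset.ne_of_mem_erase hj)]
      rw [this, Function.update_self]
      abel
    rw [← hup]
    exact hg _
  have hsum := Finset.sum_le_sum fun k (_ : k ∈ Finset.univ) => hex k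
  rw [Finset.sum_const, Finset.card_univ, Fintype.card_fin, ← Finset.sum_mul, nsmul_eq_mul] at hsum
  have hN' : (0 : ℝ) < N - Fintype.card m := by
    rw [sub_pos]; exact_mod_cast hN
  have hx : f x ⬝ᵥ (B g)⁻¹ *ᵥ f x ≤ Fintype.card m / (N - Fintype.card m : ℝ) := by
    rw [le_div_iff₀ hN']
    have := mul_le_mul_of_nonneg_right hlev (add_nonneg zero_le_one (hnn (f x)))
    nlinarith
  rw [← hform]
  exact ((quadBound_of_mulVec_eq ha (hinv (f x))).mono ha hx) w

/-- There is an exact design of size `N` whose G-criterion is at most `D / (N - D)`, where `D` is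
the dimension. -/
theorem exists_exact_design [Fintype ι] [Nonempty ι] (f : ι → m → ℝ) {N : ℕ}
    (hN : Fintype.card m < N) :
    ∃ n : ι → ℕ, ∑ i, n i = N ∧ ∀ i, QuadBound f (fun i => (n i : ℝ)) (f i)
      (Fintype.card m / (N - Fintype.card m : ℝ)) := by
  classical
  have hreg : ∀ k : ℕ, ∃ g : Fin N → ι, ∀ i w, (f i ⬝ᵥ w) ^ 2 ≤
      Fintype.card m / (N - Fintype.card m : ℝ) *
        (1 / ((k : ℝ) + 1) * (w ⬝ᵥ w) + ∑ k, (f (g k) ⬝ᵥ w) ^ 2) := fun k =>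
    exists_regularized_exact_design f hN Nat.one_div_pos_of_nat
  choose G hG using hreg
  -- There are finitely many sequences, so one of them is optimal for infinitely many ridge terms
  -- 1/(k+1); the ridge can then be sent to 0 with the design fixed.
  obtain ⟨g, hg⟩ := Finite.exists_infinite_fiber G
  have hfreq : ∃ᶠ k in Filter.atTop, G k = g := by
    rw [Nat.frequently_atTop_iff_infinite]
    exact Set.infinite_coe_iff.1 hg
  refine ⟨fun i => (Finset.univ.filter fun k => g k = i).card, ?_, fun i w => ?_⟩
  · rw [← Finset.card_eq_sum_card_fiberwise (fun k _ => Finset.mem_univ (g k))]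
    simp
  · have hsum : ∑ k, (f (g k) ⬝ᵥ w) ^ 2 =
        ∑ j, ((Finset.univ.filter fun k => g k = j).card : ℝ) * (f j ⬝ᵥ w) ^ 2 := by
      rw [← Finset.sum_fiberwise Finset.univ g]
      refine Finset.sum_congr rfl fun j _ => ?_
      rw [Finset.sum_congr rfl fun k hk => by rw [(Finset.mem_filter.1 hk).2]]
      simp
    rw [← hsum]
    have hlim : Filter.Tendsto (fun k : ℕ => Fintype.card m / (N - Fintype.card m : ℝ) *
        (1 / ((k : ℝ) + 1) * (w ⬝ᵥ w) + ∑ k, (f (g k) ⬝ᵥ w) ^ 2)) Filter.atTop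
        (nhds (Fintype.card m / (N - Fintype.card m : ℝ) *
          (0 * (w ⬝ᵥ w) + ∑ k, (f (g k) ⬝ᵥ w) ^ 2))) :=
      (((tendsto_one_div_add_atTop_nhds_zero_nat).mul_const _).add_const _).const_mul _
    rw [zero_mul, zero_add] at hlim
    exact ge_of_tendsto_of_frequently hlim (hfreq.mono fun k hk => by rw [← hk]; exact hG k i w)

end Exchange

/-! ### Sparse designs -/

theorem card_halfIdx (d : ℕ) : Fintype.card (HalfIdx d) = d * (d + 1) / 2 := by
  rw [← Fintype.card_congr (Sym2.sortEquiv (α := Fin d)), Sym2.card, Fintype.card_fin,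
    Nat.choose_two_right, Nat.add_sub_cancel, mul_comm]

/-- Carathéodory's theorem for designs: the information matrix does not determine a dense
design. -/
theorem exists_sparse_design {ι : Type*} [Fintype ι] {d : ℕ} (f : ι → Vec d) (s lam : ι → ℝ)
    (hlam : lam ∈ stdSimplex ℝ ι) :
    ∃ mu ∈ stdSimplex ℝ ι, infoMatrix f (fun i => mu i / s i) = infoMatrix f (fun i => lam i / s i)
      ∧ {i | mu i ≠ 0}.ncard ≤ d * (d + 1) / 2 + 1 := by
  classical
  -- Symmetric matrices are recorded by their upper triangle, so Carathéodory is applied in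
  -- dimension d(d+1)/2.
  let G : ι → HalfIdx d → ℝ := fun i p => (s i)⁻¹ * (f i p.1.1 * f i p.1.2)
  have hmem : ∑ i, lam i • G i ∈ convexHull ℝ (Set.range G) :=
    (convex_convexHull ℝ _).sum_mem (fun i _ => hlam.1 i) hlam.2
      fun i _ => subset_convexHull ℝ _ (Set.mem_range_self i)
  obtain ⟨κ, _, z, w, hz, hind, hw, hw1, hsum⟩ := eq_pos_convex_span_of_mem_convexHull hmem
  choose x hx using fun k => hz (Set.mem_range_self k)
  let mu : ι → ℝ := fun i => ∑ k, if x k = i then w k else 0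
  have hmu : ∀ φ : ι → ℝ, ∑ i, mu i * φ i = ∑ k, w k * φ (x k) := by
    intro φ
    simp only [mu, Finset.sum_mul]
    rw [Finset.sum_comm]
    simp [ite_mul]
  refine ⟨mu, ⟨fun i => Finset.sum_nonneg fun k _ => ?_, ?_⟩, ?_, ?_⟩
  · split_ifs
    exacts [(hw k).le, le_rfl]
  · simpa [hw1] using hmu fun _ => 1
  · have key : ∀ p q : Fin d, p ≤ q → ∑ i, mu i / s i * (f i p * f i q) =
        ∑ i, lam i / s i * (f i p * f i q) := by
      intro p q hpq
      have h1 := hmu fun i => (s i)⁻¹ * (f i p * f i q)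
      have h2 := congrFun hsum ⟨(p, q), hpq⟩
      simp only [Finset.sum_apply, Pi.smul_apply, smul_eq_mul, ← hx, G] at h2
      simp only [div_eq_mul_inv, mul_assoc]
      rw [h1, h2]
    ext p q
    simp only [infoMatrix, Matrix.sum_apply, Matrix.smul_apply, Matrix.vecMulVec_apply, smul_eq_mul]
    rcases le_total p q with h | h
    · exact key p q h
    · simpa only [mul_comm (f _ p)] using key q p h
  · have hsub : {i | mu i ≠ 0} ⊆ Set.range x := by
      intro i hi
      by_contra hne
      refine hi (Finset.sum_eq_zero fun k _ => if_neg fun hk => hne ⟨k, hk⟩)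
    calc {i | mu i ≠ 0}.ncard ≤ (Set.range x).ncard := Set.ncard_le_ncard hsub (Set.finite_range x)
      _ ≤ Fintype.card κ := by
        rw [← Set.image_univ, ← Nat.card_eq_fintype_card, ← Set.ncard_univ]
        exact Set.ncard_image_le
      _ ≤ Module.finrank ℝ (vectorSpan ℝ (Set.range z)) + 1 := hind.card_le_finrank_succ
      _ ≤ Module.finrank ℝ (HalfIdx d → ℝ) + 1 := by
        gcongr; exact Submodule.finrank_le _
      _ = d * (d + 1) / 2 + 1 := by rw [Module.finrank_pi, card_halfIdx]

/-! ### Optimal designs -/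

theorem QuadBound.of_le {ι m : Type*} [Fintype ι] [Fintype m] {f : ι → m → ℝ} {a a' : ι → ℝ}
    {v : m → ℝ} {K K' : ℝ} (h : QuadBound f a v K) (hle : ∀ i, K * a i ≤ K' * a' i) :
    QuadBound f a' v K' := by
  intro w
  refine (h w).trans ?_
  rw [Finset.mul_sum, Finset.mul_sum]
  refine Finset.sum_le_sum fun i _ => ?_
  rw [← mul_assoc, ← mul_assoc]
  exact mul_le_mul_of_nonneg_right (hle i) (sq_nonneg _)

theorem QuadBound.sub {ι m : Type*} [Fintype ι] [Fintype m] {f : ι → m → ℝ} {a : ι → ℝ}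
    {u v : m → ℝ} {K : ℝ} (hu : QuadBound f a u K) (hv : QuadBound f a v K) :
    QuadBound f a (u - v) (4 * K) := by
  intro w
  rw [sub_dotProduct]
  nlinarith [hu w, hv w, sq_nonneg (u ⬝ᵥ w + v ⬝ᵥ w)]

/-! ### Spanning arms, optimal values and rounding -/

section

variable {d : ℕ} {X : Finset (Vec d)}

theorem nonempty_of_span (hd : 0 < d) (hX : Submodule.span ℝ (X : Set (Vec d)) = ⊤) :
    X.Nonempty := by
  have : Nonempty (Fin d) := ⟨⟨0, hd⟩⟩
  by_contra h
  rw [Finset.not_nonempty_iff_eq_empty] at h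
  subst h
  simp at hX

theorem eq_zero_of_forall_dotProduct (hX : Submodule.span ℝ (X : Set (Vec d)) = ⊤) {w : Vec d}
    (h : ∀ x : X, (x : Vec d) ⬝ᵥ w = 0) : w = 0 := by
  have : ∀ u ∈ Submodule.span ℝ (X : Set (Vec d)), u ⬝ᵥ w = 0 := by
    intro u hu
    induction hu using Submodule.span_induction with
    | mem x hx => exact h ⟨x, hx⟩
    | zero => simp
    | add x y _ _ hx hy => rw [add_dotProduct, hx, hy, add_zero]
    | smul c x _ hx => rw [smul_dotProduct, hx, smul_zero]
  exact dotProduct_self_eq_zero.1 (this w (hX ▸ Submodule.mem_top))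

theorem exists_mulVec_eq_of_pos (hX : Submodule.span ℝ (X : Set (Vec d)) = ⊤) {a : X → ℝ}
    (ha : ∀ x, 0 < a x) (v : Vec d) :
    ∃ w, infoMatrix (fun x : X => (x : Vec d)) a *ᵥ w = v := by
  refine exists_mulVec_eq_of_ker fun w hw => ?_
  have h0 : ∑ x : X, a x * ((x : Vec d) ⬝ᵥ w) ^ 2 = 0 := by
    rw [← dotProduct_infoMatrix_mulVec_self (fun x : X => (x : Vec d)), hw, dotProduct_zero]
  rw [Finset.sum_eq_zero_iff_of_nonneg fun x _ => mul_nonneg (ha x).le (sq_nonneg _)] at h0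
  have : w = 0 := eq_zero_of_forall_dotProduct hX fun x =>
    pow_eq_zero_iff two_ne_zero |>.1 ((mul_eq_zero.1 (h0 x (Finset.mem_univ x))).resolve_left
      (ha x).ne')
  rw [this, dotProduct_zero]

theorem exists_pos_mem_stdSimplex (hX : X.Nonempty) :
    ∃ mu ∈ stdSimplex ℝ X, ∀ x, 0 < mu x := by
  have hc : (0 : ℝ) < X.card := by exact_mod_cast hX.card_pos
  refine ⟨fun _ => (X.card : ℝ)⁻¹, ⟨fun _ => (inv_pos.2 hc).le, ?_⟩, fun _ => inv_pos.2 hc⟩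
  simp [hc.ne']

variable {s : X → ℝ} {V : Finset (Vec d)} {lam mu : X → ℝ} {K : ℝ}

theorem designValue_le_iff (hs : ∀ x, 0 < s x) (hlam : ∀ x, 0 ≤ lam x) (hK : 0 ≤ K) :
    designValue s V lam ≤ ENNReal.ofReal K ↔
      ∀ v ∈ V, QuadBound (fun x : X => (x : Vec d)) (fun x => lam x / s x) v K := by
  unfold designValue
  rw [iSup₂_le_iff]
  exact forall₂_congr fun v _ => invQuad_le_iff (fun x => div_nonneg (hlam x) (hs x).le) hK

theorem optValue_ne_top (hne : X.Nonempty) (hX : Submodule.span ℝ (X : Set (Vec d)) = ⊤)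
    (hs : ∀ x, 0 < s x) : optValue s V ≠ ⊤ := by
  obtain ⟨mu, hmu, hpos⟩ := exists_pos_mem_stdSimplex hne
  refine ne_top_of_le_ne_top (ENNReal.sum_ne_top.2 fun v _ => ?_) ((iInf₂_le mu hmu).trans
    (iSup₂_le fun v hv => Finset.single_le_sum (f := fun v =>
      invQuad (infoMatrix (fun x : X => (x : Vec d)) fun x => mu x / s x) v)
      (fun _ _ => zero_le) hv))
  obtain ⟨w, hw⟩ := exists_mulVec_eq_of_pos hX (fun x => div_pos (hpos x) (hs x)) v
  rw [invQuad_of_mulVec_eq hw]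
  exact ENNReal.ofReal_ne_top

theorem IsOptDesign.designValue_eq (h : IsOptDesign s V lam) :
    designValue s V lam = optValue s V :=
  le_antisymm (le_iInf₂ h.2) (iInf₂_le lam h.1)

theorem IsOptDesign.quadBound (hne : X.Nonempty) (hX : Submodule.span ℝ (X : Set (Vec d)) = ⊤)
    (hs : ∀ x, 0 < s x) (h : IsOptDesign s V lam) {v : Vec d} (hv : v ∈ V) :
    QuadBound (fun x : X => (x : Vec d)) (fun x => lam x / s x) v (optValue s V).toReal := by
  refine (designValue_le_iff hs h.1.1 ENNReal.toReal_nonneg).1 ?_ v hv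
  rw [ENNReal.ofReal_toReal (optValue_ne_top hne hX hs), h.designValue_eq]

theorem toReal_optValue_le (hs : ∀ x, 0 < s x) (hmu : mu ∈ stdSimplex ℝ X) (hK : 0 ≤ K)
    (h : ∀ v ∈ V, QuadBound (fun x : X => (x : Vec d)) (fun x => mu x / s x) v K) :
    (optValue s V).toReal ≤ K :=
  ENNReal.toReal_le_of_le_ofReal hK
    ((iInf₂_le mu hmu).trans ((designValue_le_iff hs hmu.1 hK).2 h))

/-- The G-optimal value is at most twice the dimension. -/
theorem toReal_optValue_one_le (hd : 0 < d) (hne : X.Nonempty) :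
    (optValue (fun _ : X => (1 : ℝ)) X).toReal ≤ 2 * d := by
  have : Nonempty X := hne.to_subtype
  -- With N = 2d the exchange bound d/(N - d) equals 1, and normalizing the allocation by N costs
  -- the factor 2d.
  obtain ⟨n, hn, hb⟩ := exists_exact_design (fun x : X => (x : Vec d)) (N := 2 * d) (by simp; omega)
  have hd' : (0 : ℝ) < d := by exact_mod_cast hd
  refine toReal_optValue_le (mu := fun x => n x / (2 * d)) (fun _ => one_pos) ⟨fun x => ?_, ?_⟩
    (by positivity) fun v hv => ?_
  · positivity
  · rw [← Finset.sum_div, ← Nat.cast_sum, hn]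
    push_cast
    field_simp
  · refine (hb ⟨v, hv⟩).of_le fun x => le_of_eq ?_
    rw [Fintype.card_fin]
    push_cast
    field_simp
    ring

theorem IsOptDesign.exists_sparse (h : IsOptDesign s V lam) :
    ∃ mu, IsOptDesign s V mu ∧ supportSize mu ≤ d * (d + 1) / 2 + 1 := by
  obtain ⟨mu, hmu, heq, hcard⟩ := exists_sparse_design (fun x : X => (x : Vec d)) s lam h.1
  refine ⟨mu, ⟨hmu, fun nu hnu => ?_⟩, hcard⟩
  have : designValue s V mu = designValue s V lam := by simp only [designValue, heq]
  rw [this]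
  exact h.2 nu hnu

theorem Choices.Valid.supportSize_le {R : Choices X} (hR : R.Valid) (hs : ∀ x, 0 < s x) :
    supportSize (R.design s V) ≤ d * (d + 1) / 2 + 1 := by
  obtain ⟨mu, hmu, hcard⟩ := (hR.opt s hs V).exists_sparse
  exact hR.sparse s hs V mu hmu hcard

theorem sum_ceil_le (hlam : lam ∈ stdSimplex ℝ X) {t : ℝ} (ht : 0 ≤ t) :
    ((∑ x, ⌈t * lam x⌉₊ : ℕ) : ℝ) ≤ t + supportSize lam := by
  classical
  have h1 : ∀ x, ((⌈t * lam x⌉₊ : ℕ) : ℝ) ≤ t * lam x + if lam x ≠ 0 then 1 else 0 := by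
    intro x
    split_ifs with h
    · exact (Nat.ceil_lt_add_one (mul_nonneg ht (hlam.1 x))).le
    · simp only [ne_eq, not_not] at h
      simp [h]
  rw [Nat.cast_sum]
  refine (Finset.sum_le_sum fun x _ => h1 x).trans (le_of_eq ?_)
  rw [Finset.sum_add_distrib, ← Finset.mul_sum, hlam.2, mul_one, Finset.sum_boole, supportSize,
    Set.ncard_eq_toFinset_card']
  simp

/-- The G-criterion of the rounded allocation on the lifted arms. -/
theorem Choices.Valid.quadBound_phi {R : Choices X} (hR : R.Valid) (hd : 0 < d)
    (hne : X.Nonempty) {N : ℕ} (hN : d * (d + 1) ≤ N) (x : X) :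
    QuadBound (fun x : X => phi (x : Vec d)) (fun x => (R.alloc N x : ℝ)) (phi (x : Vec d))
      (6 * d ^ 2 / N) := by
  have : Nonempty X := hne.to_subtype
  have hdd : 2 * (d * (d + 1) / 2) = d * (d + 1) :=
    Nat.mul_div_cancel' (Nat.even_mul_succ_self d).two_dvd
  have hpos : 0 < d * (d + 1) := by positivity
  obtain ⟨n, hn, hb⟩ := exists_exact_design (fun x : X => phi (x : Vec d)) (N := N)
    (by rw [card_halfIdx]; omega)
  rw [card_halfIdx] at hb
  have hN0 : (0 : ℝ) < N := by
    have : 0 < N := by omega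
    exact_mod_cast this
  have hD : ((d * (d + 1) / 2 : ℕ) : ℝ) = d * (d + 1) / 2 := by
    have : ((2 * (d * (d + 1) / 2) : ℕ) : ℝ) = d * (d + 1) := by rw [hdd]; push_cast; ring
    push_cast at this ⊢
    linarith
  have hNr : (d : ℝ) * (d + 1) ≤ N := by exact_mod_cast hN
  have hd1 : (1 : ℝ) ≤ d := by exact_mod_cast hd
  -- For D = d(d+1)/2 the assumption is N ≥ 2D, so D/(N - D) ≤ 2D/N, and D ≤ d².
  have hK : 3 * (((d * (d + 1) / 2 : ℕ) : ℝ) / (N - (d * (d + 1) / 2 : ℕ))) ≤ 6 * d ^ 2 / N := by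
    have hN2 : 2 * ((d : ℝ) * (d + 1) / 2) ≤ N := by linarith
    have hle : (d : ℝ) * (d + 1) / 2 ≤ d ^ 2 := by nlinarith
    have h0 : 0 ≤ (d : ℝ) * (d + 1) / 2 := by positivity
    rw [hD, ← mul_div_assoc, div_le_div_iff₀ (by nlinarith) hN0]
    generalize (d : ℝ) * (d + 1) / 2 = D at *
    have h1 : 0 ≤ (N - 2 * D) * (6 * (d : ℝ) ^ 2 - 3 * D) :=
      mul_nonneg (sub_nonneg.2 hN2) (by linarith)
    nlinarith [mul_nonneg h0 (sub_nonneg.2 hle)]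
  have hK0 : 0 ≤ ((d * (d + 1) / 2 : ℕ) : ℝ) / (N - (d * (d + 1) / 2 : ℕ)) := by
    rw [hD]
    exact div_nonneg (by positivity) (by nlinarith)
  have hval : phiValue (R.alloc N) ≤ ENNReal.ofReal (6 * d ^ 2 / N) := by
    refine (hR.alloc_opt N n hn.le).trans ((?_ : _ ≤ ENNReal.ofReal _).trans
      (ENNReal.ofReal_le_ofReal hK))
    rw [ENNReal.ofReal_mul (by norm_num), ENNReal.ofReal_ofNat]
    gcongr
    exact iSup_le fun x => (invQuad_le_iff (fun _ => Nat.cast_nonneg _) hK0).2 (hb x)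
  exact (invQuad_le_iff (fun _ => Nat.cast_nonneg _) (by positivity)).1 ((le_iSup _ x).trans hval)

end

/-! ### Concentration -/

section Concentration

variable {Ω κ : Type*} [MeasurableSpace Ω] {P : Measure Ω}

theorem _root_.ProbabilityTheory.HasSubgaussianMGF.mono {Y : Ω → ℝ} {c c' : NNReal}
    (h : HasSubgaussianMGF Y c P) (hc : c ≤ c') : HasSubgaussianMGF Y c' P :=
  ⟨h.integrable_exp_mul, fun t => (h.mgf_le t).trans (Real.exp_le_exp.2 (by gcongr))⟩

theorem measure_lt_le_ofReal [IsProbabilityMeasure P] {Y : Ω → ℝ} {t r : ℝ}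
    (h : P.real {ω | t ≤ Y ω} ≤ r) : P {ω | t < Y ω} ≤ ENNReal.ofReal r := by
  have hsub : {ω | t < Y ω} ⊆ {ω | t ≤ Y ω} := fun ω (hω : t < Y ω) => hω.le
  refine (measure_mono hsub).trans ?_
  rw [← ofReal_measureReal]
  exact ENNReal.ofReal_le_ofReal h

theorem measure_lt_abs_le [IsProbabilityMeasure P] {Y : Ω → ℝ} {t r : ℝ} (hr : 0 ≤ r)
    (h : P.real {ω | t ≤ Y ω} ≤ r) (h' : P.real {ω | t ≤ -Y ω} ≤ r) :
    P {ω | t < |Y ω|} ≤ ENNReal.ofReal (2 * r) := by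
  have hsub : {ω | t < |Y ω|} ⊆ {ω | t < Y ω} ∪ {ω | t < -Y ω} := fun ω (hω : t < |Y ω|) => lt_abs.1 hω
  refine (measure_mono hsub).trans ((measure_union_le _ _).trans ?_)
  rw [two_mul, ENNReal.ofReal_add hr hr]
  exact add_le_add (measure_lt_le_ofReal h) (measure_lt_le_ofReal h')

/-- Two-sided tail of a linear combination of independent sub-Gaussian variables. -/
theorem measure_lt_abs_sum_le {ξ : κ → Ω → ℝ} (hind : iIndepFun ξ P) {c : κ → NNReal}
    (hξ : ∀ p, HasSubgaussianMGF (ξ p) (c p) P) (T : Finset κ) (a : κ → ℝ) {t K : ℝ} (ht : 0 ≤ t)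
    (hK : ∑ p ∈ T, a p ^ 2 * c p ≤ K) :
    P {ω | t < |∑ p ∈ T, a p * ξ p ω|} ≤ ENNReal.ofReal (2 * Real.exp (-t ^ 2 / (2 * K))) := by
  have : IsProbabilityMeasure P := hind.isProbabilityMeasure
  have hK0 : 0 ≤ K := (Finset.sum_nonneg fun p _ => by positivity).trans hK
  have hind' : iIndepFun (fun p ω => a p * ξ p ω) P :=
    hind.comp (fun p x => a p * x) fun p => measurable_const_mul (a p)
  have hsub : HasSubgaussianMGF (fun ω => ∑ p ∈ T, a p * ξ p ω) K.toNNReal P := by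
    refine (HasSubgaussianMGF.sum_of_iIndepFun hind' fun p _ => (hξ p).const_mul (a p)).mono ?_
    rw [← NNReal.coe_le_coe, Real.coe_toNNReal K hK0]
    push_cast
    exact hK
  refine measure_lt_abs_le (Real.exp_pos _).le ?_ ?_
  · simpa [Real.coe_toNNReal K hK0] using hsub.measure_ge_le ht
  · simpa [Real.coe_toNNReal K hK0] using hsub.neg.measure_ge_le ht

theorem lintegral_exp_sq_gaussian :
    ∫⁻ g, ENNReal.ofReal (Real.exp (g ^ 2 / 4)) ∂(gaussianReal 0 1) ≤ 2 := by
  rw [gaussianReal_of_var_ne_zero _ one_ne_zero, lintegral_withDensity_eq_lintegral_mul _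
    (measurable_gaussianPDF 0 1) (by fun_prop)]
  have h : ∀ g : ℝ, (gaussianPDF 0 1 * fun g => ENNReal.ofReal (Real.exp (g ^ 2 / 4))) g =
      ENNReal.ofReal (√2) * gaussianPDF 0 2 g := by
    intro g
    rw [Pi.mul_apply, gaussianPDF, gaussianPDF, ← ENNReal.ofReal_mul (gaussianPDFReal_nonneg _ _ _),
      ← ENNReal.ofReal_mul (Real.sqrt_nonneg _)]
    congr 1
    rw [gaussianPDFReal, gaussianPDFReal, mul_assoc, ← Real.exp_add]
    have e : -(g - 0) ^ 2 / (2 * ((1 : NNReal) : ℝ)) + g ^ 2 / 4 =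
      -(g - 0) ^ 2 / (2 * ((2 : NNReal) : ℝ)) := by push_cast; ring
    rw [e, ← mul_assoc]
    congr 1
    push_cast
    rw [Real.sqrt_mul (by positivity) (2 : ℝ), mul_one, mul_inv]
    field_simp
  rw [lintegral_congr h, lintegral_const_mul _ (measurable_gaussianPDF 0 2),
    lintegral_gaussianPDF_eq_one _ two_ne_zero, mul_one, ← ENNReal.ofReal_ofNat]
  refine ENNReal.ofReal_le_ofReal ?_
  rw [Real.sqrt_le_left (by norm_num)]
  norm_num

/-- Gaussian linearization: exp(Y²/(4c)) is the average of exp(Y g/√(2c)) over a standard Gaussian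
g. Exchanging the integrals and using the sub-Gaussian bound in Y leaves E exp(g²/4) = √2. -/
theorem lintegral_exp_sq_le [IsProbabilityMeasure P] {Y : Ω → ℝ} (hY : Measurable Y) {c : NNReal}
    (hc : 0 < c) (h : HasSubgaussianMGF Y c P) :
    ∫⁻ ω, ENNReal.ofReal (Real.exp (Y ω ^ 2 / (4 * c))) ∂P ≤ 2 := by
  have hc' : (0 : ℝ) < c := hc
  have hs : √(2 * (c : ℝ)) ^ 2 = 2 * c := Real.sq_sqrt (by positivity)
  have hs0 : √(2 * (c : ℝ)) ≠ 0 := (Real.sqrt_pos.2 (by positivity)).ne'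
  have h1 : ∀ ω, ENNReal.ofReal (Real.exp (Y ω ^ 2 / (4 * c))) =
      ∫⁻ g, ENNReal.ofReal (Real.exp (Y ω / √(2 * c) * g)) ∂(gaussianReal 0 1) := by
    intro ω
    rw [← ofReal_integral_eq_lintegral_ofReal (integrable_exp_mul_gaussianReal _)
      (ae_of_all _ fun _ => (Real.exp_pos _).le)]
    have := congrFun (mgf_fun_id_gaussianReal (μ := 0) (v := 1)) (Y ω / √(2 * c))
    rw [mgf] at this
    rw [this]
    congr 2
    rw [div_pow, hs]
    push_cast
    field_simp
    ring
  simp_rw [h1]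
  rw [lintegral_lintegral_swap (by fun_prop)]
  refine (lintegral_mono fun g => ?_).trans lintegral_exp_sq_gaussian
  have h2 : ∀ ω, Y ω / √(2 * c) * g = g / √(2 * c) * Y ω := fun ω => by ring
  simp_rw [h2]
  rw [← ofReal_integral_eq_lintegral_ofReal (h.integrable_exp_mul _)
      (ae_of_all _ fun _ => (Real.exp_pos _).le)]
  refine ENNReal.ofReal_le_ofReal ((h.mgf_le _).trans (Real.exp_le_exp.2 (le_of_eq ?_)))
  rw [div_pow, hs]
  field_simp
  ring

theorem exp_le_one_add_add_sq_mul_exp (x : ℝ) :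
    Real.exp x ≤ 1 + x + x ^ 2 * Real.exp |x| := by
  have h := Complex.norm_exp_sub_sum_le_norm_mul_exp (x : ℂ) 2
  have h2 : Complex.exp x - ∑ m ∈ Finset.range 2, (x : ℂ) ^ m / (m.factorial : ℂ) =
      ((Real.exp x - 1 - x : ℝ) : ℂ) := by
    simp [Finset.sum_range_succ]
    ring
  rw [h2, Complex.norm_real, Complex.norm_real, Real.norm_eq_abs, Real.norm_eq_abs, sq_abs] at h
  linarith [(abs_le.1 h).2]

/-- The centered square of a strictly sub-Gaussian variable is sub-exponential. -/
theorem integrable_and_mgf_sq_sub_le [IsProbabilityMeasure P] {Y : Ω → ℝ} (hY : Measurable Y)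
    {c : NNReal} (hc : 0 < c) (h : HasSubgaussianMGF Y c P) (hvar : ∫ ω, Y ω ^ 2 ∂P = c) {s : ℝ}
    (hs : |s| * c ≤ 1 / 8) :
    Integrable (fun ω => Real.exp (s * (Y ω ^ 2 - c))) P ∧
      mgf (fun ω => Y ω ^ 2 - c) P s ≤ Real.exp (256 * (s * c) ^ 2) := by
  have hc' : (0 : ℝ) < c := hc
  have hlin := lintegral_exp_sq_le hY hc h
  have hE : Integrable (fun ω => Real.exp (Y ω ^ 2 / (4 * c))) P := by
    refine ⟨by fun_prop, ?_⟩
    rw [hasFiniteIntegral_iff_ofReal (ae_of_all _ fun _ => (Real.exp_pos _).le)]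
    exact hlin.trans_lt (by simp)
  have hEle : ∫ ω, Real.exp (Y ω ^ 2 / (4 * c)) ∂P ≤ 2 := by
    have h1 := ofReal_integral_eq_lintegral_ofReal hE (ae_of_all _ fun _ => (Real.exp_pos _).le)
    rw [← h1, ← ENNReal.ofReal_ofNat] at hlin
    exact (ENNReal.ofReal_le_ofReal_iff (by norm_num)).1 hlin
  have hsq : Integrable (fun ω => Y ω ^ 2) P := (h.memLp 2).integrable_sq
  -- Taylor to first order; since |s|c ≤ 1/8, half of the exponent Y²/(4c) absorbs e^{|sY²|} and the
  -- other half absorbs the square.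
  have hpt : ∀ ω, Real.exp (s * Y ω ^ 2) ≤
      1 + s * Y ω ^ 2 + 128 * (s * c) ^ 2 * Real.exp (Y ω ^ 2 / (4 * c)) := by
    intro ω
    refine (exp_le_one_add_add_sq_mul_exp _).trans ?_
    set u := Y ω ^ 2 with hu
    have hu0 : 0 ≤ u := sq_nonneg _
    have h1 : (u / (8 * c)) ^ 2 ≤ 2 * Real.exp (u / (8 * c)) := by
      have := Real.quadratic_le_exp_of_nonneg (x := u / (8 * c)) (by positivity)
      have h0 : 0 ≤ u / (8 * c) := by positivity
      linarith
    have h2 : |s * u| ≤ u / (8 * c) := by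
      rw [abs_mul, abs_of_nonneg hu0, le_div_iff₀ (by positivity)]
      nlinarith
    have h3 : (s * u) ^ 2 = 64 * (s * c) ^ 2 * (u / (8 * c)) ^ 2 := by
      field_simp
      ring
    have h4 : Real.exp (u / (4 * c)) = Real.exp (u / (8 * c)) * Real.exp (u / (8 * c)) := by
      rw [← Real.exp_add]; congr 1; field_simp; ring
    have h5 : (s * u) ^ 2 * Real.exp |s * u| ≤
        64 * (s * c) ^ 2 * (2 * Real.exp (u / (8 * c))) * Real.exp (u / (8 * c)) := by
      rw [h3]
      gcongr
    rw [h4]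
    linarith
  have hint : Integrable (fun ω => Real.exp (s * Y ω ^ 2)) P := by
    refine Integrable.mono' (((integrable_const 1).add (hsq.const_mul s)).add
      (hE.const_mul (128 * (s * c) ^ 2))) (by fun_prop) (ae_of_all _ fun ω => ?_)
    rw [Real.norm_eq_abs, abs_of_pos (Real.exp_pos _)]
    exact hpt ω
  have hsplit : ∀ ω, Real.exp (s * (Y ω ^ 2 - c)) = Real.exp (-(s * c)) * Real.exp (s * Y ω ^ 2) :=
    fun ω => by rw [← Real.exp_add]; congr 1; ring
  refine ⟨by simp_rw [hsplit]; exact hint.const_mul _, ?_⟩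
  rw [mgf]
  simp_rw [hsplit]
  rw [integral_const_mul]
  -- Here the variance must equal the proxy c: the linear term is exactly s c and cancels against
  -- the centering factor exp(-s c).
  have hle : ∫ ω, Real.exp (s * Y ω ^ 2) ∂P ≤ 1 + s * c + 256 * (s * c) ^ 2 := by
    calc ∫ ω, Real.exp (s * Y ω ^ 2) ∂P
        ≤ ∫ ω, (1 + s * Y ω ^ 2 + 128 * (s * c) ^ 2 * Real.exp (Y ω ^ 2 / (4 * c))) ∂P :=
          integral_mono hint (((integrable_const 1).add (hsq.const_mul s)).add
            (hE.const_mul (128 * (s * c) ^ 2))) hpt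
      _ = 1 + s * c + 128 * (s * c) ^ 2 * ∫ ω, Real.exp (Y ω ^ 2 / (4 * c)) ∂P := by
          have h1 : Integrable (fun ω => 1 + s * Y ω ^ 2) P :=
            (integrable_const 1).add (hsq.const_mul s)
          rw [integral_add h1 (hE.const_mul _),
            integral_add (integrable_const 1) (hsq.const_mul s), integral_const_mul,
            integral_const_mul, hvar]
          simp
      _ ≤ 1 + s * c + 256 * (s * c) ^ 2 := by
          nlinarith [sq_nonneg (s * c)]
  calc Real.exp (-(s * c)) * ∫ ω, Real.exp (s * Y ω ^ 2) ∂P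
      ≤ Real.exp (-(s * c)) * Real.exp (s * c + 256 * (s * c) ^ 2) := by
        gcongr
        refine hle.trans ?_
        have := Real.add_one_le_exp (s * c + 256 * (s * c) ^ 2)
        linarith
    _ = Real.exp (256 * (s * c) ^ 2) := by rw [← Real.exp_add]; congr 1; ring

/-- Two-sided tail of a linear combination of centered squares of independent strictly
sub-Gaussian variables. -/
theorem measure_lt_abs_sum_sq_sub_le {ξ : κ → Ω → ℝ} (hind : iIndepFun ξ P)
    (hm : ∀ p, Measurable (ξ p)) {c : κ → NNReal} (hc : ∀ p, 0 < c p)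
    (hξ : ∀ p, HasSubgaussianMGF (ξ p) (c p) P) (hvar : ∀ p, ∫ ω, ξ p ω ^ 2 ∂P = c p)
    (T : Finset κ) (a : κ → ℝ) {t s H : ℝ} (hs : 0 ≤ s)
    (ha : ∀ p ∈ T, s * (|a p| * c p) ≤ 1 / 8) (hH : ∑ p ∈ T, (a p * c p) ^ 2 ≤ H) :
    P {ω | t < |∑ p ∈ T, a p * (ξ p ω ^ 2 - c p)|} ≤
      ENNReal.ofReal (2 * Real.exp (-(s * t) + 256 * s ^ 2 * H)) := by
  have : IsProbabilityMeasure P := hind.isProbabilityMeasure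
  have key : ∀ b : κ → ℝ, (∀ p, b p = a p ∨ b p = -a p) →
      P.real {ω | t ≤ ∑ p ∈ T, b p * (ξ p ω ^ 2 - c p)} ≤
        Real.exp (-(s * t) + 256 * s ^ 2 * H) := by
    intro b hb
    have hind' : iIndepFun (fun p ω => b p * (ξ p ω ^ 2 - c p)) P :=
      hind.comp (fun p x => b p * (x ^ 2 - c p)) fun p => by fun_prop
    have hm' : ∀ p, Measurable fun ω => b p * (ξ p ω ^ 2 - c p) := fun p => by
      have := hm p
      fun_prop
    have habs : ∀ p, |b p| = |a p| := fun p => by rcases hb p with h | h <;> simp [h]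
    have hone : ∀ p ∈ T, Integrable (fun ω => Real.exp (s * (b p * (ξ p ω ^ 2 - c p)))) P ∧
        mgf (fun ω => b p * (ξ p ω ^ 2 - c p)) P s ≤ Real.exp (256 * s ^ 2 * (a p * c p) ^ 2) := by
      intro p hp
      have hsb : |s * b p| * c p ≤ 1 / 8 := by
        rw [abs_mul, abs_of_nonneg hs, habs, mul_assoc]
        exact ha p hp
      have h1 := integrable_and_mgf_sq_sub_le (hm p) (hc p) (hξ p) (hvar p) hsb
      refine ⟨by simpa only [mul_assoc] using h1.1, ?_⟩
      rw [mgf_const_mul, mul_comm (b p)]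
      refine h1.2.trans (Real.exp_le_exp.2 (le_of_eq ?_))
      have : b p ^ 2 = a p ^ 2 := by rw [← sq_abs, habs, sq_abs]
      linear_combination 256 * s ^ 2 * (c p : ℝ) ^ 2 * this
    have hsum : ∀ ω, ∑ p ∈ T, b p * (ξ p ω ^ 2 - c p) =
        (∑ p ∈ T, fun ω => b p * (ξ p ω ^ 2 - c p)) ω := fun ω => by
      rw [Finset.sum_apply]
    simp_rw [hsum]
    refine (measure_ge_le_exp_mul_mgf t hs
      (hind'.integrable_exp_mul_sum hm' fun p hp => (hone p hp).1)).trans ?_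
    rw [hind'.mgf_sum hm' T, neg_mul, Real.exp_add]
    refine mul_le_mul_of_nonneg_left ?_ (Real.exp_pos _).le
    refine (Finset.prod_le_prod (fun _ _ => mgf_nonneg) fun p hp => (hone p hp).2).trans ?_
    rw [← Real.exp_sum, ← Finset.mul_sum]
    exact Real.exp_le_exp.2 (by gcongr)
  refine measure_lt_abs_le (Real.exp_pos _).le (key a fun _ => .inl rfl) ?_
  have := key (fun p => -a p) fun _ => .inr rfl
  simpa only [neg_mul, Finset.sum_neg_distrib] using this

/-- A bound that holds for every fixed value of an independent variable holds. -/
theorem measure_le_of_indepFun {α β : Type*} [MeasurableSpace α] [MeasurableSpace β]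
    [IsProbabilityMeasure P] {U : Ω → α} {V : Ω → β} (hU : Measurable U) (hV : Measurable V)
    (hind : IndepFun U V P) {B : Set (α × β)} (hB : MeasurableSet B) {p : ℝ≥0∞}
    (h : ∀ u, P {ω | (u, V ω) ∈ B} ≤ p) : P {ω | (U ω, V ω) ∈ B} ≤ p := by
  have hmap := (indepFun_iff_map_prod_eq_prod_map_map hU.aemeasurable hV.aemeasurable).1 hind
  have : IsProbabilityMeasure (P.map U) := Measure.isProbabilityMeasure_map hU.aemeasurable
  have : IsProbabilityMeasure (P.map V) := Measure.isProbabilityMeasure_map hV.aemeasurable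
  calc P {ω | (U ω, V ω) ∈ B} = (P.map fun ω => (U ω, V ω)) B := by
        rw [Measure.map_apply (hU.prodMk hV) hB]; rfl
    _ = ∫⁻ u, P.map V (Prod.mk u ⁻¹' B) ∂(P.map U) := by rw [hmap, Measure.prod_apply hB]
    _ ≤ ∫⁻ _, p ∂(P.map U) := by
        refine lintegral_mono fun u => ?_
        rw [Measure.map_apply hV (measurable_prodMk_left hB)]
        exact h u
    _ = p := by simp

end Concentration

/-! ### Phases -/

section Phases

variable {d : ℕ} {X : Finset (Vec d)}

/-- The rewards of the phases before phase `k`. -/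
def truncate (k : ℕ) (y : Rewards X) : Rewards X := fun j x i => if j < k then y j x i else 0

theorem truncate_apply {k j : ℕ} (h : j < k) (y : Rewards X) : truncate k y j = y j := by
  funext x i
  exact if_pos h

variable {Ω : Type*} [MeasurableSpace Ω] {P : Measure Ω} {S : Matrix (Fin d) (Fin d) ℝ}
  {η : ℕ → X → ℕ → Ω → ℝ}

theorem IsNoise.measurable_rewards (h : IsNoise P S η) (θ : Vec d) :
    Measurable (rewards θ η) := by
  refine measurable_pi_lambda _ fun k => measurable_pi_lambda _ fun x =>
    measurable_pi_lambda _ fun i => ?_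
  exact measurable_const.add (h.measurable k x i)

theorem measurable_truncate (k : ℕ) : Measurable (truncate (X := X) k) := by
  refine measurable_pi_lambda _ fun j => measurable_pi_lambda _ fun x =>
    measurable_pi_lambda _ fun i => ?_
  unfold truncate
  split_ifs
  · fun_prop
  · exact measurable_const

/-- Indexed by a sigma type so that sums over pulls, whose number varies with the arm, are sums over
one finite set of independent variables. -/
theorem IsNoise.iIndepFun_phase (h : IsNoise P S η) (k : ℕ) :
    iIndepFun (fun p : (_ : X) × ℕ => η k p.1 p.2) P :=
  h.indep.precomp (g := fun p : (_ : X) × ℕ => (k, p.1, p.2)) fun p q hpq => by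
    simp only [Prod.mk.injEq, true_and] at hpq
    exact Sigma.ext hpq.1 (heq_of_eq hpq.2)

/-- The two sides are measurable with respect to noise with disjoint index sets, phases before k and
phase k; the truncated later phases are constant. -/
theorem IsNoise.indepFun_truncate (h : IsNoise P S η) (θ : Vec d) (k : ℕ) :
    IndepFun (fun ω => truncate k (rewards θ η ω)) (fun ω x i => η k x i ω) P := by
  have hd := indep_iSup_of_disjoint (fun p : ℕ × X × ℕ => (h.measurable p.1 p.2.1 p.2.2).comap_le)
    ((iIndepFun_iff_iIndep _ _ _).1 h.indep) (S := {p : ℕ × X × ℕ | p.1 < k})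
    (T := {p : ℕ × X × ℕ | p.1 = k})
    (Set.disjoint_left.2 fun p (h1 : p.1 < k) (h2 : p.1 = k) => h1.ne h2)
  rw [IndepFun_iff_Indep]
  refine indep_of_indep_of_le_left (indep_of_indep_of_le_right hd ?_) ?_
  · rw [← measurable_iff_comap_le]
    refine @measurable_pi_lambda _ _ _ (_) _ _ fun x => @measurable_pi_lambda _ _ _ (_) _ _
      fun i => ?_
    rw [measurable_iff_comap_le]
    exact le_iSup₂_of_le (k, x, i) rfl le_rfl
  · rw [← measurable_iff_comap_le]
    refine @measurable_pi_lambda _ _ _ (_) _ _ fun j => @measurable_pi_lambda _ _ _ (_) _ _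
      fun x => @measurable_pi_lambda _ _ _ (_) _ _ fun i => ?_
    by_cases hj : j < k
    · simp only [truncate, hj, if_true, rewards]
      refine @Measurable.const_add _ _ _ _ _ (_) _ ?_ _
      rw [measurable_iff_comap_le]
      exact le_iSup₂_of_le (j, x, i) hj le_rfl
    · simp only [truncate, hj, if_false]
      exact @measurable_const _ _ _ (_) _

end Phases

/-! ### Weighted least squares -/

section LeastSquares

variable {ι m : Type*} [Fintype ι] [Fintype m] {f : ι → m → ℝ} {n : ι → ℕ} {r : ι → ℝ}

theorem exists_mulVec_eq_wls (hr : ∀ i, 0 < r i) (y : ι → ℕ → ℝ) :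
    ∃ s, infoMatrix f (fun i => n i * r i) *ᵥ s =
      ∑ i, ∑ j ∈ Finset.range (n i), (r i * y i j) • f i := by
  simp_rw [← Finset.sum_smul]
  refine exists_mulVec_eq_sum (fun i => mul_nonneg (Nat.cast_nonneg _) (hr i).le) fun i hi => ?_
  have : n i = 0 := by
    rcases mul_eq_zero.1 hi with h | h
    · exact_mod_cast h
    · exact absurd h (hr i).ne'
  simp [this]

theorem dotProduct_wls (hr : ∀ i, 0 < r i) (y : ι → ℕ → ℝ) {v w : m → ℝ}
    (hw : infoMatrix f (fun i => n i * r i) *ᵥ w = v) :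
    v ⬝ᵥ solve (infoMatrix f fun i => n i * r i)
      (∑ i, ∑ j ∈ Finset.range (n i), (r i * y i j) • f i) =
      ∑ i, ∑ j ∈ Finset.range (n i), (f i ⬝ᵥ w) * r i * y i j := by
  rw [dotProduct_solve hw (exists_mulVec_eq_wls hr y), dotProduct_sum]
  refine Finset.sum_congr rfl fun i _ => ?_
  rw [dotProduct_sum]
  refine Finset.sum_congr rfl fun j _ => ?_
  rw [dotProduct_smul, smul_eq_mul, dotProduct_comm]
  ring

/-- The estimation error of weighted least squares. -/
theorem dotProduct_wls_sub (hr : ∀ i, 0 < r i) (y : ι → ℕ → ℝ) (θ : m → ℝ) {v w : m → ℝ}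
    (hw : infoMatrix f (fun i => n i * r i) *ᵥ w = v) :
    v ⬝ᵥ solve (infoMatrix f fun i => n i * r i)
      (∑ i, ∑ j ∈ Finset.range (n i), (r i * y i j) • f i) - v ⬝ᵥ θ =
      ∑ i, ∑ j ∈ Finset.range (n i), (f i ⬝ᵥ w) * r i * (y i j - f i ⬝ᵥ θ) := by
  have h : v ⬝ᵥ θ = ∑ i, ∑ j ∈ Finset.range (n i), (f i ⬝ᵥ w) * r i * (f i ⬝ᵥ θ) := by
    rw [← hw, dotProduct_comm, dotProduct_infoMatrix_mulVec_comm, dotProduct_infoMatrix_mulVec]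
    refine Finset.sum_congr rfl fun i _ => ?_
    rw [Finset.sum_const, Finset.card_range, nsmul_eq_mul]
    ring
  rw [dotProduct_wls hr y hw, h]
  simp only [← Finset.sum_sub_distrib, mul_sub]

theorem sum_wls_weight_sq {v w : m → ℝ} (hw : infoMatrix f (fun i => n i * r i) *ᵥ w = v) :
    ∑ i, ∑ _j ∈ Finset.range (n i), (f i ⬝ᵥ w) ^ 2 * r i = v ⬝ᵥ w := by
  rw [← hw, dotProduct_comm, dotProduct_infoMatrix_mulVec_self]
  refine Finset.sum_congr rfl fun i _ => ?_
  rw [Finset.sum_const, Finset.card_range, nsmul_eq_mul]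
  ring

end LeastSquares

/-! ### Tail bounds for the noise of one phase -/

section Tail

variable {d : ℕ} {X : Finset (Vec d)} {Ω : Type*} [MeasurableSpace Ω] {P : Measure Ω}
  {S : Matrix (Fin d) (Fin d) ℝ} {η : ℕ → X → ℕ → Ω → ℝ}

/-- Tail of a double sum of the noise of one phase. -/
theorem IsNoise.measure_lt_abs_sum_le (h : IsNoise P S η) (hS : ∀ x : X, 0 ≤ armVar S x) (k : ℕ)
    (n : X → ℕ) (a : X → ℕ → ℝ) {t K : ℝ} (ht : 0 ≤ t)
    (hK : ∑ x, ∑ i ∈ Finset.range (n x), a x i ^ 2 * armVar S x ≤ K) :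
    P {ω | t < |∑ x, ∑ i ∈ Finset.range (n x), a x i * η k x i ω|} ≤
      ENNReal.ofReal (2 * Real.exp (-t ^ 2 / (2 * K))) := by
  have := HRage.measure_lt_abs_sum_le (h.iIndepFun_phase k)
    (fun p => h.subGaussian k p.1 p.2) (Finset.univ.sigma fun x => Finset.range (n x))
    (fun p => a p.1 p.2) ht (K := K)
    (by simpa only [Finset.sum_sigma, Real.coe_toNNReal _ (hS _)] using hK)
  simpa only [Finset.sum_sigma] using this

theorem IsNoise.measure_lt_abs_sum_sq_sub_le (h : IsNoise P S η) (hS : ∀ x : X, 0 < armVar S x)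
    (k : ℕ) (n : X → ℕ) (a : X → ℝ) {t s H : ℝ} (hs : 0 ≤ s)
    (ha : ∀ x, n x ≠ 0 → s * (|a x| * armVar S x) ≤ 1 / 8)
    (hH : ∑ x, ∑ _i ∈ Finset.range (n x), (a x * armVar S x) ^ 2 ≤ H) :
    P {ω | t < |∑ x, ∑ i ∈ Finset.range (n x), a x * (η k x i ω ^ 2 - armVar S x)|} ≤
      ENNReal.ofReal (2 * Real.exp (-(s * t) + 256 * s ^ 2 * H)) := by
  have hc : ∀ x : X, ((armVar S x).toNNReal : ℝ) = armVar S x := fun x =>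
    Real.coe_toNNReal _ (hS x).le
  have := HRage.measure_lt_abs_sum_sq_sub_le (h.iIndepFun_phase k)
    (fun p => h.measurable k p.1 p.2) (fun p => Real.toNNReal_pos.2 (hS p.1))
    (fun p => h.subGaussian k p.1 p.2) (fun p => by rw [hc]; exact h.var k p.1 p.2)
    (Finset.univ.sigma fun x => Finset.range (n x))
    (fun p => a p.1) (t := t) (H := H) hs
    (fun p hp => by
      rw [hc]
      refine ha p.1 fun h0 => ?_
      simp [h0] at hp)
    (by simpa only [Finset.sum_sigma, hc] using hH)
  simpa only [Finset.sum_sigma, hc] using this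

/-- Tail of the weighted least squares error in a direction `v`, for a fixed allocation. -/
theorem IsNoise.measure_lt_abs_wls_le (h : IsNoise P S η) (hS : ∀ x : X, 0 ≤ armVar S x)
    (θ : Vec d) (k : ℕ) (n : X → ℕ) {r : X → ℝ} (hr : ∀ x, 0 < r x) {v : Vec d} {ρ K t : ℝ}
    (hρ : ∀ x : X, r x * armVar S x ≤ ρ) (hρ0 : 0 ≤ ρ) (hK : 0 ≤ K) (ht : 0 ≤ t)
    (hv : QuadBound (fun x : X => (x : Vec d)) (fun x => n x * r x) v K) :
    P {ω | t < |v ⬝ᵥ solve (infoMatrix (fun x : X => (x : Vec d)) fun x => n x * r x)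
        (∑ x : X, ∑ i ∈ Finset.range (n x), (r x * rewards θ η ω k x i) • (x : Vec d)) -
          v ⬝ᵥ θ|} ≤
      ENNReal.ofReal (2 * Real.exp (-t ^ 2 / (2 * (ρ * K)))) := by
  obtain ⟨w, hw⟩ := hv.exists_mulVec_eq
  have hle := hv.dotProduct_le hK hw
  have he : ∀ ω, v ⬝ᵥ solve (infoMatrix (fun x : X => (x : Vec d)) fun x => n x * r x)
        (∑ x : X, ∑ i ∈ Finset.range (n x), (r x * rewards θ η ω k x i) • (x : Vec d)) -
          v ⬝ᵥ θ = ∑ x : X, ∑ i ∈ Finset.range (n x), ((x : Vec d) ⬝ᵥ w * r x) * η k x i ω := by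
    intro ω
    rw [dotProduct_wls_sub hr _ θ hw]
    simp only [rewards, add_sub_cancel_left]
  simp_rw [he]
  refine h.measure_lt_abs_sum_le hS k n (fun x _ => (x : Vec d) ⬝ᵥ w * r x) ht ?_
  -- The variance proxy of the error is ∑ n (xᵀw)² r² σ²; one factor r is spent on r σ² ≤ ρ, and the
  -- rest is vᵀw ≤ K.
  refine le_trans ?_ (mul_le_mul_of_nonneg_left hle hρ0)
  rw [← sum_wls_weight_sq hw, Finset.mul_sum]
  refine Finset.sum_le_sum fun x _ => ?_
  rw [Finset.mul_sum]
  refine Finset.sum_le_sum fun i _ => ?_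
  have := mul_le_mul_of_nonneg_left (hρ x)
    (mul_nonneg (sq_nonneg ((x : Vec d) ⬝ᵥ w)) (hr x).le)
  linarith

end Tail

/-! ### The half-vectorization -/

theorem phi_dotProduct {d : ℕ} {S : Matrix (Fin d) (Fin d) ℝ} (hS : ∀ i j, S i j = S j i)
    (x : Vec d) : phi x ⬝ᵥ (fun p : HalfIdx d => S p.1.1 p.1.2) = armVar S x := by
  classical
  let g : Fin d × Fin d → ℝ := fun p => x p.1 * x p.2 * S p.1 p.2
  have hg : ∀ p, g p.swap = g p := fun p => by
    simp only [g, Prod.fst_swap, Prod.snd_swap, hS p.2 p.1]; ring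
  have h1 : phi x ⬝ᵥ (fun p : HalfIdx d => S p.1.1 p.1.2) =
      ∑ p ∈ Finset.univ.filter (fun p : Fin d × Fin d => p.1 ≤ p.2),
        (if p.1 = p.2 then g p else 2 * g p) := by
    rw [dotProduct, Finset.sum_subtype (p := fun p : Fin d × Fin d => p.1 ≤ p.2) _ (by simp)]
    refine Finset.sum_congr rfl fun p _ => ?_
    simp only [phi, g, ite_mul, mul_assoc]
  have h2 : armVar S x = ∑ p, g p := by
    rw [Fintype.sum_prod_type]
    simp only [armVar, dotProduct, Matrix.mulVec, Finset.mul_sum, g]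
    exact Finset.sum_congr rfl fun i _ => Finset.sum_congr rfl fun j _ => by ring
  have h3 : ∑ p ∈ Finset.univ.filter (fun p : Fin d × Fin d => ¬ p.1 ≤ p.2), g p =
      ∑ p ∈ Finset.univ.filter (fun p : Fin d × Fin d => p.1 < p.2), g p := by
    refine Finset.sum_equiv (Equiv.prodComm _ _) (fun p => by simp) fun p _ => ?_
    exact (hg p).symm
  have h4 : ∀ p : Fin d × Fin d, (if p.1 = p.2 then g p else 2 * g p) =
      g p + if p.1 ≠ p.2 then g p else 0 := fun p => by
    split_ifs <;> first | contradiction | ring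
  rw [h1, h2, ← Finset.sum_filter_add_sum_filter_not Finset.univ (fun p : Fin d × Fin d => p.1 ≤ p.2), h3]
  simp_rw [h4]
  rw [Finset.sum_add_distrib, ← Finset.sum_filter, Finset.filter_filter]
  congr 2
  ext p
  simp [lt_iff_le_and_ne]

/-! ### Measurability -/

section DualNorm

variable {α ι m : Type*} [MeasurableSpace α] [Fintype ι] [Fintype m] {f : ι → m → ℝ}

/-- The dual norm is a supremum of functions continuous in the test vector, so a countable dense set
of test vectors suffices. -/
theorem measurable_invQuad {a : α → ι → ℝ} (ha : Measurable a) (ha0 : ∀ y i, 0 ≤ a y i)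
    {v : α → m → ℝ} (hv : Measurable v) :
    Measurable fun y => invQuad (infoMatrix f (a y)) (v y) := by
  have hsup : ∀ y, invQuad (infoMatrix f (a y)) (v y) =
      ⨆ k : ℕ, ENNReal.ofReal (2 * (v y ⬝ᵥ TopologicalSpace.denseSeq (m → ℝ) k) -
        ∑ i, a y i * (f i ⬝ᵥ TopologicalSpace.denseSeq (m → ℝ) k) ^ 2) := by
    intro y
    rw [invQuad_eq_iSup (ha0 y)]
    refine le_antisymm (iSup_le fun w => ?_) (iSup_le fun k => le_iSup (fun w : m → ℝ =>
      ENNReal.ofReal (2 * (v y ⬝ᵥ w) - ∑ i, a y i * (f i ⬝ᵥ w) ^ 2)) _)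
    have hcont : Continuous fun w : m → ℝ =>
        ENNReal.ofReal (2 * (v y ⬝ᵥ w) - ∑ i, a y i * (f i ⬝ᵥ w) ^ 2) := by
      refine ENNReal.continuous_ofReal.comp ?_
      unfold dotProduct
      fun_prop
    refine (TopologicalSpace.denseRange_denseSeq (m → ℝ)).induction_on w
      (isClosed_le hcont continuous_const) fun k => ?_
    exact le_iSup (fun k : ℕ => ENNReal.ofReal (2 * (v y ⬝ᵥ TopologicalSpace.denseSeq (m → ℝ) k) -
        ∑ i, a y i * (f i ⬝ᵥ TopologicalSpace.denseSeq (m → ℝ) k) ^ 2)) k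
  simp_rw [hsup]
  refine Measurable.iSup fun k => ENNReal.measurable_ofReal.comp ?_
  unfold dotProduct
  fun_prop

/-- Polarization. It replaces the arbitrarily chosen solution, whose measurability is unclear, by
two dual norms, which are measurable. -/
theorem dotProduct_solve_eq_invQuad {a : ι → ℝ} (ha : ∀ i, 0 ≤ a i) {v b : m → ℝ}
    (hv : ∃ w, infoMatrix f a *ᵥ w = v) (hb : ∃ u, infoMatrix f a *ᵥ u = b) :
    v ⬝ᵥ solve (infoMatrix f a) b = ((invQuad (infoMatrix f a) (v + b)).toReal -
      (invQuad (infoMatrix f a) (v - b)).toReal) / 4 := by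
  obtain ⟨w, hw⟩ := hv
  rw [dotProduct_solve hw hb]
  obtain ⟨u, hu⟩ := hb
  have h1 : infoMatrix f a *ᵥ (w + u) = v + b := by rw [Matrix.mulVec_add, hw, hu]
  have h2 : infoMatrix f a *ᵥ (w - u) = v - b := by rw [Matrix.mulVec_sub, hw, hu]
  rw [invQuad_of_mulVec_eq h1, invQuad_of_mulVec_eq h2,
    ENNReal.toReal_ofReal (dotProduct_nonneg_of_mulVec_eq ha h1),
    ENNReal.toReal_ofReal (dotProduct_nonneg_of_mulVec_eq ha h2)]
  have h3 : v ⬝ᵥ u = w ⬝ᵥ b := by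
    rw [← hw, dotProduct_comm, dotProduct_infoMatrix_mulVec_comm, hu]
  simp only [add_dotProduct, dotProduct_add, sub_dotProduct, dotProduct_sub]
  rw [h3, dotProduct_comm b w]
  ring

theorem measurable_dotProduct_solve {a : α → ι → ℝ} (ha : Measurable a) (ha0 : ∀ y i, 0 ≤ a y i)
    {b : α → m → ℝ} (hb : Measurable b) (v : m → ℝ)
    (hv' : ∀ y, ∃ w, infoMatrix f (a y) *ᵥ w = v) (hb' : ∀ y, ∃ u, infoMatrix f (a y) *ᵥ u = b y) :
    Measurable fun y => v ⬝ᵥ solve (infoMatrix f (a y)) (b y) := by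
  simp_rw [fun y => dotProduct_solve_eq_invQuad (ha0 y) (hv' y) (hb' y)]
  exact ((measurable_invQuad ha ha0 (hb.const_add v)).ennreal_toReal.sub
    (measurable_invQuad ha ha0 (hb.const_sub v)).ennreal_toReal).div_const 4

theorem measurable_sum_range {n : α → ℕ} (hn : Measurable n) {g : α → ℕ → ℝ}
    (hg : ∀ i, Measurable fun y => g y i) :
    Measurable fun y => ∑ i ∈ Finset.range (n y), g y i := by
  have : Measurable fun p : α × ℕ => ∑ i ∈ Finset.range p.2, g p.1 i :=
    measurable_from_prod_countable_left fun k =>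
      show Measurable fun y => ∑ i ∈ Finset.range k, g y i from
        Finset.measurable_fun_sum _ fun i _ => hg i
  exact this.comp (measurable_id.prodMk hn)

end DualNorm

/-- Only finitely many subsets of A occur. Stating this with simple functions avoids putting a
σ-algebra on finite sets of items or on states. -/
theorem exists_simpleFunc_filter {α β : Type*} [MeasurableSpace α] (A : Finset β)
    (p : α → β → Prop) [∀ y, DecidablePred (p y)] (h : ∀ z ∈ A, MeasurableSet {y | p y z}) :
    ∃ φ : SimpleFunc α (Finset β), ∀ y, φ y = A.filter (p y) := by
  classical
  refine ⟨⟨fun y => A.filter (p y), fun B => ?_, ?_⟩, fun y => rfl⟩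
  · have : (fun y => A.filter (p y)) ⁻¹' {B} =
        {y | (∀ z ∈ A, p y z ↔ z ∈ B)} ∩ {_y | B ⊆ A} := by
      ext y
      simp only [Set.mem_preimage, Set.mem_singleton_iff, Set.mem_inter_iff, Set.mem_ofPred_eq]
      constructor
      · rintro rfl
        exact ⟨fun z hz => by simp [hz], Finset.filter_subset _ _⟩
      · rintro ⟨h1, h2⟩
        ext z
        rw [Finset.mem_filter]
        exact ⟨fun hz => (h1 z hz.1).1 hz.2, fun hz => ⟨h2 hz, (h1 z (h2 hz)).2 hz⟩⟩
    rw [this]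
    refine MeasurableSet.inter ?_ (MeasurableSet.const _)
    have h2 : {y | ∀ z ∈ A, p y z ↔ z ∈ B} = ⋂ z ∈ A, {y | p y z ↔ z ∈ B} := by
      ext y; simp
    rw [h2]
    refine A.measurableSet_biInter fun z hz => ?_
    by_cases hzB : z ∈ B
    · simpa only [hzB, iff_true] using h z hz
    · simp only [hzB, iff_false]
      exact (h z hz).compl
  · exact A.powerset.finite_toSet.subset (by
      rintro _ ⟨y, rfl⟩
      exact Finset.mem_coe.2 (Finset.mem_powerset.2 (Finset.filter_subset _ _)))

/-! ### Measurability of the pulls, the estimates and the states -/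

section Algorithm

variable {d : ℕ} {I : Input d} {R : Choices I.X}

theorem roundSet_bai {A : Finset (Vec d)} {v : Vec d} :
    v ∈ roundSet .bai A ↔ ∃ z ∈ A, ∃ z' ∈ A, z ≠ z' ∧ z' - z = v := by
  classical
  simp only [roundSet, Finset.mem_image, Finset.mem_offDiag, Prod.exists]
  exact ⟨fun ⟨z, z', ⟨h1, h2, h3⟩, h4⟩ => ⟨z, h1, z', h2, h3, h4⟩,
    fun ⟨z, h1, z', h2, h3, h4⟩ => ⟨z, z', ⟨h1, h2, h3⟩, h4⟩⟩

/-- What the analysis uses about the input. -/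
structure Input.Regular (I : Input d) : Prop where
  dim_pos : 0 < d
  span : Submodule.span ℝ (I.X : Set (Vec d)) = ⊤
  vmin_pos : 0 < I.vmin
  vmin_le_vmax : I.vmin ≤ I.vmax
  δ_pos : 0 < I.δ
  δ_lt_one : I.δ < 1

theorem Input.Regular.nonempty (h : I.Regular) : I.X.Nonempty := nonempty_of_span h.dim_pos h.span

theorem Input.Regular.varEst_mem (h : I.Regular) (y : Rewards I.X) (x : I.X) :
    I.vmin ≤ varEst I R y x ∧ varEst I R y x ≤ I.vmax :=
  ⟨le_min (le_max_right _ _) h.vmin_le_vmax, min_le_right _ _⟩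

theorem Input.Regular.varEst_pos (h : I.Regular) (y : Rewards I.X) (x : I.X) :
    0 < varEst I R y x :=
  h.vmin_pos.trans_le (h.varEst_mem y x).1

theorem Input.Regular.roundTau_nonneg (h : I.Regular) (y : Rewards I.X) {ℓ : ℕ} (hℓ : ℓ ≠ 0)
    (st : State d) : 0 ≤ roundTau I R y ℓ st := by
  unfold roundTau
  rcases Nat.eq_zero_or_pos I.Z.card with hZ | hZ
  · simp [hZ]
  refine mul_nonneg (mul_nonneg (by unfold eps; positivity) ENNReal.toReal_nonneg)
    (Real.log_nonneg ?_)
  rw [le_div_iff₀ h.δ_pos]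
  have h1 : (1 : ℝ) ≤ ℓ := by exact_mod_cast Nat.one_le_iff_ne_zero.2 hℓ
  have h2 : (1 : ℝ) ≤ I.Z.card := by exact_mod_cast hZ
  have h3 : (1 : ℝ) ≤ (ℓ : ℝ) ^ 2 * I.Z.card := by nlinarith
  linarith [h.δ_lt_one]

theorem roundTheta_eq (y : Rewards I.X) (ℓ : ℕ) (st : State d) :
    roundTheta I R y ℓ st = solve (infoMatrix (fun x : I.X => (x : Vec d))
      fun x => (roundPulls I R y ℓ st x : ℝ) * (varEst I R y x)⁻¹)
    (∑ x : I.X, ∑ i ∈ Finset.range (roundPulls I R y ℓ st x),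
      ((varEst I R y x)⁻¹ * y (ℓ + 1) x i) • (x : Vec d)) := rfl

/-- Directions of a round are in the range of the information matrix of the round, with the
precision the round is designed for. -/
theorem Input.Regular.quadBound_round (h : I.Regular) (hR : R.Valid) (y : Rewards I.X) {ℓ : ℕ}
    (hℓ : ℓ ≠ 0) (hZ : I.Z.Nonempty) (st : State d) {v : Vec d}
    (hv : v ∈ roundSet I.obj st.active) :
    QuadBound (fun x : I.X => (x : Vec d))
      (fun x => (roundPulls I R y ℓ st x : ℝ) * (varEst I R y x)⁻¹) v
      (eps ℓ ^ 2 / (3 * Real.log (8 * (ℓ : ℝ) ^ 2 * I.Z.card / I.δ))) := by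
  have hs := fun x => h.varEst_pos (R := R) y x
  have hopt := hR.opt _ hs (roundSet I.obj st.active)
  have hlog : 0 < Real.log (8 * (ℓ : ℝ) ^ 2 * I.Z.card / I.δ) := by
    refine Real.log_pos ?_
    rw [lt_div_iff₀ h.δ_pos]
    have h1 : (1 : ℝ) ≤ ℓ := by exact_mod_cast Nat.one_le_iff_ne_zero.2 hℓ
    have h2 : (1 : ℝ) ≤ I.Z.card := by exact_mod_cast hZ.card_pos
    have h3 : (1 : ℝ) ≤ (ℓ : ℝ) ^ 2 * I.Z.card := by nlinarith
    linarith [h.δ_lt_one]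
  have heps : 0 < eps ℓ := by unfold eps; positivity
  refine (hopt.quadBound h.nonempty h.span hs hv).of_le fun x => ?_
  have hn : roundTau I R y ℓ st * R.design (varEst I R y) (roundSet I.obj st.active) x ≤
      roundPulls I R y ℓ st x := Nat.le_ceil _
  set lam := R.design (varEst I R y) (roundSet I.obj st.active) x
  have hK : 0 ≤ eps ℓ ^ 2 / (3 * Real.log (8 * (ℓ : ℝ) ^ 2 * I.Z.card / I.δ)) := by positivity
  have := mul_le_mul_of_nonneg_left hn hK
  have e : eps ℓ ^ 2 / (3 * Real.log (8 * (ℓ : ℝ) ^ 2 * I.Z.card / I.δ)) *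
      (roundTau I R y ℓ st * lam) =
      (optValue (varEst I R y) (roundSet I.obj st.active)).toReal * lam := by
    unfold roundTau
    field_simp
  rw [e] at this
  have := mul_le_mul_of_nonneg_right this (inv_nonneg.2 (hs x).le)
  rw [div_eq_mul_inv]
  linarith

theorem Input.Regular.exists_round (h : I.Regular) (hR : R.Valid) (y : Rewards I.X) {ℓ : ℕ}
    (hℓ : ℓ ≠ 0) (hZ : I.Z.Nonempty) (st : State d) {v : Vec d}
    (hv : v ∈ roundSet I.obj st.active) :
    ∃ w, infoMatrix (fun x : I.X => (x : Vec d))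
      (fun x => (roundPulls I R y ℓ st x : ℝ) * (varEst I R y x)⁻¹) *ᵥ w = v :=
  (h.quadBound_round hR y hℓ hZ st hv).exists_mulVec_eq

theorem Input.Regular.measurable_roundPulls (h : I.Regular) (hmeas : Measurable (varEst I R))
    (hR : R.Valid) (ℓ : ℕ)
    (st : State d) (x : I.X) : Measurable fun y => roundPulls I R y ℓ st x := by
  have hdes : Measurable fun y => R.design (varEst I R y) (roundSet I.obj st.active) :=
    (hR.measurable _).comp hmeas
  have hopt : Measurable fun y => optValue (varEst I R y) (roundSet I.obj st.active) := by
    -- The infimum over the uncountable simplex is attained at the chosen design, which is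
    -- measurable in the variances.
    have : ∀ y, optValue (varEst I R y) (roundSet I.obj st.active) =
        designValue (varEst I R y) (roundSet I.obj st.active)
          (R.design (varEst I R y) (roundSet I.obj st.active)) := fun y =>
      (hR.opt _ (fun x => h.varEst_pos y x) _).designValue_eq.symm
    simp_rw [this]
    unfold designValue
    refine Measurable.biSup _ (Finset.countable_toSet _) fun v _ => measurable_invQuad ?_
      (fun y x => div_nonneg ((hR.opt _ (fun x => h.varEst_pos y x) _).1.1 x)
        (h.varEst_pos y x).le) measurable_const
    exact measurable_pi_lambda _ fun x => ((measurable_pi_apply x).comp hdes).div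
      ((measurable_pi_apply x).comp hmeas)
  unfold roundPulls roundTau
  refine Measurable.nat_ceil (Measurable.mul ?_ ((measurable_pi_apply x).comp hdes))
  exact (hopt.ennreal_toReal.const_mul _).mul_const _

theorem Input.Regular.measurable_dotProduct_roundTheta (h : I.Regular) (hmeas : Measurable (varEst I R))
    (hR : R.Valid) {ℓ : ℕ}
    (hℓ : ℓ ≠ 0) (hZ : I.Z.Nonempty) (st : State d) {v : Vec d}
    (hv : v ∈ roundSet I.obj st.active) : Measurable fun y => v ⬝ᵥ roundTheta I R y ℓ st := by
  simp_rw [roundTheta_eq]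
  have hn := fun x => h.measurable_roundPulls hmeas hR ℓ st x
  have hs : ∀ x, Measurable fun y => (varEst I R y x)⁻¹ := fun x =>
    ((measurable_pi_apply x).comp hmeas).inv
  refine measurable_dotProduct_solve ?_ (fun y x => mul_nonneg (Nat.cast_nonneg _)
    (inv_nonneg.2 (h.varEst_pos y x).le)) ?_ v (fun y => h.exists_round hR y hℓ hZ st hv)
    fun y => exists_mulVec_eq_wls (fun x => inv_pos.2 (h.varEst_pos y x)) _
  · exact measurable_pi_lambda _ fun x => (measurable_from_nat.comp (hn x)).mul (hs x)
  · simp_rw [← Finset.sum_smul]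
    refine Finset.measurable_fun_sum _ fun x _ => Measurable.smul_const ?_ _
    exact measurable_sum_range (hn x) fun i => (hs x).mul (by fun_prop)

theorem Input.Regular.exists_simpleFunc_update (h : I.Regular) (hmeas : Measurable (varEst I R))
    (hR : R.Valid) {ℓ : ℕ}
    (hℓ : ℓ ≠ 0) (hZ : I.Z.Nonempty) (st : State d) :
    ∃ φ : SimpleFunc (Rewards I.X) (State d), ∀ y, φ y =
      update I.obj (roundTheta I R y ℓ st) (eps ℓ) st := by
  classical
  have hm : ∀ v ∈ roundSet I.obj st.active, Measurable fun y => v ⬝ᵥ roundTheta I R y ℓ st :=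
    fun v hv => h.measurable_dotProduct_roundTheta hmeas hR hℓ hZ st hv
  rcases hobj : I.obj with _ | α
  · rw [hobj] at hm
    obtain ⟨φ, hφ⟩ := exists_simpleFunc_filter (α := Rewards I.X) st.active
      (fun y z => ¬ ∃ z' ∈ st.active, eps ℓ < (z' - z) ⬝ᵥ roundTheta I R y ℓ st) (by
        intro z hz
        have : {y | ¬ ∃ z' ∈ st.active, eps ℓ < (z' - z) ⬝ᵥ roundTheta I R y ℓ st} =
            (⋃ z' ∈ st.active, {y | eps ℓ < (z' - z) ⬝ᵥ roundTheta I R y ℓ st})ᶜ := by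
          ext y; simp
        rw [this]
        refine (st.active.measurableSet_biUnion fun z' hz' => ?_).compl
        by_cases hzz : z = z'
        · subst hzz
          simp
        · exact measurableSet_lt measurable_const
            (hm _ (roundSet_bai.2 ⟨z, hz, z', hz', hzz, rfl⟩)))
    refine ⟨φ.map fun A => { st with active := A }, fun y => ?_⟩
    rw [SimpleFunc.map_apply, hφ]
    simp only [update]
  · rw [hobj] at hm
    obtain ⟨φ, hφ⟩ := exists_simpleFunc_filter (α := Rewards I.X) st.active
      (fun y z => α < z ⬝ᵥ roundTheta I R y ℓ st - eps ℓ) fun z hz =>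
        measurableSet_lt measurable_const ((hm z hz).sub_const _)
    obtain ⟨ψ, hψ⟩ := exists_simpleFunc_filter (α := Rewards I.X) st.active
      (fun y z => z ⬝ᵥ roundTheta I R y ℓ st + eps ℓ < α) fun z hz =>
        measurableSet_lt ((hm z hz).add_const _) measurable_const
    refine ⟨(φ.pair ψ).map fun AB => ⟨st.active \ (((st.good ∪ AB.1) \ st.good) ∪
      ((st.bad ∪ AB.2) \ st.bad)), st.good ∪ AB.1, st.bad ∪ AB.2⟩, fun y => ?_⟩
    rw [SimpleFunc.map_apply, SimpleFunc.pair_apply, hφ, hψ]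
    simp only [update]

/-- For each fixed current state the update is a simple function of the rewards; binding over the
finitely many current states gives the next one. -/
theorem Input.Regular.exists_simpleFunc_state (h : I.Regular) (hmeas : Measurable (varEst I R))
    (hR : R.Valid)
    (hZ : I.Z.Nonempty) (j : ℕ) :
    ∃ φ : SimpleFunc (Rewards I.X) (State d), ∀ y, φ y = state I R y j := by
  induction j with
  | zero => exact ⟨SimpleFunc.const _ ⟨I.Z, ∅, ∅⟩, fun y => rfl⟩
  | succ j ih =>
    obtain ⟨φ, hφ⟩ := ih
    choose ψ hψ using fun st => h.exists_simpleFunc_update hmeas hR (Nat.succ_ne_zero j) hZ st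
    refine ⟨φ.bind ψ, fun y => ?_⟩
    rw [SimpleFunc.bind_apply, hφ, hψ]
    rfl

end Algorithm

/-! ### The elimination rounds -/

section Locality

variable {d : ℕ} {I : Input d} {R : Choices I.X} {y y' : Rewards I.X}

theorem stageOneTheta_congr (h : y 0 = y' 0) : stageOneTheta I R y = stageOneTheta I R y' := by
  simp only [stageOneTheta, h]

theorem varEst_congr (h0 : y 0 = y' 0) (h1 : y 1 = y' 1) : varEst I R y = varEst I R y' := by
  funext x
  simp only [varEst, stageTwoFit, h1, stageOneTheta_congr h0]

theorem roundPulls_congr (h : varEst I R y = varEst I R y') (ℓ : ℕ) (st : State d) :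
    roundPulls I R y ℓ st = roundPulls I R y' ℓ st := by
  funext x
  simp only [roundPulls, roundTau, h]

theorem roundTheta_congr (h : varEst I R y = varEst I R y') {ℓ : ℕ} (st : State d)
    (hℓ : y (ℓ + 1) = y' (ℓ + 1)) : roundTheta I R y ℓ st = roundTheta I R y' ℓ st := by
  simp only [roundTheta, roundPulls_congr h, h, hℓ]

/-- Round ℓ reads phase ℓ + 1, so the last phase seen after j rounds is j + 1; phases 0 and 1 enter
through the variance estimates. -/
theorem state_congr {j : ℕ} (h : ∀ k ≤ j + 1, y k = y' k) : state I R y j = state I R y' j := by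
  induction j with
  | zero => rfl
  | succ j ih =>
    have hv : varEst I R y = varEst I R y' := varEst_congr (h 0 (by omega)) (h 1 (by omega))
    rw [state, state, ih fun k hk => h k (by omega), roundTheta_congr hv _ (h _ le_rfl)]

end Locality

/-! ### Conditioning on the earlier phases -/

section Conditioning

variable {d : ℕ} {X : Finset (Vec d)} {Ω : Type*} [MeasurableSpace Ω] {P : Measure Ω}
  {S : Matrix (Fin d) (Fin d) ℝ} {η : ℕ → X → ℕ → Ω → ℝ}

/-- An event that depends on the phases up to `k` has a probability at most its maximal probability
for fixed rewards of the phases before `k`. -/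
theorem IsNoise.measure_rewards_mem_le [IsProbabilityMeasure P] (h : IsNoise P S η) (θ : Vec d)
    (k : ℕ) {B : Set (Rewards X)} (hB : MeasurableSet B)
    (hloc : ∀ y y' : Rewards X, (∀ j ≤ k, y j = y' j) → (y ∈ B ↔ y' ∈ B)) {p : ℝ≥0∞}
    (hp : ∀ u : Rewards X, P {ω | Function.update u k (rewards θ η ω k) ∈ B} ≤ p) :
    P {ω | rewards θ η ω ∈ B} ≤ p := by
  let G : Rewards X × (X → ℕ → ℝ) → Rewards X := fun q =>
    Function.update q.1 k fun x i => (x : Vec d) ⬝ᵥ θ + q.2 x i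
  have hG : Measurable G := by
    refine measurable_pi_lambda _ fun j => ?_
    by_cases hj : j = k
    · subst hj
      simp only [G, Function.update_self]
      fun_prop
    · simp only [G, Function.update_of_ne hj]
      fun_prop
  have hm : Measurable fun ω x i => η k x i ω := measurable_pi_lambda _ fun x =>
    measurable_pi_lambda _ fun i => h.measurable k x i
  have := measure_le_of_indepFun ((measurable_truncate k).comp (h.measurable_rewards θ)) hm
    (h.indepFun_truncate θ k) (hG hB) (p := p) hp
  refine le_trans (le_of_eq ?_) this
  congr 1
  ext ω
  refine hloc _ _ fun j hj => ?_
  by_cases hjk : j = k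
  · subst hjk
    simp only [G, Function.update_self]
    rfl
  · simp only [G, Function.update_of_ne hjk]
    exact (truncate_apply (lt_of_le_of_ne hj hjk) _).symm

end Conditioning

/-! ### Failure probability of the rounds -/

section Rounds

variable {d : ℕ} {I : Input d} {R : Choices I.X} {S : Matrix (Fin d) (Fin d) ℝ} {θ : Vec d}

/-- This keeps the union bound of a round at |Z| directions instead of |Z|² pairs. -/
theorem card_directions_le {obj : Objective} {Z : Finset (Vec d)} (h : WellPosed obj Z θ) :
    (directions obj Z θ).card ≤ Z.card := by
  classical
  rcases obj with _ | α
  · obtain ⟨z, hz⟩ := h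
    simp only [directions, hz]
    refine Finset.card_image_le.trans ((Finset.card_filter_le _ _).trans ?_)
    simp
  · exact le_rfl

/-- The rewards for which the variance estimates are not too small, but round `j + 1` misjudges a
direction that it is designed for. -/
def roundFailure (I : Input d) (R : Choices I.X) (S : Matrix (Fin d) (Fin d) ℝ) (θ : Vec d)
    (j : ℕ) : Set (Rewards I.X) :=
  {y | (∀ x : I.X, armVar S x ≤ 3 / 2 * varEst I R y x) ∧ ∃ v ∈ directions I.obj I.Z θ,
    v ∈ roundSet I.obj (state I R y j).active ∧
      eps (j + 1) < |v ⬝ᵥ roundTheta I R y (j + 1) (state I R y j) - v ⬝ᵥ θ|}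

theorem Input.Regular.measurableSet_state (h : I.Regular) (hmeas : Measurable (varEst I R))
    (hR : R.Valid) (hZ : I.Z.Nonempty) (j : ℕ) (Q : State d → Rewards I.X → Prop)
    (hQ : ∀ st, MeasurableSet {y | Q st y}) : MeasurableSet {y | Q (state I R y j) y} := by
  obtain ⟨φ, hφ⟩ := h.exists_simpleFunc_state hmeas hR hZ j
  simp_rw [← hφ]
  exact SimpleFunc.measurableSet_cut (fun y st => Q st y) φ hQ

theorem Input.Regular.measurableSet_roundFailure (h : I.Regular) (hmeas : Measurable (varEst I R))
    (hR : R.Valid) (hZ : I.Z.Nonempty) (j : ℕ) : MeasurableSet (roundFailure I R S θ j) := by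
  have hacc : MeasurableSet {y : Rewards I.X | ∀ x : I.X, armVar S x ≤ 3 / 2 * varEst I R y x} := by
    have : {y : Rewards I.X | ∀ x : I.X, armVar S x ≤ 3 / 2 * varEst I R y x} =
        ⋂ x : I.X, {y | armVar S x ≤ 3 / 2 * varEst I R y x} := by
      ext y; simp
    rw [this]
    exact MeasurableSet.iInter fun x => measurableSet_le measurable_const
      (((measurable_pi_apply x).comp hmeas).const_mul _)
  refine hacc.inter (h.measurableSet_state hmeas hR hZ j (fun st y => ∃ v ∈ directions I.obj I.Z θ,
    v ∈ roundSet I.obj st.active ∧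
      eps (j + 1) < |v ⬝ᵥ roundTheta I R y (j + 1) st - v ⬝ᵥ θ|) fun st => ?_)
  have : {y | ∃ v ∈ directions I.obj I.Z θ, v ∈ roundSet I.obj st.active ∧
        eps (j + 1) < |v ⬝ᵥ roundTheta I R y (j + 1) st - v ⬝ᵥ θ|} =
      ⋃ v ∈ directions I.obj I.Z θ, {y | v ∈ roundSet I.obj st.active ∧
        eps (j + 1) < |v ⬝ᵥ roundTheta I R y (j + 1) st - v ⬝ᵥ θ|} := by
    ext y; simp only [Set.mem_iUnion, Set.mem_ofPred_eq, exists_prop]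
  rw [this]
  refine Finset.measurableSet_biUnion _ fun v _ => ?_
  by_cases hv : v ∈ roundSet I.obj st.active
  · simp only [hv, true_and]
    have hm := h.measurable_dotProduct_roundTheta hmeas hR (Nat.succ_ne_zero j) hZ st hv
    exact measurableSet_lt measurable_const (hm.sub_const (v ⬝ᵥ θ)).abs
  · simp [hv]

theorem mem_roundFailure_congr (j : ℕ) {y y' : Rewards I.X} (h : ∀ k ≤ j + 2, y k = y' k) :
    y ∈ roundFailure I R S θ j ↔ y' ∈ roundFailure I R S θ j := by
  have hv : varEst I R y = varEst I R y' := varEst_congr (h 0 (by omega)) (h 1 (by omega))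
  have hs : state I R y j = state I R y' j := state_congr fun k hk => h k (by omega)
  simp only [roundFailure, Set.mem_ofPred_eq, hv, hs, roundTheta_congr hv _ (h (j + 2) le_rfl)]

variable {Ω : Type*} [MeasurableSpace Ω] {P : Measure Ω} [IsProbabilityMeasure P]
  {η : ℕ → I.X → ℕ → Ω → ℝ}

theorem Input.Regular.measure_roundFailure_le (h : I.Regular) (hmeas : Measurable (varEst I R))
    (hR : R.Valid) (hZ : I.Z.Nonempty) (hS : ∀ x : I.X, 0 ≤ armVar S x) (hη : IsNoise P S η)
    (hwp : WellPosed I.obj I.Z θ) (j : ℕ) :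
    P {ω | rewards θ η ω ∈ roundFailure I R S θ j} ≤
      ENNReal.ofReal (I.δ / 4 * (1 / ((j + 1 : ℕ) : ℝ) ^ 2)) := by
  refine hη.measure_rewards_mem_le θ (j + 2) (h.measurableSet_roundFailure hmeas hR hZ j)
    (fun y y' hyy => mem_roundFailure_congr j hyy) fun u => ?_
  set Y : Ω → Rewards I.X := fun ω => Function.update u (j + 2) (rewards θ η ω (j + 2)) with hY
  have hYu : ∀ ω, ∀ k ≤ j + 1, Y ω k = u k := fun ω k hk => by
    rw [hY]
    exact Function.update_of_ne (by omega) _ _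
  have hYk : ∀ ω, Y ω (j + 2) = rewards θ η ω (j + 2) := fun ω => by
    rw [hY]
    exact Function.update_self _ _ _
  have hv : ∀ ω, varEst I R (Y ω) = varEst I R u := fun ω =>
    varEst_congr (hYu ω 0 (by omega)) (hYu ω 1 (by omega))
  have hs : ∀ ω, state I R (Y ω) j = state I R u j := fun ω => state_congr (hYu ω)
  have hδ := h.δ_pos
  have hc : (0 : ℝ) < I.Z.card := by exact_mod_cast hZ.card_pos
  set st := state I R u j
  -- Accuracy of the variances is decided by phases 0 and 1, which are frozen in `u`; if it fails,
  -- the event is empty by definition.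
  by_cases hacc : ∀ x : I.X, armVar S x ≤ 3 / 2 * varEst I R u x
  swap
  · have : {ω | Y ω ∈ roundFailure I R S θ j} = ∅ := by
      ext ω
      simp only [roundFailure, Set.mem_ofPred_eq, hv, hacc, false_and, Set.mem_empty_iff_false]
    rw [this, measure_empty]
    exact zero_le
  have hlog : 0 < Real.log (8 * ((j + 1 : ℕ) : ℝ) ^ 2 * I.Z.card / I.δ) := by
    refine Real.log_pos ?_
    rw [lt_div_iff₀ h.δ_pos]
    have h1 : (1 : ℝ) ≤ (j + 1 : ℕ) := by exact_mod_cast Nat.succ_pos j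
    have h2 : (1 : ℝ) ≤ I.Z.card := by exact_mod_cast hZ.card_pos
    have h3 : (1 : ℝ) ≤ ((j + 1 : ℕ) : ℝ) ^ 2 * I.Z.card := by nlinarith
    linarith [h.δ_lt_one]
  have heps : 0 < eps (j + 1) := by unfold eps; positivity
  have hdir : ∀ v ∈ directions I.obj I.Z θ, P {ω | v ∈ roundSet I.obj st.active ∧
      eps (j + 1) < |v ⬝ᵥ roundTheta I R (Y ω) (j + 1) st - v ⬝ᵥ θ|} ≤
      ENNReal.ofReal (I.δ / 4 * (1 / ((j + 1 : ℕ) : ℝ) ^ 2) / I.Z.card) := by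
    intro v _
    by_cases hvA : v ∈ roundSet I.obj st.active
    swap
    · simp [hvA]
    simp only [hvA, true_and]
    have htail := hη.measure_lt_abs_wls_le hS θ (j + 2) (fun x => roundPulls I R u (j + 1) st x)
      (r := fun x => (varEst I R u x)⁻¹) (fun x => inv_pos.2 (h.varEst_pos u x)) (v := v)
      (ρ := 3 / 2) (fun x => by
        rw [inv_mul_le_iff₀ (h.varEst_pos u x), mul_comm]
        exact hacc x) (by norm_num) (by positivity) heps.le
      (h.quadBound_round hR u (Nat.succ_ne_zero j) hZ st hvA)
    have e : ∀ ω, roundTheta I R (Y ω) (j + 1) st =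
        solve (infoMatrix (fun x : I.X => (x : Vec d))
          fun x => (roundPulls I R u (j + 1) st x : ℝ) * (varEst I R u x)⁻¹)
        (∑ x : I.X, ∑ i ∈ Finset.range (roundPulls I R u (j + 1) st x),
          ((varEst I R u x)⁻¹ * rewards θ η ω (j + 2) x i) • (x : Vec d)) := by
      intro ω
      rw [roundTheta_eq, roundPulls_congr (hv ω), hv, hYk]
    simp_rw [e]
    refine htail.trans (ENNReal.ofReal_le_ofReal (le_of_eq ?_))
    -- The factor 3 in τ_ℓ compensates 2 · (3/2), so the exponent is exactly the logarithm; the tail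
    -- is 2 · δ/(8ℓ²|Z|) with ℓ = j + 1.
    have e2 : -eps (j + 1) ^ 2 / (2 * (3 / 2 * (eps (j + 1) ^ 2 /
        (3 * Real.log (8 * ((j + 1 : ℕ) : ℝ) ^ 2 * I.Z.card / I.δ))))) =
        -Real.log (8 * ((j + 1 : ℕ) : ℝ) ^ 2 * I.Z.card / I.δ) := by
      field_simp
    have hj : (0 : ℝ) < (j + 1 : ℕ) := by exact_mod_cast Nat.succ_pos j
    rw [e2, Real.exp_neg, Real.exp_log (by positivity)]
    field_simp
    norm_num
  have hsub : {ω | Y ω ∈ roundFailure I R S θ j} ⊆ ⋃ v ∈ directions I.obj I.Z θ,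
      {ω | v ∈ roundSet I.obj st.active ∧
        eps (j + 1) < |v ⬝ᵥ roundTheta I R (Y ω) (j + 1) st - v ⬝ᵥ θ|} := by
    intro ω hω
    simp only [roundFailure, Set.mem_ofPred_eq, hs] at hω
    obtain ⟨_, v, hv1, hv2⟩ := hω
    simp only [Set.mem_iUnion, Set.mem_ofPred_eq]
    exact ⟨v, hv1, hv2⟩
  refine (measure_mono hsub).trans ((measure_biUnion_finset_le _ _).trans
    ((Finset.sum_le_sum hdir).trans ?_))
  rw [Finset.sum_const, nsmul_eq_mul, ← ENNReal.ofReal_natCast, ← ENNReal.ofReal_mul (by positivity)]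
  refine ENNReal.ofReal_le_ofReal ?_
  have hcard : ((directions I.obj I.Z θ).card : ℝ) ≤ I.Z.card := by
    exact_mod_cast card_directions_le hwp
  rw [← mul_div_assoc, div_le_iff₀ hc, mul_comm]
  exact mul_le_mul_of_nonneg_left hcard (by positivity)

theorem tsum_one_div_succ_sq_le : ∑' j : ℕ, 1 / ((j + 1 : ℕ) : ℝ) ^ 2 ≤ 2 := by
  have h := (hasSum_nat_add_iff' 1).2 hasSum_zeta_two
  rw [h.tsum_eq]
  have := Real.pi_lt_d2
  have := Real.pi_pos
  simp
  nlinarith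

theorem Input.Regular.measure_iUnion_roundFailure_le (h : I.Regular)
    (hmeas : Measurable (varEst I R)) (hR : R.Valid) (hZ : I.Z.Nonempty)
    (hS : ∀ x : I.X, 0 ≤ armVar S x) (hη : IsNoise P S η) (hwp : WellPosed I.obj I.Z θ) :
    P {ω | ∃ j, rewards θ η ω ∈ roundFailure I R S θ j} ≤ ENNReal.ofReal (I.δ / 2) := by
  have hδ := h.δ_pos
  have : {ω | ∃ j, rewards θ η ω ∈ roundFailure I R S θ j} =
      ⋃ j, {ω | rewards θ η ω ∈ roundFailure I R S θ j} := by
    ext ω; simp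
  have hsum : Summable fun j : ℕ => 1 / ((j + 1 : ℕ) : ℝ) ^ 2 :=
    ((hasSum_nat_add_iff' 1).2 hasSum_zeta_two).summable
  rw [this]
  refine (measure_iUnion_le _).trans ((ENNReal.tsum_le_tsum fun j =>
    h.measure_roundFailure_le hmeas hR hZ hS hη hwp j).trans ?_)
  rw [← ENNReal.ofReal_tsum_of_nonneg (fun j => by positivity) (hsum.mul_left _), tsum_mul_left]
  refine ENNReal.ofReal_le_ofReal ?_
  nlinarith [tsum_one_div_succ_sq_le]

end Rounds

/-! ### The variance estimates -/

section BurnIn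

variable {d : ℕ} {I : Input d} {R : Choices I.X}

theorem stageOneTheta_eq (y : Rewards I.X) :
    stageOneTheta I R y = solve (infoMatrix (fun x : I.X => (x : Vec d))
      fun x => (stageOnePulls I R x : ℝ) * 1)
    (∑ x : I.X, ∑ i ∈ Finset.range (stageOnePulls I R x), ((1 : ℝ) * y 0 x i) • (x : Vec d)) := by
  simp only [stageOneTheta, mul_one, one_mul]

theorem stageTwoFit_eq (y : Rewards I.X) :
    stageTwoFit I R y = solve (infoMatrix (fun x : I.X => phi (x : Vec d))
      fun x => (R.alloc I.half x : ℝ) * 1)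
    (∑ x : I.X, ∑ i ∈ Finset.range (R.alloc I.half x),
      ((1 : ℝ) * (y 1 x i - (x : Vec d) ⬝ᵥ stageOneTheta I R y) ^ 2) • phi (x : Vec d)) := by
  simp only [stageTwoFit, mul_one, one_mul]

theorem Input.Regular.quadBound_stageOne (h : I.Regular) (hR : R.Valid) (hN : 0 < I.half)
    (x : I.X) : QuadBound (fun x : I.X => (x : Vec d)) (fun x => (stageOnePulls I R x : ℝ) * 1)
      (x : Vec d) (2 * d / I.half) := by
  have hN' : (0 : ℝ) < I.half := by exact_mod_cast hN
  have hopt := hR.opt (fun _ => 1) (fun _ => one_pos) I.X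
  refine (hopt.quadBound h.nonempty h.span (fun _ => one_pos) x.2).of_le fun x => ?_
  have h1 := toReal_optValue_one_le h.dim_pos h.nonempty
  have h2 : R.design (fun _ => 1) I.X x * I.half ≤ stageOnePulls I R x := Nat.le_ceil _
  have h3 : 0 ≤ R.design (fun _ => 1) I.X x := hopt.1.1 x
  rw [div_one, mul_one, div_mul_eq_mul_div, le_div_iff₀ hN', mul_assoc]
  exact mul_le_mul h1 h2 (by positivity) (by positivity)

theorem Input.Regular.measurable_stageOne (h : I.Regular) (hR : R.Valid) (hN : 0 < I.half)
    (x : I.X) : Measurable fun y => (x : Vec d) ⬝ᵥ stageOneTheta I R y := by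
  obtain ⟨w, hw⟩ := (h.quadBound_stageOne hR hN x).exists_mulVec_eq
  simp_rw [stageOneTheta_eq, fun y : Rewards I.X => dotProduct_wls (fun _ => one_pos) (y 0) hw]
  fun_prop

/-- Both burn-in designs are deterministic and N ≥ d(d+1) puts every φ_x in the range of the second,
so the fit is a fixed linear combination of squared residuals. -/
theorem Input.Regular.measurable_varEst (h : I.Regular) (hR : R.Valid)
    (hN : d * (d + 1) ≤ I.half) : Measurable (varEst I R) := by
  have hd := h.dim_pos
  have hN0 : 0 < I.half := lt_of_lt_of_le (by positivity) hN
  refine measurable_pi_lambda _ fun x => ?_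
  unfold varEst
  refine Measurable.min (Measurable.max ?_ measurable_const) measurable_const
  have hq : QuadBound (fun x : I.X => phi (x : Vec d)) (fun x => (R.alloc I.half x : ℝ) * 1)
      (phi (x : Vec d)) (6 * d ^ 2 / I.half) := by
    simpa only [mul_one] using hR.quadBound_phi h.dim_pos h.nonempty hN x
  obtain ⟨w, hw⟩ := hq.exists_mulVec_eq
  simp_rw [stageTwoFit_eq, fun y : Rewards I.X => dotProduct_wls (fun _ => one_pos)
    (fun x i => (y 1 x i - (x : Vec d) ⬝ᵥ stageOneTheta I R y) ^ 2) hw]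
  refine Finset.measurable_fun_sum _ fun x' _ => Finset.measurable_fun_sum _ fun i _ => ?_
  have := h.measurable_stageOne hR hN0 x'
  fun_prop

theorem varEst_of_eq (h : I.Regular) (heq : I.vmin = I.vmax) (y : Rewards I.X) (x : I.X) :
    varEst I R y x = I.vmin :=
  le_antisymm ((h.varEst_mem y x).2.trans heq.ge) (h.varEst_mem y x).1

/-- The number of burn-in pulls is large. -/
structure Input.LargeBudget (I : Input d) : Prop where
  two_le : 2 * I.δ ≤ I.X.card
  le_c : 3000000 ≤ I.c

theorem Input.LargeBudget.log_pos (hb : I.LargeBudget) (h : I.Regular) :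
    0.69 ≤ Real.log (I.X.card / I.δ) := by
  have h2 : (2 : ℝ) ≤ I.X.card / I.δ := by
    rw [le_div_iff₀ h.δ_pos]
    exact hb.two_le
  have := Real.log_le_log (by norm_num) h2
  have := Real.log_two_gt_d9
  linarith

theorem Input.Regular.one_le_kappa (h : I.Regular) : 1 ≤ I.kappa :=
  (one_le_div h.vmin_pos).2 h.vmin_le_vmax

theorem Input.Regular.kappa_mul (h : I.Regular) : I.kappa * I.vmin = I.vmax :=
  div_mul_cancel₀ _ h.vmin_pos.ne'

theorem Input.LargeBudget.le_half (hb : I.LargeBudget) (h : I.Regular) :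
    3000000 * (I.kappa ^ 2 * d ^ 2 * Real.log (I.X.card / I.δ)) ≤ I.half := by
  refine le_trans ?_ (Nat.le_ceil _)
  have := hb.log_pos h
  have h0 : 0 ≤ I.kappa ^ 2 * d ^ 2 * Real.log (I.X.card / I.δ) := by
    have : 0 ≤ Real.log (I.X.card / I.δ) := by linarith
    positivity
  have := mul_le_mul_of_nonneg_right hb.le_c h0
  linarith

theorem Input.LargeBudget.dim_le_half (hb : I.LargeBudget) (h : I.Regular) :
    d * (d + 1) ≤ I.half := by
  have h1 := hb.le_half h
  have h2 := hb.log_pos h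
  have h3 := h.one_le_kappa
  have hd : (1 : ℝ) ≤ d := by exact_mod_cast h.dim_pos
  have h4 : (1 : ℝ) ≤ I.kappa ^ 2 := one_le_pow₀ h3
  have h5 : (d : ℝ) ^ 2 ≤ I.kappa ^ 2 * d ^ 2 := le_mul_of_one_le_left (sq_nonneg _) h4
  have h6 : 0.69 * (d : ℝ) ^ 2 ≤ I.kappa ^ 2 * d ^ 2 * Real.log (I.X.card / I.δ) := by
    rw [mul_comm]
    exact mul_le_mul h5 h2 (by norm_num) (by positivity)
  have : (d : ℝ) * (d + 1) ≤ I.half := by nlinarith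
  exact_mod_cast this

variable {S : Matrix (Fin d) (Fin d) ℝ} {θ : Vec d} {Ω : Type*} [MeasurableSpace Ω]
  {P : Measure Ω} {η : ℕ → I.X → ℕ → Ω → ℝ}

/-- The event that the first stage misestimates the mean of some arm. -/
def stageOneFailure (I : Input d) (R : Choices I.X) (θ : Vec d) : Set (Rewards I.X) :=
  {y | ∃ x : I.X, √(I.vmin / (27 * d)) < |(x : Vec d) ⬝ᵥ stageOneTheta I R y - (x : Vec d) ⬝ᵥ θ|}

/-- With u = |X|/δ ≥ 2 the union bound is |X| · 2u⁻⁶ = 2δ/u⁵ ≤ δ/16. The lower bound on u is what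
`LargeBudget.two_le` provides. -/
theorem measure_exists_arm_le (hb : I.LargeBudget) (h : I.Regular) {p : I.X → Ω → Prop}
    (hp : ∀ x, P {ω | p x ω} ≤
      ENNReal.ofReal (2 * Real.exp (-(6 * Real.log (I.X.card / I.δ))))) :
    P {ω | ∃ x, p x ω} ≤ ENNReal.ofReal (I.δ / 6) := by
  have hδ := h.δ_pos
  have hc : (0 : ℝ) < I.X.card := by exact_mod_cast h.nonempty.card_pos
  have : {ω | ∃ x, p x ω} = ⋃ x, {ω | p x ω} := by
    ext ω; simp only [Set.mem_iUnion, Set.mem_ofPred_eq]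
  rw [this]
  refine (measure_iUnion_fintype_le _ _).trans ((Finset.sum_le_sum fun x _ => hp x).trans ?_)
  rw [Finset.sum_const, Finset.card_univ, Fintype.card_coe, nsmul_eq_mul,
    ← ENNReal.ofReal_natCast, ← ENNReal.ofReal_mul (by positivity)]
  refine ENNReal.ofReal_le_ofReal ?_
  have h2 : (2 : ℝ) ≤ I.X.card / I.δ := by
    rw [le_div_iff₀ hδ]
    exact hb.two_le
  have hcard : (I.X.card : ℝ) = (I.X.card / I.δ) * I.δ := (div_mul_cancel₀ _ hδ.ne').symm
  have hexp : Real.exp (-(6 * Real.log (I.X.card / I.δ))) = ((I.X.card / I.δ) ^ 6)⁻¹ := by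
    rw [Real.exp_neg, ← Real.rpow_natCast, Real.rpow_def_of_pos (div_pos hc hδ)]
    congr 2
    push_cast
    ring
  rw [hexp]
  generalize (I.X.card : ℝ) / I.δ = u at *
  rw [hcard]
  have hu : (32 : ℝ) ≤ u ^ 5 := by
    calc (32 : ℝ) = 2 ^ 5 := by norm_num
      _ ≤ u ^ 5 := by gcongr
  have hu0 : 0 < u := by linarith
  have e : u * I.δ * (2 * (u ^ 6)⁻¹) = 2 * I.δ / u ^ 5 := by
    rw [pow_succ u 5]; field_simp
  rw [e, div_le_iff₀ (by positivity)]
  nlinarith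

theorem measure_stageOneFailure_le (hb : I.LargeBudget) (h : I.Regular) (hR : R.Valid)
    (hS : ∀ x : I.X, 0 < armVar S x ∧ armVar S x ≤ I.vmax) (hη : IsNoise P S η) :
    P {ω | rewards θ η ω ∈ stageOneFailure I R θ} ≤ ENNReal.ofReal (I.δ / 6) := by
  have hN := hb.dim_le_half h
  have hd := h.dim_pos
  have hN0 : 0 < I.half := lt_of_lt_of_le (by positivity) hN
  have hNr : (0 : ℝ) < I.half := by exact_mod_cast hN0
  have hdr : (0 : ℝ) < d := by exact_mod_cast hd
  have hvmax : 0 < I.vmax := h.vmin_pos.trans_le h.vmin_le_vmax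
  refine measure_exists_arm_le hb h fun x => ?_
  simp_rw [stageOneTheta_eq]
  refine (hη.measure_lt_abs_wls_le (fun x => (hS x).1.le) θ 0 (stageOnePulls I R)
    (fun _ => one_pos) (ρ := I.vmax) (K := 2 * d / I.half) (fun x => by
      rw [one_mul]; exact (hS x).2) hvmax.le (by positivity) (Real.sqrt_nonneg _)
      (h.quadBound_stageOne hR hN0 x)).trans (ENNReal.ofReal_le_ofReal ?_)
  gcongr
  rw [Real.sq_sqrt (by have := h.vmin_pos; positivity), neg_div, neg_le_neg_iff]
  have hvm := h.vmin_pos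
  -- The exponent is N/(108 κ d²); one power of κ would be enough for this stage.
  have e : I.vmin / (27 * d) / (2 * (I.vmax * (2 * d / I.half))) =
      I.half / (108 * (I.kappa * d ^ 2)) := by
    rw [← h.kappa_mul]
    field_simp
    norm_num
  have hκ := h.one_le_kappa
  rw [e, le_div_iff₀ (by positivity)]
  have h1 := hb.le_half h
  have h2 : I.kappa * d ^ 2 * Real.log (I.X.card / I.δ) ≤
      I.kappa ^ 2 * d ^ 2 * Real.log (I.X.card / I.δ) := by
    have := hb.log_pos h
    gcongr
    nlinarith
  have h3 : 0 ≤ I.kappa * d ^ 2 * Real.log (I.X.card / I.δ) := by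
    have : 0 ≤ Real.log (I.X.card / I.δ) := by linarith [hb.log_pos h]
    positivity
  nlinarith

/-- The event that the first stage succeeds, but the interaction of its error with the noise of the
second stage is large. -/
def crossFailure (I : Input d) (R : Choices I.X) (θ : Vec d) (a : I.X → ℝ) : Set (Rewards I.X) :=
  {y | y ∉ stageOneFailure I R θ ∧ I.vmin / 9 <
    |∑ x : I.X, ∑ i ∈ Finset.range (R.alloc I.half x), (2 * a x *
      ((x : Vec d) ⬝ᵥ stageOneTheta I R y - (x : Vec d) ⬝ᵥ θ)) * (y 1 x i - (x : Vec d) ⬝ᵥ θ)|}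

theorem measure_crossFailure_le [IsProbabilityMeasure P] (hb : I.LargeBudget) (h : I.Regular) (hR : R.Valid)
    (hS : ∀ x : I.X, 0 < armVar S x ∧ armVar S x ≤ I.vmax) (hη : IsNoise P S η) (a : I.X → ℝ)
    (ha : ∑ x, (R.alloc I.half x : ℝ) * a x ^ 2 ≤ 6 * d ^ 2 / I.half) :
    P {ω | rewards θ η ω ∈ crossFailure I R θ a} ≤
      ENNReal.ofReal (2 * Real.exp (-(6 * Real.log (I.X.card / I.δ)))) := by
  have hN := hb.dim_le_half h
  have hd := h.dim_pos
  have hN0 : 0 < I.half := lt_of_lt_of_le (by positivity) hN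
  have hNr : (0 : ℝ) < I.half := by exact_mod_cast hN0
  have hdr : (0 : ℝ) < d := by exact_mod_cast hd
  have hvm := h.vmin_pos
  have hvmax : 0 < I.vmax := h.vmin_pos.trans_le h.vmin_le_vmax
  have hm := fun x => h.measurable_stageOne hR hN0 x
  refine hη.measure_rewards_mem_le θ 1 ?_ ?_ ?_
  · have hf : MeasurableSet (stageOneFailure I R θ) := by
      have : stageOneFailure I R θ = ⋃ x : I.X, {y | √(I.vmin / (27 * d)) <
          |(x : Vec d) ⬝ᵥ stageOneTheta I R y - (x : Vec d) ⬝ᵥ θ|} := by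
        ext y; simp [stageOneFailure]
      rw [this]
      exact MeasurableSet.iUnion fun x => measurableSet_lt measurable_const
        ((hm x).sub_const _).abs
    suffices hsum : Measurable fun y : Rewards I.X =>
        ∑ x : I.X, ∑ i ∈ Finset.range (R.alloc I.half x), (2 * a x *
          ((x : Vec d) ⬝ᵥ stageOneTheta I R y - (x : Vec d) ⬝ᵥ θ)) *
            (y 1 x i - (x : Vec d) ⬝ᵥ θ) by
      have hset := measurableSet_lt (measurable_const (a := I.vmin / 9)) hsum.abs
      exact hf.compl.inter hset
    refine Finset.measurable_fun_sum _ fun x' _ => Finset.measurable_fun_sum _ fun i _ => ?_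
    have := hm x'
    fun_prop
  · intro y y' hyy
    simp only [crossFailure, stageOneFailure, Set.mem_ofPred_eq,
      stageOneTheta_congr (hyy 0 zero_le_one), hyy 1 le_rfl]
  · intro u
    have hu : ∀ ω, stageOneTheta I R (Function.update u 1 (rewards θ η ω 1)) =
        stageOneTheta I R u := fun ω =>
      stageOneTheta_congr (Function.update_of_ne zero_ne_one _ _)
    -- With phase 0 frozen the first-stage errors are constants; they are either small enough to
    -- bound the variance of the cross term, or the event is empty.
    by_cases hfail : u ∈ stageOneFailure I R θ
    · have : {ω | Function.update u 1 (rewards θ η ω 1) ∈ crossFailure I R θ a} = ∅ := by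
        ext ω
        simp only [Set.mem_ofPred_eq, Set.mem_empty_iff_false, iff_false]
        intro hω
        refine hω.1 ?_
        simp only [stageOneFailure, Set.mem_ofPred_eq, hu] at hfail ⊢
        exact hfail
      rw [this, measure_empty]
      exact zero_le
    have he : ∀ x : I.X, ((x : Vec d) ⬝ᵥ stageOneTheta I R u - (x : Vec d) ⬝ᵥ θ) ^ 2 ≤
        I.vmin / (27 * d) := by
      intro x
      simp only [stageOneFailure, Set.mem_ofPred_eq, not_exists, not_lt] at hfail
      rw [← sq_abs, ← Real.sq_sqrt (show 0 ≤ I.vmin / (27 * d) by positivity)]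
      gcongr
      exact hfail x
    set e : I.X → ℝ := fun x => (x : Vec d) ⬝ᵥ stageOneTheta I R u - (x : Vec d) ⬝ᵥ θ
    have hK : ∑ x, ∑ _i ∈ Finset.range (R.alloc I.half x), (2 * a x * e x) ^ 2 * armVar S x ≤
        4 * (I.vmin / (27 * d)) * I.vmax * (6 * d ^ 2 / I.half) := by
      refine le_trans ?_ (mul_le_mul_of_nonneg_left ha (by positivity))
      rw [Finset.mul_sum]
      refine Finset.sum_le_sum fun x _ => ?_
      rw [Finset.sum_const, Finset.card_range, nsmul_eq_mul]
      have h1 := mul_le_mul (he x) (hS x).2 (hS x).1.le (by positivity)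
      have h2 : 0 ≤ 4 * ((R.alloc I.half x : ℝ) * a x ^ 2) := by positivity
      have := mul_le_mul_of_nonneg_left h1 h2
      calc (R.alloc I.half x : ℝ) * ((2 * a x * e x) ^ 2 * armVar S x)
          = 4 * ((R.alloc I.half x : ℝ) * a x ^ 2) * (e x ^ 2 * armVar S x) := by ring
        _ ≤ 4 * ((R.alloc I.half x : ℝ) * a x ^ 2) * (I.vmin / (27 * d) * I.vmax) := this
        _ = _ := by ring
    have htail := hη.measure_lt_abs_sum_le (fun x => (hS x).1.le) 1 (R.alloc I.half)
      (fun x _ => 2 * a x * e x) (t := I.vmin / 9) (by positivity) hK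
    refine le_trans (measure_mono ?_) (htail.trans (ENNReal.ofReal_le_ofReal ?_))
    · intro ω hω
      have := hω.2
      simp only [hu, Function.update_self, rewards, add_sub_cancel_left] at this
      exact this
    · gcongr
      have e : (I.vmin / 9) ^ 2 / (2 * (4 * (I.vmin / (27 * d)) * I.vmax *
          (6 * d ^ 2 / I.half))) = I.half / (144 * (I.kappa * d)) := by
        rw [← h.kappa_mul]
        have hκ := h.one_le_kappa
        field_simp
        norm_num
      have hκ := h.one_le_kappa
      rw [neg_div, neg_le_neg_iff, e, le_div_iff₀ (by positivity)]
      have h1 := hb.le_half h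
      have hd1 : (1 : ℝ) ≤ d := by exact_mod_cast hd
      have h2 : I.kappa * d * Real.log (I.X.card / I.δ) ≤
          I.kappa ^ 2 * d ^ 2 * Real.log (I.X.card / I.δ) := by
        have := hb.log_pos h
        gcongr <;> nlinarith
      have h3 : 0 ≤ I.kappa * d * Real.log (I.X.card / I.δ) := by
        have : 0 ≤ Real.log (I.X.card / I.δ) := by linarith [hb.log_pos h]
        positivity
      nlinarith

theorem measure_sq_sub_le (hb : I.LargeBudget) (h : I.Regular)
    (hS : ∀ x : I.X, 0 < armVar S x ∧ armVar S x ≤ I.vmax) (hη : IsNoise P S η) (a : I.X → ℝ)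
    (ha : ∑ x, (R.alloc I.half x : ℝ) * a x ^ 2 ≤ 6 * d ^ 2 / I.half)
    (ha' : ∀ x, |a x| ≤ 6 * d ^ 2 / I.half) :
    P {ω | I.vmin / 9 < |∑ x, ∑ i ∈ Finset.range (R.alloc I.half x),
      a x * (η 1 x i ω ^ 2 - armVar S x)|} ≤
      ENNReal.ofReal (2 * Real.exp (-(6 * Real.log (I.X.card / I.δ)))) := by
  have hN := hb.dim_le_half h
  have hd := h.dim_pos
  have hN0 : 0 < I.half := lt_of_lt_of_le (by positivity) hN
  have hNr : (0 : ℝ) < I.half := by exact_mod_cast hN0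
  have hdr : (0 : ℝ) < d := by exact_mod_cast hd
  have hvm := h.vmin_pos
  have hκ := h.one_le_kappa
  have hκ0 : 0 < I.kappa := by linarith
  have hvmax : 0 < I.vmax := h.vmin_pos.trans_le h.vmin_le_vmax
  refine (hη.measure_lt_abs_sum_sq_sub_le (fun x => (hS x).1) 1 (R.alloc I.half) a
    -- The Chernoff parameter minimizing -st + 256 s² H, that is s = t/(512 H), with t = σ_min²/9.
    (s := I.half / (27648 * I.kappa * d ^ 2 * I.vmax)) (H := I.vmax ^ 2 * (6 * d ^ 2 / I.half))
    (by positivity) (fun x _ => ?_) ?_).trans (ENNReal.ofReal_le_ofReal ?_)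
  · have h1 := mul_le_mul (ha' x) (hS x).2 (hS x).1.le (by positivity)
    refine (mul_le_mul_of_nonneg_left h1 (by positivity)).trans ?_
    have e : I.half / (27648 * I.kappa * d ^ 2 * I.vmax) * (6 * d ^ 2 / I.half * I.vmax) =
        1 / (4608 * I.kappa) := by
      field_simp
      norm_num
    rw [e]
    exact one_div_le_one_div_of_le (by norm_num) (by linarith)
  · refine le_trans ?_ (mul_le_mul_of_nonneg_left ha (by positivity))
    rw [Finset.mul_sum]
    refine Finset.sum_le_sum fun x _ => ?_
    rw [Finset.sum_const, Finset.card_range, nsmul_eq_mul]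
    have h1 : armVar S x ^ 2 ≤ I.vmax ^ 2 := pow_le_pow_left₀ (hS x).1.le (hS x).2 2
    have h2 : 0 ≤ (R.alloc I.half x : ℝ) * a x ^ 2 := by positivity
    have := mul_le_mul_of_nonneg_left h1 h2
    nlinarith
  · gcongr
    -- The minimum is -t²/(1024 H) = -N/(497664 κ² d²). Having it at most -6 log(|X|/δ) requires 6 ·
    -- 497664 = 2985984 ≤ 3000000, the binding constraint on the burn-in constant; this is also
    -- where κ² is needed.
    have e : -(I.half / (27648 * I.kappa * d ^ 2 * I.vmax) * (I.vmin / 9)) +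
        256 * (I.half / (27648 * I.kappa * d ^ 2 * I.vmax)) ^ 2 *
          (I.vmax ^ 2 * (6 * d ^ 2 / I.half)) =
        -(I.half / (497664 * (I.kappa ^ 2 * d ^ 2))) := by
      rw [← h.kappa_mul]
      field_simp
      norm_num
    rw [e, neg_le_neg_iff, le_div_iff₀ (by positivity)]
    have h1 := hb.le_half h
    have h3 : 0 ≤ I.kappa ^ 2 * d ^ 2 * Real.log (I.X.card / I.δ) := by
      have : 0 ≤ Real.log (I.X.card / I.δ) := by linarith [hb.log_pos h]
      positivity
    nlinarith

/-- The error of the second stage in terms of the noise and the error of the first stage. -/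
theorem abs_varEst_sub_le (hb : I.LargeBudget) (h : I.Regular) (hR : R.Valid)
    (hsymm : ∀ i j, S i j = S j i)
    (hS : ∀ x : I.X, I.vmin ≤ armVar S x ∧ armVar S x ≤ I.vmax)
    {x : I.X} {w : HalfIdx d → ℝ}
    (hw : infoMatrix (fun x : I.X => phi (x : Vec d)) (fun x => (R.alloc I.half x : ℝ) * 1) *ᵥ w =
      phi (x : Vec d))
    (ha : ∑ x', (R.alloc I.half x' : ℝ) * (phi (x' : Vec d) ⬝ᵥ w) ^ 2 ≤ 6 * d ^ 2 / I.half)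
    {y : Rewards I.X} (h1 : y ∉ stageOneFailure I R θ)
    (h2 : y ∉ crossFailure I R θ fun x' => phi (x' : Vec d) ⬝ᵥ w)
    (h3 : |∑ x' : I.X, ∑ i ∈ Finset.range (R.alloc I.half x'), (phi (x' : Vec d) ⬝ᵥ w) *
      ((y 1 x' i - (x' : Vec d) ⬝ᵥ θ) ^ 2 - armVar S x')| ≤ I.vmin / 9) :
    |varEst I R y x - armVar S x| ≤ I.vmin / 3 := by
  have hN := hb.dim_le_half h
  have hd := h.dim_pos
  have hN0 : 0 < I.half := lt_of_lt_of_le (by positivity) hN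
  have hNr : (0 : ℝ) < I.half := by exact_mod_cast hN0
  have hdr : (0 : ℝ) < d := by exact_mod_cast hd
  have hvm := h.vmin_pos
  set a : I.X → ℝ := fun x' => phi (x' : Vec d) ⬝ᵥ w with ha_def
  set e : I.X → ℝ := fun x' => (x' : Vec d) ⬝ᵥ stageOneTheta I R y - (x' : Vec d) ⬝ᵥ θ with he_def
  have h2' : |∑ x' : I.X, ∑ i ∈ Finset.range (R.alloc I.half x'),
      (2 * a x' * e x') * (y 1 x' i - (x' : Vec d) ⬝ᵥ θ)| ≤ I.vmin / 9 := by
    by_contra! hlt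
    exact h2 ⟨h1, hlt⟩
  have he : ∀ x' : I.X, e x' ^ 2 ≤ I.vmin / (27 * d) := by
    intro x'
    simp only [stageOneFailure, Set.mem_ofPred_eq, not_exists, not_lt] at h1
    rw [← sq_abs, ← Real.sq_sqrt (show 0 ≤ I.vmin / (27 * d) by positivity)]
    gcongr
    exact h1 x'
  -- Cauchy-Schwarz gives ∑ n|a| ≤ √(6d²/N · N) ≤ 3d. The first-stage threshold σ_min²/(27d) is
  -- chosen so that the product is σ_min²/9.
  have hbias : |∑ x' : I.X, ∑ _i ∈ Finset.range (R.alloc I.half x'), a x' * e x' ^ 2| ≤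
      I.vmin / 9 := by
    have hcs : (∑ x' : I.X, (R.alloc I.half x' : ℝ) * |a x'|) ^ 2 ≤ (3 * d) ^ 2 := by
      have := sum_mul_mul_sq_le (fun x' : I.X => Nat.cast_nonneg (R.alloc I.half x'))
        (fun x' => |a x'|) fun _ => (1 : ℝ)
      simp only [mul_one, one_pow, sq_abs] at this
      refine this.trans ?_
      have hsum : ∑ x' : I.X, (R.alloc I.half x' : ℝ) ≤ I.half := by
        exact_mod_cast hR.alloc_le I.half
      refine (mul_le_mul ha hsum (Finset.sum_nonneg fun _ _ => Nat.cast_nonneg _)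
        (by positivity)).trans ?_
      rw [div_mul_cancel₀ _ hNr.ne']
      nlinarith
    have hcs' := abs_le_of_sq_le_sq hcs (by positivity)
    refine (Finset.abs_sum_le_sum_abs _ _).trans ?_
    calc ∑ x' : I.X, |∑ _i ∈ Finset.range (R.alloc I.half x'), a x' * e x' ^ 2|
        ≤ ∑ x' : I.X, (R.alloc I.half x' : ℝ) * |a x'| * (I.vmin / (27 * d)) := by
          refine Finset.sum_le_sum fun x' _ => ?_
          rw [Finset.sum_const, Finset.card_range, nsmul_eq_mul, abs_mul, abs_mul, Nat.abs_cast,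
            abs_of_nonneg (sq_nonneg (e x')), ← mul_assoc]
          exact mul_le_mul_of_nonneg_left (he x') (by positivity)
      _ = (∑ x' : I.X, (R.alloc I.half x' : ℝ) * |a x'|) * (I.vmin / (27 * d)) := by
          rw [Finset.sum_mul]
      _ ≤ 3 * d * (I.vmin / (27 * d)) :=
          mul_le_mul_of_nonneg_right ((le_abs_self _).trans hcs') (by positivity)
      _ = I.vmin / 9 := by field_simp; norm_num
  -- Expansion of (η - e)² - σ² under the least squares weights a.
  have hdec : phi (x : Vec d) ⬝ᵥ stageTwoFit I R y - armVar S x =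
      (∑ x' : I.X, ∑ i ∈ Finset.range (R.alloc I.half x'), a x' *
        ((y 1 x' i - (x' : Vec d) ⬝ᵥ θ) ^ 2 - armVar S x')) -
      (∑ x' : I.X, ∑ i ∈ Finset.range (R.alloc I.half x'),
        (2 * a x' * e x') * (y 1 x' i - (x' : Vec d) ⬝ᵥ θ)) +
      ∑ x' : I.X, ∑ _i ∈ Finset.range (R.alloc I.half x'), a x' * e x' ^ 2 := by
    have := dotProduct_wls_sub (fun _ => one_pos)
      (fun (x : I.X) i => (y 1 x i - (x : Vec d) ⬝ᵥ stageOneTheta I R y) ^ 2)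
      (fun p : HalfIdx d => S p.1.1 p.1.2) hw
    rw [← stageTwoFit_eq, phi_dotProduct hsymm] at this
    rw [this, ← Finset.sum_sub_distrib, ← Finset.sum_add_distrib]
    refine Finset.sum_congr rfl fun x' _ => ?_
    rw [← Finset.sum_sub_distrib, ← Finset.sum_add_distrib]
    refine Finset.sum_congr rfl fun i _ => ?_
    rw [phi_dotProduct hsymm]
    simp only [ha_def, he_def]
    ring
  have hfit : |phi (x : Vec d) ⬝ᵥ stageTwoFit I R y - armVar S x| ≤ I.vmin / 3 := by
    rw [hdec]
    refine (abs_add_le _ _).trans ?_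
    refine (add_le_add_left (abs_sub _ _) _).trans ?_
    linarith
  -- Truncation to an interval containing the true variance does not increase the error.
  rw [abs_le] at hfit ⊢
  unfold varEst
  have hx := hS x
  constructor
  · have : armVar S x - I.vmin / 3 ≤ min (max (phi (x : Vec d) ⬝ᵥ stageTwoFit I R y) I.vmin)
        I.vmax := le_min ((by linarith : _ ≤ _).trans (le_max_left _ _)) (by linarith)
    linarith
  · have : min (max (phi (x : Vec d) ⬝ᵥ stageTwoFit I R y) I.vmin) I.vmax ≤
        armVar S x + I.vmin / 3 := (min_le_left _ _).trans (max_le (by linarith) (by linarith))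
    linarith

theorem Input.Regular.measure_varEst_le [IsProbabilityMeasure P] (h : I.Regular) (hR : R.Valid) (hc : 3000000 ≤ I.c)
    (hcase : 2 * I.δ ≤ I.X.card ∨ I.vmin = I.vmax) (hsymm : ∀ i j, S i j = S j i)
    (hS : ∀ x : I.X, I.vmin ≤ armVar S x ∧ armVar S x ≤ I.vmax) (hη : IsNoise P S η) :
    Measurable (varEst I R) ∧ P {ω | ¬ ∀ x : I.X,
      |varEst I R (rewards θ η ω) x - armVar S x| ≤ I.vmin / 3} ≤ ENNReal.ofReal (I.δ / 2) := by
  have hvm := h.vmin_pos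
  -- If σ_min² = σ_max², truncation makes the estimate constant and exact. Measurability is proved
  -- along with the bound because in this case the burn-in may be too short for the lifted design to
  -- span.
  rcases hcase with hcase | heq
  swap
  · refine ⟨measurable_pi_lambda _ fun x => ?_, ?_⟩
    · simp_rw [fun y => varEst_of_eq (R := R) h heq y x]
      exact measurable_const
    · have : {ω | ¬ ∀ x : I.X, |varEst I R (rewards θ η ω) x - armVar S x| ≤ I.vmin / 3} = ∅ := by
        ext ω
        simp only [Set.mem_ofPred_eq, Set.mem_empty_iff_false, iff_false, not_not]
        intro x
        have := hS x
        rw [varEst_of_eq h heq, show armVar S x = I.vmin by linarith, sub_self, abs_zero]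
        positivity
      rw [this, measure_empty]
      exact zero_le
  have hb : I.LargeBudget := ⟨hcase, hc⟩
  have hN := hb.dim_le_half h
  refine ⟨h.measurable_varEst hR hN, ?_⟩
  have hd := h.dim_pos
  have hN0 : 0 < I.half := lt_of_lt_of_le (by positivity) hN
  have hNr : (0 : ℝ) < I.half := by exact_mod_cast hN0
  have hK0 : (0 : ℝ) ≤ 6 * d ^ 2 / I.half := by positivity
  have hS' : ∀ x : I.X, 0 < armVar S x ∧ armVar S x ≤ I.vmax := fun x =>
    ⟨hvm.trans_le (hS x).1, (hS x).2⟩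
  have hq : ∀ x : I.X, QuadBound (fun x : I.X => phi (x : Vec d))
      (fun x => (R.alloc I.half x : ℝ) * 1) (phi (x : Vec d)) (6 * d ^ 2 / I.half) := fun x => by
    simpa only [mul_one] using hR.quadBound_phi h.dim_pos h.nonempty hN x
  choose w hw using fun x => (hq x).exists_mulVec_eq
  have ha : ∀ x : I.X, ∑ x' : I.X, (R.alloc I.half x' : ℝ) * (phi (x' : Vec d) ⬝ᵥ w x) ^ 2 ≤
      6 * d ^ 2 / I.half := by
    intro x
    have h1 := (hq x).dotProduct_le hK0 (hw x)
    rw [← hw x, dotProduct_comm, dotProduct_infoMatrix_mulVec_self] at h1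
    simpa only [mul_one] using h1
  -- Cauchy-Schwarz in the design form: (φ_{x'}ᵀA⁻¹φ_x)² is at most the product of two dual norms,
  -- each at most 6d²/N.
  have ha' : ∀ x x' : I.X, |phi (x' : Vec d) ⬝ᵥ w x| ≤ 6 * d ^ 2 / I.half := by
    intro x x'
    refine abs_le_of_sq_le_sq' ?_ hK0 |> abs_le.2
    refine (hq x' (w x)).trans ?_
    simp only [mul_one]
    rw [sq (6 * (d : ℝ) ^ 2 / I.half)]
    exact mul_le_mul_of_nonneg_left (ha x) hK0
  have hsub : {ω | ¬ ∀ x : I.X, |varEst I R (rewards θ η ω) x - armVar S x| ≤ I.vmin / 3} ⊆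
      {ω | rewards θ η ω ∈ stageOneFailure I R θ} ∪
      ({ω | ∃ x : I.X, rewards θ η ω ∈ crossFailure I R θ fun x' => phi (x' : Vec d) ⬝ᵥ w x} ∪
      {ω | ∃ x : I.X, I.vmin / 9 < |∑ x' : I.X, ∑ i ∈ Finset.range (R.alloc I.half x'),
        (phi (x' : Vec d) ⬝ᵥ w x) * (η 1 x' i ω ^ 2 - armVar S x')|}) := by
    intro ω hω
    by_contra hno
    simp only [Set.mem_union, not_or, Set.mem_ofPred_eq, not_exists, not_lt] at hno
    refine hω fun x => abs_varEst_sub_le hb h hR hsymm hS (hw x) (ha x) hno.1 (hno.2.1 x) ?_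
    simpa only [rewards, add_sub_cancel_left] using hno.2.2 x
  have hδ := h.δ_pos
  refine (measure_mono hsub).trans ((measure_union_le _ _).trans ((add_le_add
    (measure_stageOneFailure_le hb h hR hS' hη) ((measure_union_le _ _).trans (add_le_add
      (measure_exists_arm_le hb h fun x => measure_crossFailure_le hb h hR hS' hη _ (ha x))
      (measure_exists_arm_le hb h fun x => measure_sq_sub_le hb h hS' hη _ (ha x) (ha' x))))).trans
    ?_))
  rw [← ENNReal.ofReal_add (by positivity) (by positivity),
    ← ENNReal.ofReal_add (by positivity) (by positivity)]
  exact ENNReal.ofReal_le_ofReal (by linarith)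

end BurnIn

/-! ### Runs without misjudgements -/

section Targets

variable {d : ℕ} {Z A : Finset (Vec d)} {θ z : Vec d}

theorem mem_target_bai {z' : Vec d} :
    z' ∈ target .bai Z θ ↔ z' ∈ Z ∧ ∀ u ∈ Z, u ⬝ᵥ θ ≤ z' ⬝ᵥ θ := by
  classical
  simp only [target, Finset.mem_filter]

theorem target_bai_mono (h : target .bai Z θ = {z}) (hA : A ⊆ Z) (hz : z ∈ A) :
    target .bai A θ = {z} := by
  have hzt : z ∈ target .bai Z θ := by rw [h]; exact Finset.mem_singleton_self z
  rw [mem_target_bai] at hzt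
  ext z'
  rw [mem_target_bai, Finset.mem_singleton]
  constructor
  · rintro ⟨h1, h2⟩
    have : z' ∈ target .bai Z θ :=
      mem_target_bai.2 ⟨hA h1, fun u hu => (hzt.2 u hu).trans (h2 z hz)⟩
    rwa [h, Finset.mem_singleton] at this
  · rintro rfl
    exact ⟨hz, fun u hu => hzt.2 u (hA hu)⟩

theorem mem_directions_bai (h : target .bai Z θ = {z}) {v : Vec d} :
    v ∈ directions .bai Z θ ↔ ∃ u ∈ Z, u ≠ z ∧ z - u = v := by
  classical
  simp only [directions, h, Finset.mem_image, Finset.mem_filter, Finset.mem_product,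
    Finset.mem_singleton, Prod.exists]
  constructor
  · rintro ⟨a, b, ⟨⟨rfl, hb⟩, hne⟩, hv⟩
    exact ⟨b, hb, hne, hv⟩
  · rintro ⟨u, hu, hne, hv⟩
    exact ⟨z, u, ⟨⟨rfl, hu⟩, hne⟩, hv⟩

theorem dotProduct_directions_ne {obj : Objective} (h : WellPosed obj Z θ) {v : Vec d}
    (hv : v ∈ directions obj Z θ) : v ⬝ᵥ θ - obj.offset ≠ 0 := by
  rcases obj with _ | α
  · obtain ⟨z, hz⟩ := h
    obtain ⟨u, hu, hne, rfl⟩ := (mem_directions_bai hz).1 hv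
    intro h0
    simp only [Objective.offset, sub_zero, sub_dotProduct] at h0
    have hzt : z ∈ target .bai Z θ := by rw [hz]; exact Finset.mem_singleton_self z
    rw [mem_target_bai] at hzt
    have : u ∈ target .bai Z θ :=
      mem_target_bai.2 ⟨hu, fun u' hu' => (hzt.2 u' hu').trans (by linarith)⟩
    rw [hz, Finset.mem_singleton] at this
    exact hne this
  · exact sub_ne_zero.2 (h v hv)

theorem gap_le {obj : Objective} {v : Vec d} (hv : v ∈ directions obj Z θ) :
    gap obj Z θ ≤ |v ⬝ᵥ θ - obj.offset| :=
  ciInf_le ⟨0, by rintro _ ⟨v, rfl⟩; exact abs_nonneg _⟩ (⟨v, hv⟩ : directions obj Z θ)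

theorem gap_pos {obj : Objective} (h : WellPosed obj Z θ) (hne : (directions obj Z θ).Nonempty) :
    0 < gap obj Z θ := by
  have : Nonempty (directions obj Z θ) := hne.to_subtype
  obtain ⟨v, hv⟩ := exists_eq_ciInf_of_finite
    (f := fun v : directions obj Z θ => |(v : Vec d) ⬝ᵥ θ - obj.offset|)
  rw [gap, ← hv]
  exact abs_pos.2 (dotProduct_directions_ne h v.2)

end Targets

theorem eps_pos (j : ℕ) : 0 < eps j := by unfold eps; positivity

theorem eps_succ (j : ℕ) : eps j = 2 * eps (j + 1) := by
  unfold eps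
  rw [pow_succ]
  field_simp

/-! ### Invariants of the item sets and termination -/

section Runs

variable {d : ℕ} {Z : Finset (Vec d)} {θ : Vec d} {obj : Objective}

/-- What is known about the state after `j` rounds without misjudgements. -/
structure SoundState (obj : Objective) (Z : Finset (Vec d)) (θ : Vec d) (j : ℕ) (st : State d) :
    Prop where
  directions_subset : directions obj st.active θ ⊆ directions obj Z θ
  le_eps : j ≠ 0 → ∀ v ∈ directions obj st.active θ, |v ⬝ᵥ θ - obj.offset| ≤ 2 * eps j
  output_eq : Done obj st → output obj st = target obj Z θ
  nonempty : ¬ Done obj st → (directions obj st.active θ).Nonempty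
  roundSet_eq : ∀ v ∈ roundSet obj st.active, ∃ u u' : Vec d,
    (u = 0 ∨ u ∈ directions obj st.active θ) ∧ (u' = 0 ∨ u' ∈ directions obj st.active θ) ∧
      v = u - u'

/-- The state after `j` rounds without misjudgements of best-arm identification. -/
structure SoundBai (Z : Finset (Vec d)) (θ z : Vec d) (j : ℕ) (st : State d) : Prop where
  subset : st.active ⊆ Z
  mem : z ∈ st.active
  le_eps : j ≠ 0 → ∀ u ∈ st.active, (z - u) ⬝ᵥ θ ≤ 2 * eps j

theorem SoundBai.soundState {z : Vec d} (hz : target .bai Z θ = {z}) {j : ℕ} {st : State d}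
    (h : SoundBai Z θ z j st) : SoundState .bai Z θ j st := by
  have hA := target_bai_mono hz h.subset h.mem
  have hzt : z ∈ target .bai Z θ := by rw [hz]; exact Finset.mem_singleton_self z
  rw [mem_target_bai] at hzt
  refine ⟨fun v hv => ?_, fun hj v hv => ?_, fun hdone => ?_, fun hnd => ?_, fun v hv => ?_⟩
  · obtain ⟨u, hu, hne, rfl⟩ := (mem_directions_bai hA).1 hv
    exact (mem_directions_bai hz).2 ⟨u, h.subset hu, hne, rfl⟩
  · obtain ⟨u, hu, hne, rfl⟩ := (mem_directions_bai hA).1 hv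
    have h0 := hzt.2 u (h.subset hu)
    rw [Objective.offset, sub_zero, abs_of_nonneg (by rw [sub_dotProduct]; linarith)]
    exact h.le_eps hj u hu
  · rw [hz]
    exact Finset.eq_singleton_iff_unique_mem.2 ⟨h.mem, fun u hu =>
      Finset.card_le_one.1 hdone u hu z h.mem⟩
  · simp only [Done, not_le] at hnd
    obtain ⟨u, hu, hne⟩ := Finset.exists_mem_ne hnd z
    exact ⟨z - u, (mem_directions_bai hA).2 ⟨u, hu, hne, rfl⟩⟩
  · obtain ⟨u, hu, u', hu', hne, rfl⟩ := roundSet_bai.1 hv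
    have key : ∀ u ∈ st.active, z - u = 0 ∨ z - u ∈ directions .bai st.active θ := by
      intro u hu
      by_cases huz : u = z
      · exact .inl (by rw [huz, sub_self])
      · exact .inr ((mem_directions_bai hA).2 ⟨u, hu, huz, rfl⟩)
    -- A difference of two active items is a difference of two directions from the best item; either
    -- may be zero.
    exact ⟨z - u, z - u', key u hu, key u' hu', by abel⟩

/-- The best item survives since no item can look better than it by more than ε. A surviving u has
estimated gap at most ε to the best item, hence true gap at most 2ε. -/
theorem SoundBai.update {z : Vec d} (hz : target .bai Z θ = {z}) {j : ℕ} {st : State d}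
    (h : SoundBai Z θ z j st) {θ' : Vec d}
    (hgood : ∀ v ∈ directions .bai Z θ, v ∈ roundSet .bai st.active →
      |v ⬝ᵥ θ' - v ⬝ᵥ θ| ≤ eps (j + 1)) :
    SoundBai Z θ z (j + 1) (HRage.update .bai θ' (eps (j + 1)) st) := by
  classical
  have hzt : z ∈ target .bai Z θ := by rw [hz]; exact Finset.mem_singleton_self z
  rw [mem_target_bai] at hzt
  have hmem : ∀ u, u ∈ (HRage.update .bai θ' (eps (j + 1)) st).active ↔
      u ∈ st.active ∧ ¬ ∃ u' ∈ st.active, eps (j + 1) < (u' - u) ⬝ᵥ θ' := fun u => by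
    simp only [HRage.update, Finset.mem_filter]
  have hest : ∀ u ∈ st.active, |(z - u) ⬝ᵥ θ' - (z - u) ⬝ᵥ θ| ≤ eps (j + 1) := by
    intro u hu
    by_cases huz : u = z
    · simp [huz, (eps_pos _).le]
    · exact hgood _ ((mem_directions_bai hz).2 ⟨u, h.subset hu, huz, rfl⟩)
        (roundSet_bai.2 ⟨u, hu, z, h.mem, huz, rfl⟩)
  refine ⟨fun u hu => h.subset ((hmem u).1 hu).1, (hmem z).2 ⟨h.mem, ?_⟩, fun _ u hu => ?_⟩
  · rintro ⟨u, hu, hlt⟩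
    have h1 := abs_le.1 (hest u hu)
    have h2 := hzt.2 u (h.subset hu)
    simp only [sub_dotProduct] at h1 hlt
    linarith
  · obtain ⟨hu1, hu2⟩ := (hmem u).1 hu
    push Not at hu2
    have h1 := abs_le.1 (hest u hu1)
    have h2 := hu2 z h.mem
    linarith

/-- The state after `j` rounds without misjudgements of level-set identification. -/
structure SoundLs (α : ℝ) (Z : Finset (Vec d)) (θ : Vec d) (j : ℕ) (st : State d) : Prop where
  subset : st.active ⊆ Z
  good : ∀ u, u ∈ st.good ↔ u ∈ Z ∧ u ∉ st.active ∧ α < u ⬝ᵥ θ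
  bad : ∀ u, u ∈ st.bad ↔ u ∈ Z ∧ u ∉ st.active ∧ u ⬝ᵥ θ < α
  le_eps : j ≠ 0 → ∀ u ∈ st.active, |u ⬝ᵥ θ - α| ≤ 2 * eps j

theorem SoundLs.soundState {α : ℝ} {j : ℕ} {st : State d} (h : SoundLs α Z θ j st) :
    SoundState (.ls α) Z θ j st := by
  classical
  refine ⟨h.subset, h.le_eps, fun hdone => ?_, fun hnd => ?_, fun v hv => ?_⟩
  · have h0 : st.active = ∅ := Finset.card_eq_zero.1 hdone
    ext u
    simp only [output, target, Finset.mem_filter, h.good, h0]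
    simp
  · exact Finset.card_ne_zero.1 hnd
  · exact ⟨v, 0, .inr hv, .inl rfl, (sub_zero v).symm⟩

/-- A classification beyond the margin ε is correct because the error is at most ε; an item left
undecided is estimated within ε of the threshold, so its mean is within 2ε. -/
theorem SoundLs.update {α : ℝ} {j : ℕ} {st : State d}
    (h : SoundLs α Z θ j st) {θ' : Vec d}
    (hgood : ∀ v ∈ st.active, |v ⬝ᵥ θ' - v ⬝ᵥ θ| ≤ eps (j + 1)) :
    SoundLs α Z θ (j + 1) (HRage.update (.ls α) θ' (eps (j + 1)) st) := by
  classical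
  set st' := HRage.update (.ls α) θ' (eps (j + 1)) st with hst'
  have hg : ∀ u, u ∈ st'.good ↔ u ∈ st.good ∨ (u ∈ st.active ∧ α < u ⬝ᵥ θ' - eps (j + 1)) :=
    fun u => by simp only [hst', HRage.update, Finset.mem_union, Finset.mem_filter]
  have hb : ∀ u, u ∈ st'.bad ↔ u ∈ st.bad ∨ (u ∈ st.active ∧ u ⬝ᵥ θ' + eps (j + 1) < α) :=
    fun u => by simp only [hst', HRage.update, Finset.mem_union, Finset.mem_filter]
  have ha : ∀ u, u ∈ st'.active ↔ u ∈ st.active ∧ ¬ α < u ⬝ᵥ θ' - eps (j + 1) ∧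
      ¬ u ⬝ᵥ θ' + eps (j + 1) < α := by
    intro u
    have : u ∈ st'.active ↔ u ∈ st.active ∧
        ¬ ((u ∈ st'.good ∧ u ∉ st.good) ∨ (u ∈ st'.bad ∧ u ∉ st.bad)) := by
      simp only [hst', HRage.update, Finset.mem_sdiff, Finset.mem_union]
    rw [this, hg, hb]
    by_cases hu : u ∈ st.active
    · have h1 : u ∉ st.good := fun hug => ((h.good u).1 hug).2.1 hu
      have h2 : u ∉ st.bad := fun hub => ((h.bad u).1 hub).2.1 hu
      simp only [hu, h1, h2, true_and, false_or, not_false_eq_true, and_true, not_or]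
    · simp only [hu, false_and]
  have habove : ∀ u ∈ st.active, α < u ⬝ᵥ θ' - eps (j + 1) → α < u ⬝ᵥ θ := fun u hu hlt => by
    have := abs_le.1 (hgood u hu)
    linarith
  have hbelow : ∀ u ∈ st.active, u ⬝ᵥ θ' + eps (j + 1) < α → u ⬝ᵥ θ < α := fun u hu hlt => by
    have := abs_le.1 (hgood u hu)
    linarith
  refine ⟨fun u hu => h.subset ((ha u).1 hu).1, fun u => ?_, fun u => ?_, fun _ u hu => ?_⟩
  · rw [hg, ha, h.good]
    by_cases hu : u ∈ st.active
    · have h1 := habove u hu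
      have h2 := hbelow u hu
      have h3 := h.subset hu
      have h4 : α < u ⬝ᵥ θ → ¬ u ⬝ᵥ θ' + eps (j + 1) < α := fun h h' => h.not_gt (h2 h')
      simp only [hu, h3, true_and, not_true_eq_false, false_and, false_or, not_and, not_not]
      exact ⟨fun hp => ⟨fun hn => absurd hp hn, h1 hp⟩, fun hp => by
        by_contra hn
        exact h4 hp.2 (hp.1 hn)⟩
    · simp only [hu, false_and, or_false, not_false_eq_true, true_and]
  · rw [hb, ha, h.bad]
    by_cases hu : u ∈ st.active
    · have h1 := habove u hu
      have h2 := hbelow u hu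
      have h3 := h.subset hu
      have h4 : u ⬝ᵥ θ < α → ¬ α < u ⬝ᵥ θ' - eps (j + 1) := fun h h' => h.not_gt (h1 h')
      simp only [hu, h3, true_and, not_true_eq_false, false_and, false_or, not_and, not_not]
      exact ⟨fun hq => ⟨fun _ => hq, h2 hq⟩, fun hq => hq.1 (h4 hq.2)⟩
    · simp only [hu, false_and, or_false, not_false_eq_true, true_and]
  · obtain ⟨hu1, hu2, hu3⟩ := (ha u).1 hu
    have := abs_le.1 (hgood u hu1)
    rw [abs_le]
    constructor <;> linarith

variable {I : Input d} {R : Choices I.X} {y : Rewards I.X}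

/-- No round misjudges a direction that it is designed for. -/
def SoundRun (I : Input d) (R : Choices I.X) (θ : Vec d) (y : Rewards I.X) : Prop :=
  ∀ j, ∀ v ∈ directions I.obj I.Z θ, v ∈ roundSet I.obj (state I R y j).active →
    |v ⬝ᵥ roundTheta I R y (j + 1) (state I R y j) - v ⬝ᵥ θ| ≤ eps (j + 1)

theorem SoundRun.soundState (h : SoundRun I R θ y) (hwp : WellPosed I.obj I.Z θ) (j : ℕ) :
    SoundState I.obj I.Z θ j (state I R y j) := by
  unfold SoundRun at h
  rcases hobj : I.obj with _ | α
  · rw [hobj] at h hwp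
    obtain ⟨z, hz⟩ := hwp
    have hzt : z ∈ target .bai I.Z θ := by rw [hz]; exact Finset.mem_singleton_self z
    have : SoundBai I.Z θ z j (state I R y j) := by
      induction j with
      | zero => exact ⟨subset_rfl, (mem_target_bai.1 hzt).1, fun h => absurd rfl h⟩
      | succ j ih =>
        rw [state, hobj]
        exact ih.update hz (h j)
    exact this.soundState hz
  · rw [hobj] at h
    have : SoundLs α I.Z θ j (state I R y j) := by
      induction j with
      | zero =>
        refine ⟨subset_rfl, fun u => ?_, fun u => ?_, fun h => absurd rfl h⟩ <;>
          · simp only [state, Finset.notMem_empty, false_iff]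
            exact fun h => h.2.1 h.1
      | succ j ih =>
        rw [state, hobj]
        exact ih.update fun v hv => h j v (ih.subset hv) hv
    exact this.soundState

/-- Drives both termination, since the accuracy tends to 0 and the gap is positive, and the bound on
the number of rounds. -/
theorem SoundRun.gap_le_of_not_done (h : SoundRun I R θ y) (hwp : WellPosed I.obj I.Z θ) {j : ℕ}
    (hj : j ≠ 0) (hnd : ¬ Done I.obj (state I R y j)) : gap I.obj I.Z θ ≤ 2 * eps j := by
  have hs := h.soundState hwp j
  obtain ⟨v, hv⟩ := hs.nonempty hnd
  exact (gap_le (hs.directions_subset hv)).trans (hs.le_eps hj v hv)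

theorem tendsto_eps : Filter.Tendsto eps Filter.atTop (nhds 0) := by
  have : eps = fun j => ((1 / 2 : ℝ)) ^ j := by
    funext j
    simp [eps]
  rw [this]
  exact tendsto_pow_atTop_nhds_zero_of_lt_one (by norm_num) (by norm_num)

theorem SoundRun.exists_done (h : SoundRun I R θ y) (hwp : WellPosed I.obj I.Z θ) :
    ∃ j, Done I.obj (state I R y j) := by
  by_contra! hnd
  have hs := h.soundState hwp 0
  obtain ⟨v, hv⟩ := hs.nonempty (hnd 0)
  have hpos := gap_pos hwp ⟨v, hs.directions_subset hv⟩
  have hlim : Filter.Tendsto (fun j => 2 * eps j) Filter.atTop (nhds (2 * 0)) :=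
    tendsto_eps.const_mul 2
  rw [mul_zero] at hlim
  have : gap I.obj I.Z θ ≤ 0 := by
    refine ge_of_tendsto hlim ?_
    filter_upwards [Filter.eventually_ge_atTop 1] with j hj
    exact h.gap_le_of_not_done hwp (by omega) (hnd j)
  linarith

theorem SoundRun.exists_stopsAfter (h : SoundRun I R θ y) (hwp : WellPosed I.obj I.Z θ) :
    ∃ j, StopsAfter I R y j ∧ output I.obj (state I R y j) = target I.obj I.Z θ := by
  classical
  have hex := h.exists_done hwp
  refine ⟨Nat.find hex, ⟨Nat.find_spec hex, fun i hi => Nat.find_min hex hi⟩, ?_⟩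
  exact (h.soundState hwp _).output_eq (Nat.find_spec hex)

end Runs

/-! ### Sample complexity -/

section Complexity

variable {d : ℕ} {I : Input d} {R : Choices I.X} {y : Rewards I.X} {S : Matrix (Fin d) (Fin d) ℝ}
  {θ : Vec d}

theorem Input.Regular.psiStar_ne_top (h : I.Regular) (hS : ∀ x : I.X, 0 < armVar S x)
    (hwp : WellPosed I.obj I.Z θ) : psiStar I.obj I.X I.Z S θ ≠ ⊤ := by
  obtain ⟨mu, hmu, hpos⟩ := exists_pos_mem_stdSimplex h.nonempty
  refine ne_top_of_le_ne_top (ENNReal.sum_ne_top.2 fun v hv => ?_) ((iInf₂_le mu hmu).trans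
    (iSup₂_le fun v hv => Finset.single_le_sum (s := directions I.obj I.Z θ) (f := fun v =>
      invQuad (infoMatrix (fun x : I.X => (x : Vec d)) fun x => mu x / armVar S x) v /
        ENNReal.ofReal ((v ⬝ᵥ θ - I.obj.offset) ^ 2)) (fun _ _ => zero_le) hv))
  obtain ⟨w, hw⟩ := exists_mulVec_eq_of_pos h.span (fun x => div_pos (hpos x) (hS x)) v
  rw [invQuad_of_mulVec_eq hw]
  refine ENNReal.div_ne_top ENNReal.ofReal_ne_top (ENNReal.ofReal_pos.2 ?_).ne'
  exact sq_pos_of_ne_zero (dotProduct_directions_ne hwp hv)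

/-- The design problem of a round is bounded by the instance-dependent complexity. -/
theorem SoundState.toReal_optValue_le {j : ℕ} {st : State d}
    (hst : SoundState I.obj I.Z θ j st) (h : I.Regular) (hS : ∀ x : I.X, 0 < armVar S x)
    (hwp : WellPosed I.obj I.Z θ) (hacc : ∀ x : I.X, varEst I R y x ≤ 4 / 3 * armVar S x) {g : ℝ}
    (hg : 0 < g) (hgap : ∀ v ∈ directions I.obj st.active θ, |v ⬝ᵥ θ - I.obj.offset| ≤ g) :
    (optValue (varEst I R y) (roundSet I.obj st.active)).toReal ≤
      16 / 3 * g ^ 2 * (psiStar I.obj I.X I.Z S θ).toReal := by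
  rw [← div_le_iff₀' (by positivity)]
  -- Working with any r > ψ* avoids having to show that the infimum over designs is attained.
  refine le_of_forall_gt_imp_ge_of_dense fun r hr => ?_
  have hr0 : 0 ≤ r := ENNReal.toReal_nonneg.trans hr.le
  rw [div_le_iff₀' (by positivity)]
  have hlt : psiStar I.obj I.X I.Z S θ < ENNReal.ofReal r :=
    (ENNReal.lt_ofReal_iff_toReal_lt (h.psiStar_ne_top hS hwp)).2 hr
  unfold psiStar at hlt
  simp only [iInf_lt_iff] at hlt
  obtain ⟨lam, hlam, hlt⟩ := hlt
  have hlam0 : ∀ x : I.X, 0 ≤ lam x / armVar S x := fun x => div_nonneg (hlam.1 x) (hS x).le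
  have hdir : ∀ u, (u = 0 ∨ u ∈ directions I.obj st.active θ) →
      QuadBound (fun x : I.X => (x : Vec d)) (fun x => lam x / armVar S x) u (r * g ^ 2) := by
    rintro u (rfl | hu)
    · intro w
      rw [zero_dotProduct, zero_pow two_ne_zero]
      exact mul_nonneg (by positivity) (sum_mul_dotProduct_sq_nonneg hlam0 w)
    · have huZ := hst.directions_subset hu
      have h1 := (le_iSup₂ (f := fun v (_ : v ∈ directions I.obj I.Z θ) =>
        invQuad (infoMatrix (fun x : I.X => (x : Vec d)) fun x => lam x / armVar S x) v /
        ENNReal.ofReal ((v ⬝ᵥ θ - I.obj.offset) ^ 2)) u huZ).trans hlt.le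
      have hpos : 0 < (u ⬝ᵥ θ - I.obj.offset) ^ 2 :=
        sq_pos_of_ne_zero (dotProduct_directions_ne hwp huZ)
      rw [ENNReal.div_le_iff (ENNReal.ofReal_pos.2 hpos).ne' ENNReal.ofReal_ne_top,
        ← ENNReal.ofReal_mul hr0] at h1
      refine ((invQuad_le_iff hlam0 (by positivity)).1 h1).mono hlam0 ?_
      have := hgap u hu
      rw [← sq_abs]
      gcongr
  refine HRage.toReal_optValue_le (fun x => h.varEst_pos y x) hlam (by positivity) fun v hv => ?_
  obtain ⟨u, u', hu, hu', rfl⟩ := hst.roundSet_eq v hv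
  -- The constant 16/3 is 4 from the difference of two directions times 4/3 from replacing σ² by its
  -- estimate.
  refine ((hdir u hu).sub (hdir u' hu')).of_le fun x => ?_
  have h1 : lam x / armVar S x ≤ 4 / 3 * (lam x / varEst I R y x) := by
    rw [← mul_div_assoc, div_le_div_iff₀ (hS x) (h.varEst_pos y x)]
    have := mul_le_mul_of_nonneg_left (hacc x) (hlam.1 x)
    linarith
  calc 4 * (r * g ^ 2) * (lam x / armVar S x)
      ≤ 4 * (r * g ^ 2) * (4 / 3 * (lam x / varEst I R y x)) :=
        mul_le_mul_of_nonneg_left h1 (by positivity)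
    _ = _ := by ring

/-- After at least one round this is the invariant 2ε_j = 4ε_{j+1}. Before the first round nothing
has been learned, and the assumption that all gaps are at most 2 = 4ε_1 takes its place. -/
theorem SoundRun.abs_le_four_mul_eps (h : SoundRun I R θ y) (hwp : WellPosed I.obj I.Z θ)
    (htwo : ∀ v ∈ directions I.obj I.Z θ, |v ⬝ᵥ θ - I.obj.offset| ≤ 2) (j : ℕ) {v : Vec d}
    (hv : v ∈ directions I.obj (state I R y j).active θ) :
    |v ⬝ᵥ θ - I.obj.offset| ≤ 4 * eps (j + 1) := by
  have hs := h.soundState hwp j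
  have h4 : 4 * eps (j + 1) = 2 * eps j := by rw [eps_succ j]; ring
  rw [h4]
  rcases Nat.eq_zero_or_pos j with rfl | hj
  · have := htwo v (hs.directions_subset hv)
    simpa [eps] using this
  · exact hs.le_eps hj.ne' v hv

theorem Choices.Valid.supportSize_le_two_mul (hR : R.Valid) (hd : 0 < d) {s : I.X → ℝ}
    (hs : ∀ x, 0 < s x) (V : Finset (Vec d)) :
    (supportSize (R.design s V) : ℝ) ≤ 2 * (d : ℝ) ^ 2 := by
  have h1 := hR.supportSize_le hs (V := V)
  have h2 : d * (d + 1) / 2 + 1 ≤ 2 * d ^ 2 := by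
    have h3 : d * (d + 1) ≤ 2 * d ^ 2 := by nlinarith
    have h4 : 1 ≤ d ^ 2 := Nat.one_le_pow _ _ hd
    omega
  exact_mod_cast h1.trans h2

/-- With g = 4ε the design value is at most (16/3) · 16 ε² ψ*; the factor 3ε⁻² in τ_ℓ turns this
into 256 ψ*. The term 2d² pays for rounding on the support. -/
theorem SoundRun.sum_roundPulls_le (hrun : SoundRun I R θ y) (h : I.Regular) (hR : R.Valid)
    (hS : ∀ x : I.X, 0 < armVar S x) (hwp : WellPosed I.obj I.Z θ)
    (htwo : ∀ v ∈ directions I.obj I.Z θ, |v ⬝ᵥ θ - I.obj.offset| ≤ 2)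
    (hacc : ∀ x : I.X, varEst I R y x ≤ 4 / 3 * armVar S x) (j : ℕ)
    (hlog : 0 ≤ Real.log (8 * ((j + 1 : ℕ) : ℝ) ^ 2 * I.Z.card / I.δ)) :
    ((∑ x, roundPulls I R y (j + 1) (state I R y j) x : ℕ) : ℝ) ≤
      256 * (psiStar I.obj I.X I.Z S θ).toReal *
        Real.log (8 * ((j + 1 : ℕ) : ℝ) ^ 2 * I.Z.card / I.δ) + 2 * d ^ 2 := by
  have hs := fun x => h.varEst_pos (R := R) y x
  have hopt := hR.opt _ hs (roundSet I.obj (state I R y j).active)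
  refine (sum_ceil_le hopt.1 (h.roundTau_nonneg y (Nat.succ_ne_zero j) _)).trans
    (add_le_add ?_ (hR.supportSize_le_two_mul h.dim_pos hs _))
  have he := eps_pos (j + 1)
  have hq := (hrun.soundState hwp j).toReal_optValue_le (y := y) (R := R) h hS hwp hacc
    (g := 4 * eps (j + 1)) (by positivity)
    fun v hv => hrun.abs_le_four_mul_eps hwp htwo j hv
  unfold roundTau
  refine mul_le_mul_of_nonneg_right ?_ hlog
  refine (mul_le_mul_of_nonneg_left hq (by positivity)).trans (le_of_eq ?_)
  field_simp
  ring

theorem log_ratio_nonneg (h : I.Regular) : 0 ≤ Real.log (I.Z.card / I.δ) := by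
  rcases Nat.eq_zero_or_pos I.Z.card with hZ | hZ
  · simp [hZ]
  · refine Real.log_nonneg ?_
    have : (1 : ℝ) ≤ I.Z.card := by exact_mod_cast hZ
    rw [le_div_iff₀ h.δ_pos]
    linarith [h.δ_lt_one]

/-- If round j = k + 2 is needed, the loop was not done after k + 1 rounds, so Δ ≤ 2ε_{k+1} = 2^{-k}
and k log 2 ≤ L. The two extra rounds are absorbed by L ≥ 2. -/
theorem SoundRun.rounds_le (hrun : SoundRun I R θ y) (hwp : WellPosed I.obj I.Z θ) {j : ℕ}
    (hj : StopsAfter I R y j) :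
    (j : ℝ) ≤ 3 * max (Real.log (gap I.obj I.Z θ)⁻¹) 2 := by
  set L := max (Real.log (gap I.obj I.Z θ)⁻¹) 2 with hL
  have hL2 : 2 ≤ L := le_max_right _ _
  have hL1 : Real.log (gap I.obj I.Z θ)⁻¹ ≤ L := le_max_left _ _
  rcases Nat.lt_or_ge j 2 with hj2 | hj2
  · have : (j : ℝ) ≤ 2 := by exact_mod_cast hj2.le
    linarith
  obtain ⟨k, rfl⟩ : ∃ k, j = k + 2 := ⟨j - 2, by omega⟩
  have hnd := hj.2 (k + 1) (by omega)
  have hle := hrun.gap_le_of_not_done hwp (Nat.succ_ne_zero k) hnd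
  -- `gap` is 0 by default when there are no directions; its positivity needs one.
  have hne : (directions I.obj I.Z θ).Nonempty :=
    ((hrun.soundState hwp (k + 1)).nonempty hnd).mono
      (hrun.soundState hwp (k + 1)).directions_subset
  have hpos := gap_pos hwp hne
  rw [← eps_succ] at hle
  have h1 : (2 : ℝ) ^ k ≤ (gap I.obj I.Z θ)⁻¹ := by
    rw [le_inv_comm₀ (by positivity) hpos]
    exact hle
  have h2 := Real.log_le_log (by positivity) h1
  rw [Real.log_pow] at h2
  have h3 := Real.log_two_gt_d9
  have h4 : (k : ℝ) * 0.69 ≤ k * Real.log 2 :=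
    mul_le_mul_of_nonneg_left (by linarith) (Nat.cast_nonneg k)
  push_cast
  linarith

theorem SoundRun.totalPulls_le (hrun : SoundRun I R θ y) (h : I.Regular) (hR : R.Valid)
    (hc : 0 ≤ I.c) (hS : ∀ x : I.X, 0 < armVar S x) (hwp : WellPosed I.obj I.Z θ)
    (htwo : ∀ v ∈ directions I.obj I.Z θ, |v ⬝ᵥ θ - I.obj.offset| ≤ 2)
    (hacc : ∀ x : I.X, varEst I R y x ≤ 4 / 3 * armVar S x) {j : ℕ} (hj : StopsAfter I R y j) :
    (totalPulls I R y j : ℝ) ≤ (6912 + 2 * I.c) * complexity I S θ := by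
  have hrounds := hrun.rounds_le hwp hj
  unfold complexity
  simp only
  set L := max (Real.log (gap I.obj I.Z θ)⁻¹) 2 with hL
  have hL2 : 2 ≤ L := le_max_right _ _
  set ψ := (psiStar I.obj I.X I.Z S θ).toReal with hψ
  have hψ0 : 0 ≤ ψ := ENNReal.toReal_nonneg
  have hδ := h.δ_pos
  have hd1 : (1 : ℝ) ≤ d := by exact_mod_cast h.dim_pos
  have hdd : (1 : ℝ) ≤ (d : ℝ) ^ 2 := one_le_pow₀ hd1
  have hZlog := log_ratio_nonneg h
  have hlogL : Real.log 2 ≤ Real.log L := Real.log_le_log (by norm_num) hL2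
  have hlogL0 : 0 < Real.log L := lt_of_lt_of_le (Real.log_pos (by norm_num)) hlogL
  set M := Real.log (I.Z.card / I.δ) + Real.log L with hM
  have hM0 : 0 ≤ M := by positivity
  have hXlog : 0 ≤ Real.log (I.X.card / I.δ) := by
    refine Real.log_nonneg ?_
    have : (1 : ℝ) ≤ I.X.card := by exact_mod_cast h.nonempty.card_pos
    rw [le_div_iff₀ hδ]
    linarith [h.δ_lt_one]
  have hB0 : 0 ≤ I.kappa ^ 2 * (d : ℝ) ^ 2 * Real.log (I.X.card / I.δ) := by positivity
  have hhalf : (I.half : ℝ) ≤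
      I.c * (I.kappa ^ 2 * (d : ℝ) ^ 2 * Real.log (I.X.card / I.δ)) + 1 := by
    refine (Nat.ceil_lt_add_one ?_).le.trans (le_of_eq ?_)
    · positivity
    · ring
  have hone : ((∑ x, stageOnePulls I R x : ℕ) : ℝ) ≤ I.half + 2 * (d : ℝ) ^ 2 := by
    have hopt := hR.opt (fun _ => 1) (fun _ => one_pos) I.X
    have h1 := sum_ceil_le hopt.1 (Nat.cast_nonneg (α := ℝ) I.half)
    have h2 := hR.supportSize_le_two_mul h.dim_pos (s := fun _ => 1) (fun _ => one_pos) I.X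
    simp only [stageOnePulls, mul_comm _ (I.half : ℝ)]
    linarith
  have htwo' : ((∑ x, R.alloc I.half x : ℕ) : ℝ) ≤ I.half := by
    exact_mod_cast hR.alloc_le I.half
  have hround : ∀ i ∈ Finset.range j,
      ((∑ x, roundPulls I R y (i + 1) (state I R y i) x : ℕ) : ℝ) ≤
        2304 * (ψ * M) + 2 * (d : ℝ) ^ 2 := by
    intro i hi
    rw [Finset.mem_range] at hi
    have hZ : 0 < I.Z.card := by
      have hnd := hj.2 0 (by omega)
      obtain ⟨v, hv⟩ := (hrun.soundState hwp 0).nonempty hnd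
      have : 0 < (directions I.obj I.Z θ).card := Finset.card_pos.2 ⟨v, hv⟩
      exact this.trans_le (card_directions_le hwp)
    have hZr : (1 : ℝ) ≤ I.Z.card := by exact_mod_cast hZ
    have hi1 : (1 : ℝ) ≤ (i + 1 : ℕ) := by exact_mod_cast Nat.succ_pos i
    have hij : ((i + 1 : ℕ) : ℝ) ≤ 3 * L := by
      refine le_trans ?_ hrounds
      exact_mod_cast hi
    have hratio : 0 < (I.Z.card : ℝ) / I.δ := by positivity
    have hlog0 : 0 ≤ Real.log (8 * ((i + 1 : ℕ) : ℝ) ^ 2 * I.Z.card / I.δ) := by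
      refine Real.log_nonneg ?_
      rw [le_div_iff₀ hδ]
      have h3 : (1 : ℝ) ≤ ((i + 1 : ℕ) : ℝ) ^ 2 * I.Z.card := by nlinarith
      linarith [h.δ_lt_one]
    -- Since ℓ ≤ 3L, 8ℓ² ≤ 72 L² ≤ 2⁷ L², whose logarithm is at most 9 log L because L ≥ 2. Then 256
    -- · 9 = 2304, and 3L rounds give 6912.
    have hlogle : Real.log (8 * ((i + 1 : ℕ) : ℝ) ^ 2 * I.Z.card / I.δ) ≤ 9 * M := by
      have h1 : 8 * ((i + 1 : ℕ) : ℝ) ^ 2 * I.Z.card / I.δ ≤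
          2 ^ 7 * L ^ 2 * (I.Z.card / I.δ) := by
        rw [mul_div_assoc]
        have : ((i + 1 : ℕ) : ℝ) ^ 2 ≤ (3 * L) ^ 2 := by gcongr
        refine mul_le_mul_of_nonneg_right ?_ hratio.le
        nlinarith
      have h2 := Real.log_le_log (by positivity) h1
      rw [Real.log_mul (by positivity) hratio.ne', Real.log_mul (by norm_num) (by positivity),
        Real.log_pow, Real.log_pow] at h2
      simp only [Nat.cast_ofNat] at h2
      linarith
    refine (hrun.sum_roundPulls_le h hR hS hwp htwo hacc i hlog0).trans ?_
    have := mul_le_mul_of_nonneg_left hlogle (show 0 ≤ 256 * ψ by positivity)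
    linarith
  have hsum : ((∑ i ∈ Finset.range j, ∑ x, roundPulls I R y (i + 1) (state I R y i) x : ℕ) : ℝ) ≤
      3 * L * (2304 * (ψ * M) + 2 * (d : ℝ) ^ 2) := by
    rw [Nat.cast_sum]
    refine (Finset.sum_le_sum hround).trans ?_
    rw [Finset.sum_const, Finset.card_range, nsmul_eq_mul]
    exact mul_le_mul_of_nonneg_right hrounds (by positivity)
  have htot : (totalPulls I R y j : ℝ) = ((∑ x, stageOnePulls I R x : ℕ) : ℝ) +
      ((∑ x, R.alloc I.half x : ℕ) : ℝ) +
      ((∑ i ∈ Finset.range j, ∑ x, roundPulls I R y (i + 1) (state I R y i) x : ℕ) : ℝ) := by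
    rw [totalPulls]
    push_cast
    ring
  have hA0 : 0 ≤ ψ * L * M := by positivity
  have hLd : 2 * (d : ℝ) ^ 2 ≤ L * (d : ℝ) ^ 2 := mul_le_mul_of_nonneg_right hL2 (by positivity)
  have hcA := mul_nonneg hc hA0
  have hcL : 0 ≤ I.c * (L * (d : ℝ) ^ 2) := by positivity
  have e : (6912 + 2 * I.c) * (ψ * L * M + L * (d : ℝ) ^ 2 +
      Real.log (I.X.card / I.δ) * I.kappa ^ 2 * (d : ℝ) ^ 2) =
      6912 * (ψ * L * M) + 2 * (I.c * (ψ * L * M)) + 6912 * (L * (d : ℝ) ^ 2) +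
      2 * (I.c * (L * (d : ℝ) ^ 2)) +
      6912 * (I.kappa ^ 2 * (d : ℝ) ^ 2 * Real.log (I.X.card / I.δ)) +
      2 * (I.c * (I.kappa ^ 2 * (d : ℝ) ^ 2 * Real.log (I.X.card / I.δ))) := by ring
  rw [e, htot]
  have e2 : 3 * L * (2304 * (ψ * M) + 2 * (d : ℝ) ^ 2) =
      6912 * (ψ * L * M) + 6 * (L * (d : ℝ) ^ 2) := by ring
  rw [e2] at hsum
  linarith

end Complexity

/-! ### The guarantee -/

section Guarantee

variable {d : ℕ} {I : Input d} {R : Choices I.X} {S : Matrix (Fin d) (Fin d) ℝ} {θ : Vec d}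
  {Ω : Type*} [MeasurableSpace Ω] {P : Measure Ω} [IsProbabilityMeasure P]
  {η : ℕ → I.X → ℕ → Ω → ℝ}

/-- Uses subadditivity only, so the success event need not be measurable. -/
theorem ofReal_one_sub_le_of_compl {δ : ℝ} (hδ : 0 ≤ δ) {T : Set Ω}
    (h : P Tᶜ ≤ ENNReal.ofReal δ) : ENNReal.ofReal (1 - δ) ≤ P T := by
  rw [ENNReal.ofReal_sub _ hδ, ENNReal.ofReal_one, tsub_le_iff_right]
  calc (1 : ℝ≥0∞) = P (T ∪ Tᶜ) := by rw [Set.union_compl_self, measure_univ]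
    _ ≤ P T + P Tᶜ := measure_union_le _ _
    _ ≤ P T + ENNReal.ofReal δ := by gcongr

/-- With probability at least `1 - δ` the variance estimates are accurate and no round misjudges
a direction. -/
theorem Input.Regular.ofReal_le_measure_sound (h : I.Regular) (hR : R.Valid)
    (hc : 3000000 ≤ I.c) (hcase : 2 * I.δ ≤ I.X.card ∨ I.vmin = I.vmax)
    (hsymm : ∀ i j, S i j = S j i)
    (hS : ∀ x : I.X, I.vmin ≤ armVar S x ∧ armVar S x ≤ I.vmax) (hη : IsNoise P S η)
    (hwp : WellPosed I.obj I.Z θ) :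
    ENNReal.ofReal (1 - I.δ) ≤ P {ω | (∀ x : I.X,
      |varEst I R (rewards θ η ω) x - armVar S x| ≤ I.vmin / 3) ∧
        SoundRun I R θ (rewards θ η ω)} := by
  have hδ := h.δ_pos
  have hS0 : ∀ x : I.X, 0 ≤ armVar S x := fun x => h.vmin_pos.le.trans (hS x).1
  obtain ⟨hmeas, hvar⟩ := h.measure_varEst_le hR hc hcase hsymm hS hη (θ := θ)
  refine ofReal_one_sub_le_of_compl hδ.le ?_
  -- Without items there is nothing to misjudge; the logarithms with |Z| = 0 would not be positive,
  -- so this case is kept apart.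
  rcases I.Z.eq_empty_or_nonempty with hZ | hZ
  · have hdir : directions I.obj I.Z θ = ∅ := by
      rw [← Finset.card_eq_zero]
      have := card_directions_le hwp
      rw [hZ, Finset.card_empty] at this
      rw [hZ]
      omega
    refine (measure_mono ?_).trans (hvar.trans (ENNReal.ofReal_le_ofReal (by linarith)))
    intro ω hω hacc
    refine hω ⟨hacc, fun j v hv => ?_⟩
    rw [hdir] at hv
    exact absurd hv (Finset.notMem_empty v)
  · have hround := h.measure_iUnion_roundFailure_le hmeas hR hZ hS0 hη hwp
    have hsub : {ω | (∀ x : I.X, |varEst I R (rewards θ η ω) x - armVar S x| ≤ I.vmin / 3) ∧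
        SoundRun I R θ (rewards θ η ω)}ᶜ ⊆
        {ω | ¬ ∀ x : I.X, |varEst I R (rewards θ η ω) x - armVar S x| ≤ I.vmin / 3} ∪
        {ω | ∃ j, rewards θ η ω ∈ roundFailure I R S θ j} := by
      intro ω hω
      by_contra hno
      simp only [Set.mem_union, Set.mem_ofPred_eq, not_or, not_not, not_exists] at hno
      refine hω ⟨hno.1, fun j v hv hvA => ?_⟩
      by_contra! hlt
      -- An error of σ_min²/3 ≤ σ²/3 leaves σ̂² ≥ (2/3) σ², the accuracy required in `roundFailure`.
      refine hno.2 j ⟨fun x => ?_, v, hv, hvA, hlt⟩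
      have h1 := abs_le.1 (hno.1 x)
      have h2 := (hS x).1
      linarith
    refine (measure_mono hsub).trans ((measure_union_le _ _).trans
      ((add_le_add hvar hround).trans ?_))
    rw [← ENNReal.ofReal_add (by positivity) (by positivity)]
    exact ENNReal.ofReal_le_ofReal (by linarith)

end Guarantee

end HRage

theorem theorem3 :
    ∃ c₀ : ℝ, 0 < c₀ ∧ ∀ c : ℝ, c₀ ≤ c → ∃ C : ℝ, 0 < C ∧
      ∀ (d : ℕ) (_ : 0 < d)
        (X Z : Finset (HRage.Vec d)) (_ : Submodule.span ℝ (X : Set (HRage.Vec d)) = ⊤)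
        (obj : HRage.Objective)
        (S : Matrix (Fin d) (Fin d) ℝ) (_ : S.PosSemidef)
        (vmin vmax : ℝ) (_ : 0 < vmin)
        (_ : ∀ x ∈ X, vmin ≤ HRage.armVar S x ∧ HRage.armVar S x ≤ vmax)
        (δ : ℝ) (_ : 0 < δ) (_ : δ < 1)
        (_ : 2 * δ ≤ X.card ∨ vmin = vmax)
        (R : HRage.Choices X) (_ : R.Valid)
        (Ω : Type*) (_ : MeasurableSpace Ω) (P : Measure Ω) (_ : IsProbabilityMeasure P)
        (η : ℕ → X → ℕ → Ω → ℝ) (_ : HRage.IsNoise P S η)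
        (θ : HRage.Vec d) (_ : HRage.WellPosed obj Z θ),
        let I : HRage.Input d := ⟨X, Z, obj, vmin, vmax, δ, c⟩
        ENNReal.ofReal (1 - δ) ≤
            P {ω | ∃ j, HRage.StopsAfter I R (HRage.rewards θ η ω) j ∧
              HRage.output obj (HRage.state I R (HRage.rewards θ η ω) j) =
                HRage.target obj Z θ} ∧
          ((∀ v ∈ HRage.directions obj Z θ, |v ⬝ᵥ θ - obj.offset| ≤ 2) →
            ENNReal.ofReal (1 - δ) ≤
              P {ω | ∃ j, HRage.StopsAfter I R (HRage.rewards θ η ω) j ∧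
                HRage.output obj (HRage.state I R (HRage.rewards θ η ω) j) =
                  HRage.target obj Z θ ∧
                (HRage.totalPulls I R (HRage.rewards θ η ω) j : ℝ) ≤
                  C * HRage.complexity I S θ}) := by
  -- The first constant comes from the sub-exponential tail of the squared noise; 6912 comes from
  -- the rounds, and 2c from the two burn-in stages.
  refine ⟨3000000, by norm_num, fun c hc => ⟨6912 + 2 * c, by linarith, ?_⟩⟩
  intro d hd X Z hspan obj S hS vmin vmax hvmin hvar δ hδ0 hδ1 hcase R hR Ω _ P _ η hη θ hwp I
  have hsymm : ∀ i j, S i j = S j i := fun i j => by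
    simpa using (hS.isHermitian.apply i j).symm
  obtain ⟨x₀, hx₀⟩ := HRage.nonempty_of_span hd hspan
  have hreg : I.Regular :=
    ⟨hd, hspan, hvmin, (hvar x₀ hx₀).1.trans (hvar x₀ hx₀).2, hδ0, hδ1⟩
  have hS' : ∀ x : I.X, I.vmin ≤ HRage.armVar S x ∧ HRage.armVar S x ≤ I.vmax :=
    fun x => hvar x x.2
  have hS0 : ∀ x : I.X, 0 < HRage.armVar S x := fun x => hvmin.trans_le (hS' x).1
  have hsound := hreg.ofReal_le_measure_sound (R := R) (θ := θ) hR hc hcase hsymm hS' hη hwp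
  refine ⟨hsound.trans (measure_mono fun ω hω => ?_),
    fun htwo => hsound.trans (measure_mono fun ω hω => ?_)⟩
  · exact hω.2.exists_stopsAfter hwp
  · obtain ⟨j, hj, hout⟩ := hω.2.exists_stopsAfter hwp
    refine ⟨j, hj, hout, hω.2.totalPulls_le hreg hR (by linarith) hS0 hwp htwo (fun x => ?_) hj⟩
    have h1 := abs_le.1 (hω.1 x)
    have h2 := (hS' x).1
    linarith
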